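/- Let $G$ be a compact connected Lie group and let $\sigma_1,\sigma_2$ be two commuting Lie group automorphisms of $G$, where $\sigma_1$ is an involution ($\sigma_1^2=\mathrm{id}$) and $\sigma_2$ has finite order. Let $\mathfrak g_{\mathbb R}$ be the Lie algebra of $G$ and $\mathfrak g=\mathfrak g_{\mathbb R}\otimes_{\mathbb R}\mathbb C$ its complexification; for a closed subgroup $H\subseteq G$ write $\mathfrak h\subseteq\mathfrak g$ for the complexification of its Lie algebra. The differentials of $\sigma_1,\sigma_2$ at the identity and their complex linear extensions are again denoted by $\sigma_1,\sigma_2$. Let $K$ be the identity component of $G^{\sigma_1}\cap G^{\sigma_2}$, let $S$ be a maximal torus of $K$, let $K_1$ be the identity component of $G^{\sigma_1}$, and put $T_1=Z_{K_1}(S)$ and $T=Z_G(T_1)$ (these are maximal tori of $K_1$ and of $G$, respectively). Fix an $\mathrm{Ad}_G$-invariant, $\sigma_1$- and $\sigma_2$-invariant, negative definite symmetric bilinear form $\langle\cdot,\cdot\rangle$ on $\mathfrak g_{\mathbb R}$ and extend it $\mathbb C$-bilinearly to $\mathfrak g$. For $\alpha\in\mathfrak t^*$ put $\mathfrak g_\alpha=\{x\in\mathfrak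 g : [h,x]=\alpha(h)x \text{ for all } h\in\mathfrak t\}$, let $\Delta=\{\alpha\in\mathfrak t^*\setminus\{0\} : \mathfrak g_\alpha\neq 0\}$ be the set of roots, and let $\Omega\subseteq\Delta$ be the set of roots that vanish on $\mathfrak s$. Fix a disjoint decomposition $\Omega=\Omega^+\cup(-\Omega^+)$. For $\alpha\in\Delta$ let $H_\alpha\in\mathfrak t$ be the vector determined by $\langle H_\alpha,h\rangle=\alpha(h)$ for all $h\in\mathfrak t$. Then the following hold. 1. For every $\alpha\in\Omega$, the root space $\mathfrak g_\alpha$ is contained in the $(-1)$-eigenspace of $\sigma_1$ on $\mathfrak g$. 2. For every $\alpha\in\Omega$ one has $\sigma_1\alpha=\alpha$, that is, $\sigma_1^{-1}(\mathfrak t)\subseteq\mathfrak t$ and $\alpha\circ\sigma_1^{-1}=\alpha$ on $\mathfrak t$. 3. Any two distinct roots $\alpha,\beta\in\Omega$ are strongly orthogonal: neither $\alpha+\beta$ nor $\alpha-\beta$ is a root. 4. For every root $\alpha\in\Delta$ the vector $H_\alpha$ exists and is unique, and $$\mathfrak t=\bigcap_{\alpha\in\Omega^+}\ker\alpha\ \oplus\bigoplus_{\alpha\in\Omega^+}\mathbb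 C H_\alpha .$$ -/

import Mathlib

open scoped Manifold ContDiff TensorProduct

namespace CommutingAutomorphisms

noncomputable section

section Group

variable {G : Type*} [Group G]

/-- The subgroup `G^σ` of fixed points of an automorphism `σ` of `G`. -/
def fixedSubgroup (σ : MulAut G) : Subgroup G :=
  σ.toMonoidHom.eqLocus (MonoidHom.id G)

/-- The centralizer `Z_H(S)` of `S` in the subgroup `H`, as a subgroup of the ambient group. -/
def centralizerIn (H S : Subgroup G) : Subgroup G :=
  H ⊓ Subgroup.centralizer (S : Set G)

variable [TopologicalSpace G]

/-- A torus in a compact Lie group `G`: a compact, connected, abelian subgroup.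
(Compact subgroups are closed, hence are Lie subgroups.) -/
structure IsTorus (S : Subgroup G) : Prop where
  isCompact : IsCompact (S : Set G)
  isConnected : IsConnected (S : Set G)
  comm : ∀ x ∈ S, ∀ y ∈ S, x * y = y * x

/-- `S` is a maximal torus of the subgroup `K`. -/
def IsMaximalTorusOf (S K : Subgroup G) : Prop :=
  Maximal (fun S' : Subgroup G => IsTorus S' ∧ S' ≤ K) S

/-- The identity component `H₀` of a subgroup `H` of `G`, as a subgroup of `G`. -/
def identityComponent [IsTopologicalGroup G] (H : Subgroup G) : Subgroup G :=
  (Subgroup.connectedComponentOfOne H).map H.subtype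

end Group

section LieGroup

variable (E : Type*) [NormedAddCommGroup E] [NormedSpace ℝ E]
  (G : Type*) [TopologicalSpace G] [ChartedSpace E G] [Group G] [LieGroup 𝓘(ℝ, E) ∞ G]

instance instLieGroupMinSmoothness : LieGroup 𝓘(ℝ, E) (minSmoothness ℝ 3) G :=
  LieGroup.of_le (n := ∞) (by
    rw [minSmoothness_of_isRCLikeNormedField]
    exact WithTop.coe_le_coe.2 (le_top : (3 : ℕ∞) ≤ ⊤))

/-- The real Lie algebra `𝔤_ℝ` of `G`. -/
abbrev RealLieAlg : Type _ := GroupLieAlgebra 𝓘(ℝ, E) G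

/-- The complexified Lie algebra `𝔤 = ℂ ⊗ 𝔤_ℝ` of `G`. -/
abbrev ComplexLieAlg : Type _ := ℂ ⊗[ℝ] RealLieAlg E G

variable {G}

/-- The differential at `1` of an automorphism `μ` of `G`, as an endomorphism of `𝔤_ℝ`
(using `μ 1 = 1`). -/
def differential (μ : MulAut G) : RealLieAlg E G →ₗ[ℝ] RealLieAlg E G :=
  (show E →L[ℝ] E from mfderiv 𝓘(ℝ, E) 𝓘(ℝ, E) μ 1).toLinearMap

/-- The `ℂ`-linear extension to `𝔤` of the differential of an automorphism of `G`. -/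
def complexDifferential (μ : MulAut G) : ComplexLieAlg E G →ₗ[ℂ] ComplexLieAlg E G :=
  (differential E μ).baseChange ℂ

/-- The adjoint representation: `Ad_g` is the differential of conjugation by `g`. -/
def Ad (g : G) : RealLieAlg E G →ₗ[ℝ] RealLieAlg E G :=
  differential E (MulAut.conj g)

/-- The velocity `γ'(0)` of a curve `γ` in `G` with `γ 0 = 1`, as an element of `𝔤_ℝ`. -/
def velocity (γ : ℝ → G) : RealLieAlg E G :=
  (show ℝ →L[ℝ] E from mfderiv 𝓘(ℝ, ℝ) 𝓘(ℝ, E) γ 0) 1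

variable {E}

theorem velocity_mul {γ δ : ℝ → G} (hγ : ContMDiff 𝓘(ℝ, ℝ) 𝓘(ℝ, E) ∞ γ)
    (hδ : ContMDiff 𝓘(ℝ, ℝ) 𝓘(ℝ, E) ∞ δ) (hγ0 : γ 0 = 1) (hδ0 : δ 0 = 1) :
    velocity E (fun t => γ t * δ t) = velocity E γ + velocity E δ := by
  have hn : (∞ : ℕ∞ω) ≠ 0 := by simp
  have h1 : MDifferentiableAt 𝓘(ℝ, ℝ) 𝓘(ℝ, E) γ 0 := hγ.mdifferentiableAt hn
  have h2 : MDifferentiableAt 𝓘(ℝ, ℝ) 𝓘(ℝ, E) δ 0 := hδ.mdifferentiableAt hn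
  have hm : MDifferentiableAt (𝓘(ℝ, E).prod 𝓘(ℝ, E)) 𝓘(ℝ, E)
      (fun p : G × G => p.1 * p.2) (γ 0, δ 0) :=
    (contMDiff_mul 𝓘(ℝ, E) ∞).mdifferentiableAt hn
  have hp : mfderiv 𝓘(ℝ, ℝ) (𝓘(ℝ, E).prod 𝓘(ℝ, E)) (fun t => (γ t, δ t)) 0
      = (mfderiv 𝓘(ℝ, ℝ) 𝓘(ℝ, E) γ 0).prod (mfderiv 𝓘(ℝ, ℝ) 𝓘(ℝ, E) δ 0) :=
    h1.mfderiv_prod h2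
  have hc := mfderiv_comp_apply (I := 𝓘(ℝ, ℝ)) (I' := 𝓘(ℝ, E).prod 𝓘(ℝ, E)) (I'' := 𝓘(ℝ, E))
    (f := fun t : ℝ => (γ t, δ t)) (x := (0 : ℝ)) hm (h1.prodMk h2) (1 : ℝ)
  rw [mfderiv_prod_eq_add_apply hm, hp] at hc
  have hr : ∀ a b : G, a = 1 → HasMFDerivAt 𝓘(ℝ, E) 𝓘(ℝ, E) (fun z : G => z * a) b
      (ContinuousLinearMap.id ℝ E) := by
    rintro a b rfl
    exact (hasMFDerivAt_id b).congr_of_eventuallyEq (Filter.Eventually.of_forall fun z => mul_one z)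
  have hl : ∀ a b : G, a = 1 → HasMFDerivAt 𝓘(ℝ, E) 𝓘(ℝ, E) (fun z : G => a * z) b
      (ContinuousLinearMap.id ℝ E) := by
    rintro a b rfl
    exact (hasMFDerivAt_id b).congr_of_eventuallyEq (Filter.Eventually.of_forall fun z => one_mul z)
  refine Eq.trans hc ?_
  exact congrArg₂ (fun x y : E => x + y)
    (congrArg (fun f : E →L[ℝ] E => f (velocity E γ)) (hr (δ 0) (γ 0) hδ0).mfderiv)
    (congrArg (fun f : E →L[ℝ] E => f (velocity E δ)) (hl (γ 0) (δ 0) hγ0).mfderiv)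

set_option linter.unusedSectionVars false in
theorem velocity_const_mul {γ : ℝ → G} (hγ : ContMDiff 𝓘(ℝ, ℝ) 𝓘(ℝ, E) ∞ γ) (c : ℝ) :
    velocity E (fun t => γ (c * t)) = c • velocity E γ := by
  have hn : (∞ : ℕ∞ω) ≠ 0 := by simp
  have hd : HasDerivAt (fun t : ℝ => c * t) c 0 := by
    simpa using (hasDerivAt_id (0 : ℝ)).const_mul c
  have h0 : c * 0 = 0 := mul_zero c
  have h1 : HasMFDerivAt 𝓘(ℝ, ℝ) 𝓘(ℝ, E) γ (c * 0)
      (show ℝ →L[ℝ] E from mfderiv 𝓘(ℝ, ℝ) 𝓘(ℝ, E) γ 0) := by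
    rw [h0]
    exact (hγ.mdifferentiableAt hn).hasMFDerivAt
  have h2 : HasMFDerivAt 𝓘(ℝ, ℝ) 𝓘(ℝ, ℝ) (fun t : ℝ => c * t) 0
      (ContinuousLinearMap.toSpanSingleton ℝ c) := hd.hasFDerivAt.hasMFDerivAt
  have hc := (HasMFDerivAt.comp (0 : ℝ) h1 h2).mfderiv
  refine (congrArg (fun f : ℝ →L[ℝ] E => f 1) hc).trans ?_
  have h3 : (ContinuousLinearMap.toSpanSingleton ℝ c) (1 : ℝ) = c • (1 : ℝ) := by simp
  exact (congrArg (show ℝ →L[ℝ] E from mfderiv 𝓘(ℝ, ℝ) 𝓘(ℝ, E) γ 0) h3).trans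
    (map_smul (show ℝ →L[ℝ] E from mfderiv 𝓘(ℝ, ℝ) 𝓘(ℝ, E) γ 0) c 1)

variable (E)

/-- The Lie algebra `𝔥_ℝ ⊆ 𝔤_ℝ` of a (closed) subgroup `H` of `G`, that is, its tangent space at
`1`: the set of velocities `γ'(0)` of smooth curves `γ` in `G` with `γ 0 = 1` that run in `H`. -/
def realLieSubspace (H : Subgroup G) : Submodule ℝ (RealLieAlg E G) where
  carrier := {X | ∃ γ : ℝ → G, ContMDiff 𝓘(ℝ, ℝ) 𝓘(ℝ, E) ∞ γ ∧ γ 0 = 1 ∧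
    (∀ t, γ t ∈ H) ∧ velocity E γ = X}
  zero_mem' := ⟨fun _ => 1, contMDiff_const, rfl, fun _ => H.one_mem, by
    simp [velocity, mfderiv_const]; rfl⟩
  add_mem' := by
    rintro _ _ ⟨γ, hγ, hγ0, hγH, rfl⟩ ⟨δ, hδ, hδ0, hδH, rfl⟩
    exact ⟨fun t => γ t * δ t, hγ.mul hδ, by simp [hγ0, hδ0],
      fun t => H.mul_mem (hγH t) (hδH t), velocity_mul hγ hδ hγ0 hδ0⟩
  smul_mem' := by
    rintro c _ ⟨γ, hγ, hγ0, hγH, rfl⟩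
    refine ⟨fun t => γ (c * t), hγ.comp ?_, by simp [hγ0], fun t => hγH _,
      velocity_const_mul hγ c⟩
    exact (contDiff_const.mul contDiff_id).contMDiff

/-- The complexification `𝔥 ⊆ 𝔤` of the Lie algebra of a (closed) subgroup `H` of `G`. -/
def lieSubspace (H : Subgroup G) : Submodule ℂ (ComplexLieAlg E G) :=
  (realLieSubspace E H).baseChange ℂ

end LieGroup

section Roots

variable {L : Type*} [LieRing L] [LieAlgebra ℂ L]

/-- The simultaneous eigenspace `𝔤_α = {x ∈ 𝔤 | [h, x] = α(h) x for all h ∈ 𝔱}`. -/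
def rootSpace (t : Submodule ℂ L) (α : Module.Dual ℂ t) : Submodule ℂ L where
  carrier := {x | ∀ h : t, ⁅(h : L), x⁆ = α h • x}
  zero_mem' := by simp
  add_mem' := by
    intro x y hx hy h
    rw [lie_add, hx h, hy h, smul_add]
  smul_mem' := by
    intro c x hx h
    rw [lie_smul, hx h, smul_comm]

/-- The set `Δ` of `𝔱`-roots of `𝔤`. -/
def roots (t : Submodule ℂ L) : Set (Module.Dual ℂ t) :=
  {α | α ≠ 0 ∧ rootSpace t α ≠ ⊥}

/-- The set `Ω` of `𝔱`-roots of `𝔤` that vanish on `𝔰`. -/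
def rootsVanishingOn (t s : Submodule ℂ L) : Set (Module.Dual ℂ t) :=
  {α | α ∈ roots t ∧ ∀ h : t, (h : L) ∈ s → α h = 0}

/-- Two roots are strongly orthogonal if neither their sum nor their difference is a root. -/
def StronglyOrthogonal (t : Submodule ℂ L) (α β : Module.Dual ℂ t) : Prop :=
  α + β ∉ roots t ∧ α - β ∉ roots t

/-- `v ∈ 𝔱` is the vector `H_α` dual to `α` with respect to the bilinear form `B`. -/
def IsDualVector (t : Submodule ℂ L) (B : LinearMap.BilinForm ℂ L) (α : Module.Dual ℂ t)
    (v : t) : Prop :=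
  ∀ h : t, B (v : L) (h : L) = α h

/-- The family consisting of `⋂_{α ∈ P} ker α` and of the lines `ℂ H_α`, `α ∈ P`. -/
def kernelAndLines (t : Submodule ℂ L) (P : Set (Module.Dual ℂ t)) (H : P → t) :
    Option P → Submodule ℂ t
  | none => ⨅ α ∈ P, LinearMap.ker α
  | some α => Submodule.span ℂ {H α}

end Roots

end

end CommutingAutomorphisms

/-!
Everything takes place in the complexified Lie algebra `𝔤`. Write `Ω` for the roots vanishing on `𝔰`
and `t₁` for the Lie algebra of `T₁`.

Let `α ∈ Ω` and `x ∈ 𝔤_α`. The vector `u = x + σ₁ x` is fixed by `σ₁` and commutes with `𝔰`, so it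
lies in the complexification of `t₁`, which is abelian. As `σ₁` fixes `t₁` pointwise, `[h, u] = α(h) u`
for `h ∈ t₁`; hence `u = 0`, for otherwise `α` vanishes on `t₁`, and then `x` centralizes `t₁`, lies in
`𝔱` and forces `α = 0`. This is `InvolutionTorusData.baseChange_apply_eq_neg`. The bracket of two
`(-1)`-eigenvectors is fixed by `σ₁`, so for `α, β ∈ Ω` with `α + β ≠ 0` one has `[𝔤_α, 𝔤_β] = 0`
(`InvolutionTorusData.lie_rootSpace_eq_zero`). With `y ∈ 𝔤_β`, the element `[y, ȳ]` is a nonzero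
multiple of `H_β` and commutes with `𝔤_γ` for every `γ ∈ Ω` other than `±β`; thus `γ(H_β) = 0`
(`InvolutionTorusData.apply_dualVector_eq_zero`). Since `α(H_α) ≠ 0`, no sum of two elements of `Ω` is
a root, and `𝔱` splits as claimed (`isInternal_kernelAndLines`).

This needs three facts about the real Lie algebras: `t₁` is the centralizer of `𝔰_ℝ` in the fixed
algebra of `σ₁`, `𝔱_ℝ` is the centralizer of `t₁`, and `𝔱_ℝ` is abelian.

* A compact Lie algebra with a finite order automorphism whose fixed points are central is abelian
  (`lie_eq_zero_of_fixed_central`). As `S` is a maximal torus of `K`, the fixed points of `σ₂` in `t₁`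
  lie in `𝔰_ℝ`, so `t₁` is abelian; the fixed points of `σ₁` in `𝔱_ℝ` lie in `t₁`, so `𝔱_ℝ` is abelian
  (`InvolutionTorusData.of_maximal`).
* The Lie algebra of a closed subgroup consists of the generators of its one-parameter subgroups
  (`mem_subLie_iff`).
* The exponential map of a closed connected subgroup of `G` is onto (`exists_lieExp_eq`), and an
  element of `K₁` centralizing `S` is the exponential of a vector that commutes with `𝔰_ℝ`
  (`exists_lieExp_eq_of_centralizes`). Both follow from Hunt's argument: a minimum of
  `c ↦ ⟨Ad c X, Z⟩` makes `Ad c X` commute with `Z`. Consequently commuting with `S` or with `T₁` can be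
  read off from Lie brackets.

The exponential map itself is built from integral curves of left-invariant vector fields, and the Lie
bracket is identified with the derivative of `Ad` (`hasDerivAt_adRep`).
-/

namespace CommutingAutomorphisms

noncomputable section

section LieGroups

open Filter Topology Set

/-! ### Local calculus -/

section LocalCalculus

variable {E : Type*} [NormedAddCommGroup E] [NormedSpace ℝ E]

/-- The derivative at `(x, e)` of a local multiplication `m` in its second variable: the matrix of
the left-invariant vector fields. -/
def leftMatrix (m : E × E → E) (e x : E) : E →L[ℝ] E :=
  (fderiv ℝ m (x, e)).comp (ContinuousLinearMap.inr ℝ E E)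

/-- The derivative at `(e, x)` of a local multiplication `m` in its first variable: the matrix of
the right-invariant vector fields. -/
def rightMatrix (m : E × E → E) (e x : E) : E →L[ℝ] E :=
  (fderiv ℝ m (e, x)).comp (ContinuousLinearMap.inl ℝ E E)

theorem contDiffAt_leftMatrix {m : E × E → E} {e : E} (hm : ContDiffAt ℝ ∞ m (e, e)) :
    ContDiffAt ℝ ∞ (leftMatrix m e) e := by
  have h1 : ContDiffAt ℝ ∞ (fderiv ℝ m) (e, e) := hm.fderiv_right (by simp)
  have h2 : ContDiffAt ℝ ∞ (fun x : E => fderiv ℝ m (x, e)) e :=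
    ContDiffAt.comp (f := fun x : E => (x, e)) e h1 (contDiffAt_id.prodMk contDiffAt_const)
  exact h2.clm_comp contDiffAt_const

theorem contDiffAt_rightMatrix {m : E × E → E} {e : E} (hm : ContDiffAt ℝ ∞ m (e, e)) :
    ContDiffAt ℝ ∞ (rightMatrix m e) e := by
  have h1 : ContDiffAt ℝ ∞ (fderiv ℝ m) (e, e) := hm.fderiv_right (by simp)
  have h2 : ContDiffAt ℝ ∞ (fun x : E => fderiv ℝ m (e, x)) e :=
    ContDiffAt.comp (f := fun x : E => (e, x)) e h1 (contDiffAt_const.prodMk contDiffAt_id)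
  exact h2.clm_comp contDiffAt_const

theorem leftMatrix_self {m : E × E → E} {e : E} (hm : ContDiffAt ℝ ∞ m (e, e))
    (h : ∀ᶠ z in 𝓝 e, m (e, z) = z) : leftMatrix m e e = ContinuousLinearMap.id ℝ E := by
  have hd := (hm.differentiableAt (by simp)).hasFDerivAt
  have h1 : HasFDerivAt (fun z => m (e, z)) (leftMatrix m e e) e :=
    HasFDerivAt.comp (f := fun z : E => (e, z)) e hd (hasFDerivAt_prodMk_right e e)
  exact h1.unique ((hasFDerivAt_id e).congr_of_eventuallyEq h)

theorem rightMatrix_self {m : E × E → E} {e : E} (hm : ContDiffAt ℝ ∞ m (e, e))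
    (h : ∀ᶠ z in 𝓝 e, m (z, e) = z) : rightMatrix m e e = ContinuousLinearMap.id ℝ E := by
  have hd := (hm.differentiableAt (by simp)).hasFDerivAt
  have h1 : HasFDerivAt (fun z => m (z, e)) (rightMatrix m e e) e :=
    HasFDerivAt.comp (f := fun z : E => (z, e)) e hd (hasFDerivAt_prodMk_left e e)
  exact h1.unique ((hasFDerivAt_id e).congr_of_eventuallyEq h)

/-- Symmetry of the mixed second derivative of the multiplication. -/
theorem fderiv_rightMatrix_apply {m : E × E → E} {e : E} (hm : ContDiffAt ℝ ∞ m (e, e)) (X Y : E) :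
    fderiv ℝ (fun x => rightMatrix m e x Y) e X = fderiv ℝ (fun x => leftMatrix m e x X) e Y := by
  have h1 : HasFDerivAt (fderiv ℝ m) (fderiv ℝ (fderiv ℝ m) (e, e)) (e, e) :=
    ((hm.fderiv_right (m := ∞) (by simp)).differentiableAt (by simp)).hasFDerivAt
  have hr : HasFDerivAt (fun x => rightMatrix m e x Y)
      (((ContinuousLinearMap.apply ℝ E ((Y, 0) : E × E)).comp (fderiv ℝ (fderiv ℝ m) (e, e))).comp
        (ContinuousLinearMap.inr ℝ E E)) e :=
    ((ContinuousLinearMap.apply ℝ E ((Y, 0) : E × E)).hasFDerivAt.comp _ h1).comp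
      (f := fun x : E => (e, x)) e (hasFDerivAt_prodMk_right e e)
  have hl : HasFDerivAt (fun x => leftMatrix m e x X)
      (((ContinuousLinearMap.apply ℝ E ((0, X) : E × E)).comp (fderiv ℝ (fderiv ℝ m) (e, e))).comp
        (ContinuousLinearMap.inl ℝ E E)) e :=
    ((ContinuousLinearMap.apply ℝ E ((0, X) : E × E)).hasFDerivAt.comp _ h1).comp
      (f := fun x : E => (x, e)) e (hasFDerivAt_prodMk_left e e)
  rw [hr.fderiv, hl.fderiv]
  have hs : IsSymmSndFDerivAt ℝ m (e, e) := hm.isSymmSndFDerivAt (by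
    rw [minSmoothness_of_isRCLikeNormedField]; exact WithTop.coe_le_coe.2 le_top)
  simpa using hs.eq (0, X) (Y, 0)

variable [CompleteSpace E]

/-- The solutions of `x' = A(x) X`, `x(0) = e` with small `X` exist up to a common time `ε`, and at
each time `τ ∈ [0, ε]` they depend on `X` strictly differentiably at `X = 0`. -/
theorem exists_flow_hasStrictFDerivAt {A : E → E →L[ℝ] E} {e : E} (hA : ContDiffAt ℝ 1 A e)
    (hAe : A e = ContinuousLinearMap.id ℝ E) {U : Set E} (hU : U ∈ 𝓝 e) :
    ∃ ε > (0 : ℝ), ∃ Ψ : E → ℝ → E,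
      (∀ᶠ X in 𝓝 (0 : E), Ψ X 0 = e ∧ ∀ t ∈ Icc (-ε) ε, Ψ X t ∈ U ∧
        HasDerivWithinAt (Ψ X) (A (Ψ X t) X) (Icc (-ε) ε) t) ∧
      (∀ t ∈ Icc (-ε) ε, Ψ 0 t = e) ∧
      ∀ τ ∈ Icc 0 ε, HasStrictFDerivAt (fun X => Ψ X τ) (τ • ContinuousLinearMap.id ℝ E) 0 := by
  -- The parameter `X` becomes part of the state, so that the flow is Lipschitz in it.
  set F : E × E → E × E := fun p => (A p.1 p.2, 0) with hF
  have hFc : ContDiffAt ℝ 1 F (e, 0) := by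
    have hA' : ContDiffAt ℝ 1 (fun p : E × E => A p.1) (e, 0) :=
      ContDiffAt.comp (f := Prod.fst) (e, (0 : E)) hA contDiffAt_fst
    exact (hA'.clm_apply contDiffAt_snd).prodMk contDiffAt_const
  obtain ⟨ε₀, hε₀, a, r, L, K, hr, hPL⟩ := IsPicardLindelof.of_contDiffAt_one hFc
  obtain ⟨α, hα, L', hL'⟩ :=
    (hPL 0).exists_forall_mem_closedBall_eq_hasDerivWithinAt_lipschitzOnWith
  simp only [zero_sub, zero_add] at hα hL'
  obtain ⟨C, V, hV, hCV⟩ := hFc.exists_lipschitzOnWith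
  obtain ⟨M, W, hW, hMW⟩ := hA.exists_lipschitzOnWith
  have h00 : ((e, 0) : E × E) ∈ Metric.closedBall ((e, 0) : E × E) r :=
    Metric.mem_closedBall_self r.2
  -- The solution with parameter `0` is constant on a possibly shorter interval.
  obtain ⟨ε, hε, hεle, hconst⟩ : ∃ ε > (0 : ℝ), ε ≤ ε₀ ∧ ∀ t ∈ Icc (-ε) ε, α (e, 0) t = (e, 0) := by
    have hcont : ContinuousOn (α (e, 0)) (Icc (-ε₀) ε₀) :=
      fun t ht => ((hα _ h00).2 t ht).continuousWithinAt
    have hcat : ContinuousAt (α (e, 0)) 0 :=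
      hcont.continuousAt (Icc_mem_nhds (by linarith) hε₀)
    have hpre : α (e, 0) ⁻¹' V ∈ 𝓝 (0 : ℝ) :=
      hcat.preimage_mem_nhds (by rw [(hα _ h00).1]; exact hV)
    obtain ⟨δ, hδ, hδV⟩ := Metric.mem_nhds_iff.1 hpre
    refine ⟨min ε₀ (δ / 2), lt_min hε₀ (by linarith), min_le_left _ _, ?_⟩
    set ε := min ε₀ (δ / 2) with hεdef
    have hε : 0 < ε := lt_min hε₀ (by linarith)
    have hε1 : ε ≤ ε₀ := min_le_left _ _
    have hε2 : ε ≤ δ / 2 := min_le_right _ _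
    refine ODE_solution_unique_of_mem_Icc (v := fun _ => F) (s := fun _ => V) (K := C) (t₀ := 0)
      (fun _ _ => hCV) ⟨by linarith, hε⟩ (hcont.mono (Icc_subset_Icc (by linarith) hε1)) ?_ ?_
      continuousOn_const ?_ ?_ (hα _ h00).1
    · intro t ht
      exact ((hα _ h00).2 t ⟨by linarith [ht.1], by linarith [ht.2]⟩).hasDerivAt
        (Icc_mem_nhds (by linarith [ht.1]) (by linarith [ht.2]))
    · intro t ht
      apply hδV
      rw [Metric.mem_ball, Real.dist_eq, sub_zero, abs_lt]
      exact ⟨by linarith [ht.1], by linarith [ht.2]⟩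
    · intro t _
      have : F (e, 0) = 0 := by simp [hF]
      rw [this]
      exact hasDerivAt_const _ _
    · intro t _
      exact mem_of_mem_nhds hV
  have hsub : Icc (-ε) ε ⊆ Icc (-ε₀) ε₀ := Icc_subset_Icc (by linarith) hεle
  have h0mem : (0 : ℝ) ∈ Icc (-ε) ε := ⟨by linarith, hε.le⟩
  have hball : ∀ X ∈ Metric.closedBall (0 : E) r,
      ((e, X) : E × E) ∈ Metric.closedBall ((e, 0) : E × E) r := by
    intro X hX
    rw [Metric.mem_closedBall, dist_eq_norm] at hX ⊢
    rw [sub_zero] at hX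
    simpa [Prod.norm_def] using hX
  have hlip : ∀ X ∈ Metric.closedBall (0 : E) r, ∀ Y ∈ Metric.closedBall (0 : E) r,
      ∀ t ∈ Icc (-ε) ε, ‖(α (e, X) t).1 - (α (e, Y) t).1‖ ≤ L' * ‖X - Y‖ := by
    intro X hX Y hY t ht
    have h1 := (hL' t (hsub ht)).dist_le_mul _ (hball X hX) _ (hball Y hY)
    rw [dist_eq_norm, dist_eq_norm] at h1
    have h2 : ‖((e, X) : E × E) - (e, Y)‖ = ‖X - Y‖ := by simp [Prod.norm_def]
    rw [h2] at h1
    exact (norm_fst_le (α (e, X) t - α (e, Y) t)).trans h1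
  have hnear : ∀ X ∈ Metric.closedBall (0 : E) r, ∀ t ∈ Icc (-ε) ε,
      ‖(α (e, X) t).1 - e‖ ≤ L' * ‖X‖ := by
    intro X hX t ht
    have := hlip X hX 0 (Metric.mem_closedBall_self r.2) t ht
    rwa [hconst t ht, sub_zero] at this
  have hsnd : ∀ X ∈ Metric.closedBall (0 : E) r, ∀ t ∈ Icc (-ε) ε, (α (e, X) t).2 = X := by
    intro X hX t ht
    have hd : ∀ u ∈ Icc (-ε) ε, HasDerivWithinAt (fun u => (α (e, X) u).2) 0 (Icc (-ε) ε) u :=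
      fun u hu => (((hα _ (hball X hX)).2 u (hsub hu)).mono hsub).snd
    have := (convex_Icc (-ε) ε).norm_image_sub_le_of_norm_hasDerivWithin_le (C := 0) hd
      (fun u _ => by simp) h0mem ht
    rw [zero_mul, norm_le_zero_iff, sub_eq_zero] at this
    rw [this, (hα _ (hball X hX)).1]
  have hfst : ∀ X ∈ Metric.closedBall (0 : E) r, ∀ t ∈ Icc (-ε) ε,
      HasDerivWithinAt (fun u => (α (e, X) u).1) (A (α (e, X) t).1 X) (Icc (-ε) ε) t := by
    intro X hX t ht
    have h1 : HasDerivWithinAt (fun u => (α (e, X) u).1) (F (α (e, X) t)).1 (Icc (-ε) ε) t :=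
      (((hα _ (hball X hX)).2 t (hsub ht)).mono hsub).hasFDerivWithinAt.fst.hasDerivWithinAt.congr_deriv
        (by simp)
    simpa only [hF, hsnd X hX t ht] using h1
  have hev : ∀ {N : Set E}, N ∈ 𝓝 e → ∀ᶠ X in 𝓝 (0 : E), X ∈ Metric.closedBall (0 : E) r ∧
      ∀ t ∈ Icc (-ε) ε, (α (e, X) t).1 ∈ N := by
    intro N hN
    obtain ⟨δ, hδ, hδN⟩ := Metric.mem_nhds_iff.1 hN
    have hlim : Tendsto (fun X : E => (L' : ℝ) * ‖X‖) (𝓝 0) (𝓝 0) := by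
      have : Continuous fun X : E => (L' : ℝ) * ‖X‖ := by fun_prop
      simpa using this.tendsto 0
    filter_upwards [hlim.eventually_lt_const hδ, Metric.closedBall_mem_nhds (0 : E) hr] with X h1 h2
    refine ⟨h2, fun t ht => hδN ?_⟩
    rw [Metric.mem_ball, dist_eq_norm]
    exact (hnear X h2 t ht).trans_lt h1
  refine ⟨ε, hε, fun X t => (α (e, X) t).1, ?_, fun t ht => congrArg Prod.fst (hconst t ht), ?_⟩
  · filter_upwards [hev hU] with X hX
    exact ⟨by rw [(hα _ (hball X hX.1)).1], fun t ht => ⟨hX.2 t ht, hfst X hX.1 t ht⟩⟩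
  · intro τ hτ
    refine HasStrictFDerivAt.of_isLittleO (Asymptotics.isLittleO_iff.2 fun c hc => ?_)
    have hlim : Tendsto (fun p : E × E => ε * (M * L' * (‖p.1‖ + ‖p.2‖))) (𝓝 (0, 0)) (𝓝 0) := by
      have : Continuous fun p : E × E => ε * (M * L' * (‖p.1‖ + ‖p.2‖)) := by fun_prop
      simpa using this.tendsto (0, 0)
    have hevW := hev hW
    have h1 : ∀ᶠ p : E × E in 𝓝 (0, 0), p.1 ∈ Metric.closedBall (0 : E) r ∧
        ∀ t ∈ Icc (-ε) ε, (α (e, p.1) t).1 ∈ W :=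
      (continuous_fst.tendsto ((0 : E), (0 : E))).eventually hevW
    have h2 : ∀ᶠ p : E × E in 𝓝 (0, 0), p.2 ∈ Metric.closedBall (0 : E) r ∧
        ∀ t ∈ Icc (-ε) ε, (α (e, p.2) t).1 ∈ W :=
      (continuous_snd.tendsto ((0 : E), (0 : E))).eventually hevW
    filter_upwards [h1, h2, hlim.eventually_lt_const hc] with p hp1 hp2 hpc
    obtain ⟨X, Y⟩ := p
    have hd : ∀ t ∈ Icc (-ε) ε, HasDerivWithinAt
        (fun t => (α (e, X) t).1 - (α (e, Y) t).1 - t • (X - Y))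
        (A (α (e, X) t).1 X - A (α (e, Y) t).1 Y - (1 : ℝ) • (X - Y)) (Icc (-ε) ε) t :=
      fun t ht => ((hfst X hp1.1 t ht).sub (hfst Y hp2.1 t ht)).sub
        ((hasDerivWithinAt_id t _).smul_const (X - Y))
    -- `A` is close to the identity along both solutions, and their distance is `O(‖X - Y‖)`.
    have hb : ∀ t ∈ Icc (-ε) ε,
        ‖A (α (e, X) t).1 X - A (α (e, Y) t).1 Y - (1 : ℝ) • (X - Y)‖ ≤
          M * L' * (‖X‖ + ‖Y‖) * ‖X - Y‖ := by
      intro t ht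
      have e1 : A (α (e, X) t).1 X - A (α (e, Y) t).1 Y - (1 : ℝ) • (X - Y) =
          (A (α (e, X) t).1 - A (α (e, Y) t).1) X + (A (α (e, Y) t).1 - A e) (X - Y) := by
        rw [hAe]
        simp only [sub_apply, map_sub, ContinuousLinearMap.id_apply, one_smul]
        abel
      have b1 : ‖A (α (e, X) t).1 - A (α (e, Y) t).1‖ ≤ M * (L' * ‖X - Y‖) := by
        have := hMW.dist_le_mul _ (hp1.2 t ht) _ (hp2.2 t ht)
        rw [dist_eq_norm, dist_eq_norm] at this
        exact this.trans (mul_le_mul_of_nonneg_left (hlip X hp1.1 Y hp2.1 t ht) M.2)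
      have b2 : ‖A (α (e, Y) t).1 - A e‖ ≤ M * (L' * ‖Y‖) := by
        have := hMW.dist_le_mul _ (hp2.2 t ht) _ (mem_of_mem_nhds hW)
        rw [dist_eq_norm, dist_eq_norm] at this
        exact this.trans (mul_le_mul_of_nonneg_left (hnear Y hp2.1 t ht) M.2)
      rw [e1]
      calc _ ≤ M * (L' * ‖X - Y‖) * ‖X‖ + M * (L' * ‖Y‖) * ‖X - Y‖ :=
            (norm_add_le _ _).trans (add_le_add (ContinuousLinearMap.le_of_opNorm_le _ b1 _)
              (ContinuousLinearMap.le_of_opNorm_le _ b2 _))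
        _ = M * L' * (‖X‖ + ‖Y‖) * ‖X - Y‖ := by ring
    have := (convex_Icc (-ε) ε).norm_image_sub_le_of_norm_hasDerivWithin_le hd hb h0mem
      (⟨by linarith [hτ.1], hτ.2⟩ : τ ∈ Icc (-ε) ε)
    rw [(hα _ (hball X hp1.1)).1, (hα _ (hball Y hp2.1)).1] at this
    simp only [sub_self, zero_smul, sub_zero, Real.norm_eq_abs, abs_of_nonneg hτ.1] at this
    simp only [smul_apply, ContinuousLinearMap.id_apply]
    calc _ ≤ M * L' * (‖X‖ + ‖Y‖) * ‖X - Y‖ * τ := this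
      _ ≤ M * L' * (‖X‖ + ‖Y‖) * ‖X - Y‖ * ε := mul_le_mul_of_nonneg_left hτ.2 (by positivity)
      _ = ε * (M * L' * (‖X‖ + ‖Y‖)) * ‖X - Y‖ := by ring
      _ ≤ c * ‖X - Y‖ := mul_le_mul_of_nonneg_right hpc.le (norm_nonneg _)

end LocalCalculus

/-! ### Multiplication in the chart at the identity -/

section ChartAtOne

set_option linter.unusedSectionVars false

variable (E : Type*) [NormedAddCommGroup E] [NormedSpace ℝ E]
  {G : Type*} [TopologicalSpace G] [ChartedSpace E G] [Group G] [LieGroup 𝓘(ℝ, E) ∞ G]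

/-- The preferred chart of `G` around `1`. -/
abbrev chartOne (G : Type*) [TopologicalSpace G] [ChartedSpace E G] [Group G] : PartialEquiv G E :=
  extChartAt 𝓘(ℝ, E) (1 : G)

/-- The multiplication of `G` in the chart at `1`. -/
def localMul (G : Type*) [TopologicalSpace G] [ChartedSpace E G] [Group G] (p : E × E) : E :=
  chartOne E G ((chartOne E G).symm p.1 *
    (chartOne E G).symm p.2)

/-- The coordinates of `1` in the chart at `1`. -/
def oneCoord (G : Type*) [TopologicalSpace G] [ChartedSpace E G] [Group G] : E :=
  chartOne E G 1

theorem symm_oneCoord : (chartOne E G).symm (oneCoord E G) = 1 :=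
  extChartAt_to_inv 1

theorem target_mem_nhds : (chartOne E G).target ∈ 𝓝 (oneCoord E G) :=
  extChartAt_target_mem_nhds 1

theorem contMDiffAt_chart : ContMDiffAt 𝓘(ℝ, E) 𝓘(ℝ, E) ∞ (chartOne E G) 1 :=
  contMDiffAt_extChartAt

theorem contMDiffAt_chart_symm : ContMDiffAt 𝓘(ℝ, E) 𝓘(ℝ, E) ∞
    (chartOne E G).symm (oneCoord E G) :=
  (contMDiffOn_extChartAt_symm (1 : G)).contMDiffAt (target_mem_nhds E)

theorem contDiffAt_localMul : ContDiffAt ℝ ∞ (localMul E G) (oneCoord E G, oneCoord E G) := by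
  rw [← contMDiffAt_iff_contDiffAt]
  have h1 : ContMDiffAt 𝓘(ℝ, E × E) 𝓘(ℝ, E) ∞
      (fun p : E × E => (chartOne E G).symm p.1) (oneCoord E G, oneCoord E G) :=
    ContMDiffAt.comp (f := Prod.fst) (oneCoord E G, oneCoord E G) (contMDiffAt_chart_symm E)
      contDiffAt_fst.contMDiffAt
  have h2 : ContMDiffAt 𝓘(ℝ, E × E) 𝓘(ℝ, E) ∞
      (fun p : E × E => (chartOne E G).symm p.2) (oneCoord E G, oneCoord E G) :=
    ContMDiffAt.comp (f := Prod.snd) (oneCoord E G, oneCoord E G) (contMDiffAt_chart_symm E)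
      contDiffAt_snd.contMDiffAt
  refine ContMDiffAt.comp_of_eq (g := chartOne E G) (contMDiffAt_chart E) (h1.mul h2) ?_
  rw [symm_oneCoord, mul_one]

theorem localMul_one_left {z : E} (hz : z ∈ (chartOne E G).target) :
    localMul E G (oneCoord E G, z) = z := by
  simp only [localMul, symm_oneCoord, one_mul]
  exact (chartOne E G).right_inv hz

theorem localMul_one_right {z : E} (hz : z ∈ (chartOne E G).target) :
    localMul E G (z, oneCoord E G) = z := by
  simp only [localMul, symm_oneCoord, mul_one]
  exact (chartOne E G).right_inv hz

theorem localMul_chart {x y : G} (hx : x ∈ (chartOne E G).source)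
    (hy : y ∈ (chartOne E G).source) :
    localMul E G (chartOne E G x, chartOne E G y) =
      chartOne E G (x * y) := by
  simp only [localMul, (chartOne E G).left_inv hx,
    (chartOne E G).left_inv hy]

/-- The left-invariant vector field frame in the chart at `1`. -/
abbrev leftFrame (G : Type*) [TopologicalSpace G] [ChartedSpace E G] [Group G] (x : E) : E →L[ℝ] E :=
  leftMatrix (localMul E G) (oneCoord E G) x

/-- The right-invariant vector field frame in the chart at `1`. -/
abbrev rightFrame (G : Type*) [TopologicalSpace G] [ChartedSpace E G] [Group G] (x : E) :
    E →L[ℝ] E :=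
  rightMatrix (localMul E G) (oneCoord E G) x

theorem leftFrame_oneCoord : leftFrame E G (oneCoord E G) = ContinuousLinearMap.id ℝ E :=
  leftMatrix_self (contDiffAt_localMul E)
    (eventually_of_mem (target_mem_nhds E) fun _ hz => localMul_one_left E hz)

theorem rightFrame_oneCoord : rightFrame E G (oneCoord E G) = ContinuousLinearMap.id ℝ E :=
  rightMatrix_self (contDiffAt_localMul E)
    (eventually_of_mem (target_mem_nhds E) fun _ hz => localMul_one_right E hz)

theorem hasMFDerivAt_chart_one : HasMFDerivAt 𝓘(ℝ, E) 𝓘(ℝ, E) (chartOne E G) 1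
    (ContinuousLinearMap.id ℝ E) := by
  have h := (contMDiffAt_chart E (G := G)).mdifferentiableAt (by simp)
  refine ⟨h.continuousAt, ?_⟩
  have he : writtenInExtChartAt 𝓘(ℝ, E) 𝓘(ℝ, E) 1 (chartOne E G) =ᶠ[𝓝 (oneCoord E G)]
      id := by
    filter_upwards [target_mem_nhds E (G := G)] with z hz
    exact (chartOne E G).right_inv hz
  exact ((hasFDerivAt_id (oneCoord E G)).congr_of_eventuallyEq he).hasFDerivWithinAt

theorem tendsto_chart : Tendsto (chartOne E G) (𝓝 1) (𝓝 (oneCoord E G)) :=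
  continuousAt_extChartAt 1

/-- For `c` near `1`, the derivative of `z ↦ φ (c z)` at `1`. -/
theorem eventually_hasMFDerivAt_mul_left : ∀ᶠ c in 𝓝 (1 : G),
    HasMFDerivAt 𝓘(ℝ, E) 𝓘(ℝ, E) (fun z => chartOne E G (c * z)) 1
      (leftFrame E G (chartOne E G c)) := by
  have h0 : ∀ᶠ p in 𝓝 (oneCoord E G, oneCoord E G), DifferentiableAt ℝ (localMul E G) p := by
    have h1 := ((contDiffAt_localMul E (G := G)).of_le (m := 1) (by simp)).eventually (by simp)
    exact h1.mono fun p hp => hp.differentiableAt (by simp)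
  have h1 : Tendsto (fun c : G => (chartOne E G c, oneCoord E G)) (𝓝 1)
      (𝓝 (oneCoord E G, oneCoord E G)) := (tendsto_chart E).prodMk_nhds tendsto_const_nhds
  filter_upwards [h1.eventually h0, extChartAt_source_mem_nhds (I := 𝓘(ℝ, E)) (1 : G)] with c hc hs
  have h2 : HasFDerivAt (fun z => localMul E G (chartOne E G c, z))
      (leftFrame E G (chartOne E G c)) (oneCoord E G) :=
    HasFDerivAt.comp (f := fun z : E => (chartOne E G c, z)) (oneCoord E G)
      hc.hasFDerivAt (hasFDerivAt_prodMk_right _ _)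
  refine (HasMFDerivAt.comp (1 : G) h2.hasMFDerivAt (hasMFDerivAt_chart_one E)).congr_of_eventuallyEq
    ?_
  filter_upwards [extChartAt_source_mem_nhds (I := 𝓘(ℝ, E)) (1 : G)] with z hz
  exact (localMul_chart E hs hz).symm

/-- For `c` near `1`, the derivative of `z ↦ φ (z c)` at `1`. -/
theorem eventually_hasMFDerivAt_mul_right : ∀ᶠ c in 𝓝 (1 : G),
    HasMFDerivAt 𝓘(ℝ, E) 𝓘(ℝ, E) (fun z => chartOne E G (z * c)) 1
      (rightFrame E G (chartOne E G c)) := by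
  have h0 : ∀ᶠ p in 𝓝 (oneCoord E G, oneCoord E G), DifferentiableAt ℝ (localMul E G) p := by
    have h1 := ((contDiffAt_localMul E (G := G)).of_le (m := 1) (by simp)).eventually (by simp)
    exact h1.mono fun p hp => hp.differentiableAt (by simp)
  have h1 : Tendsto (fun c : G => (oneCoord E G, chartOne E G c)) (𝓝 1)
      (𝓝 (oneCoord E G, oneCoord E G)) := tendsto_const_nhds.prodMk_nhds (tendsto_chart E)
  filter_upwards [h1.eventually h0, extChartAt_source_mem_nhds (I := 𝓘(ℝ, E)) (1 : G)] with c hc hs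
  have h2 : HasFDerivAt (fun z => localMul E G (z, chartOne E G c))
      (rightFrame E G (chartOne E G c)) (oneCoord E G) :=
    HasFDerivAt.comp (f := fun z : E => (z, chartOne E G c)) (oneCoord E G)
      hc.hasFDerivAt (hasFDerivAt_prodMk_left _ _)
  refine (HasMFDerivAt.comp (1 : G) h2.hasMFDerivAt (hasMFDerivAt_chart_one E)).congr_of_eventuallyEq
    ?_
  filter_upwards [extChartAt_source_mem_nhds (I := 𝓘(ℝ, E)) (1 : G)] with z hz
  exact (localMul_chart E hz hs).symm

end ChartAtOne

/-! ### The exponential map -/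

section Exponential

set_option linter.unusedSectionVars false

variable (E : Type*) [NormedAddCommGroup E] [NormedSpace ℝ E] [FiniteDimensional ℝ E]
  {G : Type*} [TopologicalSpace G] [ChartedSpace E G] [Group G] [LieGroup 𝓘(ℝ, E) ∞ G]

/-- The left-invariant vector field with value `X` at `1`. -/
abbrev leftField (G : Type*) [TopologicalSpace G] [ChartedSpace E G] [Group G] (X : E) (g : G) :
    TangentSpace 𝓘(ℝ, E) g :=
  mulInvariantVectorField (I := 𝓘(ℝ, E)) (G := G) (show GroupLieAlgebra 𝓘(ℝ, E) G from X) g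

theorem contMDiff_leftField (X : E) : ContMDiff 𝓘(ℝ, E) 𝓘(ℝ, E).tangent 1
    (fun g : G => (⟨g, leftField E G X g⟩ : TangentBundle 𝓘(ℝ, E) G)) :=
  (contMDiff_mulInvariantVectorField (I := 𝓘(ℝ, E)) (G := G) X).of_le (by
    rw [minSmoothness_of_isRCLikeNormedField]; exact one_le_two)

theorem mdifferentiable_mul_left (c : G) : MDifferentiable 𝓘(ℝ, E) 𝓘(ℝ, E) (fun z : G => c * z) :=
  (contMDiff_mul_left (I := 𝓘(ℝ, E)) (n := ∞)).mdifferentiable (by simp)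

theorem mfderiv_mul_left_leftField (X : E) (c g : G) :
    mfderiv 𝓘(ℝ, E) 𝓘(ℝ, E) (fun z : G => c * z) g (leftField E G X g) = leftField E G X (c * g) := by
  have h := mfderiv_comp_apply (I := 𝓘(ℝ, E)) (I' := 𝓘(ℝ, E)) (I'' := 𝓘(ℝ, E))
    (g := fun z : G => c * z) (f := fun z : G => g * z) (x := (1 : G))
    (mdifferentiable_mul_left E c _) (mdifferentiable_mul_left E g _)
    (show TangentSpace 𝓘(ℝ, E) (1 : G) from X)
  have h2 : (fun z : G => c * z) ∘ (fun z : G => g * z) = fun z => c * g * z := by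
    ext z; simp [mul_assoc]
  rw [h2] at h
  simp only [leftField, mulInvariantVectorField]
  refine Eq.trans ?_ h.symm
  rw [mul_one]

theorem comp_smulRight_one {E F : Type*} [NormedAddCommGroup E] [NormedSpace ℝ E]
    [NormedAddCommGroup F] [NormedSpace ℝ F] (f : E →L[ℝ] F) (v : E) :
    f.comp ((1 : ℝ →L[ℝ] ℝ).smulRight v) = (1 : ℝ →L[ℝ] ℝ).smulRight (f v) := by
  ext; simp

/-- Left translates of integral curves of a left-invariant field are integral curves. -/
theorem isMIntegralCurveOn_mul_left {X : E} {γ : ℝ → G} {s : Set ℝ}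
    (h : IsMIntegralCurveOn γ (leftField E G X) s) (c : G) :
    IsMIntegralCurveOn (fun t => c * γ t) (leftField E G X) s := by
  intro t ht
  have h1 := HasMFDerivAt.comp_hasMFDerivWithinAt t
    ((mdifferentiable_mul_left E c (γ t)).hasMFDerivAt) (h t ht)
  refine h1.congr_mfderiv ?_
  exact (comp_smulRight_one (show E →L[ℝ] E from mfderiv 𝓘(ℝ, E) 𝓘(ℝ, E) (fun z : G => c * z) (γ t))
    (leftField E G X (γ t))).trans
    (congrArg (fun v : E => (1 : ℝ →L[ℝ] ℝ).smulRight v) (mfderiv_mul_left_leftField E X c (γ t)))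

/-- Left-invariant fields are complete: left translates of a local integral curve through `1` are
integral curves through every other point, all defined for the same time. -/
theorem exists_integralCurve [T2Space G] (X : E) :
    ∃ γ : ℝ → G, γ 0 = 1 ∧ IsMIntegralCurve γ (leftField E G X) := by
  obtain ⟨γ, h0, hγ⟩ := exists_isMIntegralCurveAt_of_contMDiffAt_boundaryless (I := 𝓘(ℝ, E))
    (v := leftField E G X) (x₀ := (1 : G)) 0 (contMDiff_leftField E X).contMDiffAt
  obtain ⟨ε, hε, hγ⟩ := isMIntegralCurveAt_iff'.1 hγ
  rw [Real.ball_eq_Ioo, zero_sub, zero_add] at hγ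
  exact exists_isMIntegralCurve_of_isMIntegralCurveOn (contMDiff_leftField E X) hε
    (fun x => ⟨fun t => x * γ t, by simp [h0], isMIntegralCurveOn_mul_left E hγ x⟩) 1

/-- The one-parameter subgroup of `G` with initial velocity `X`: the integral curve through `1` of
the left-invariant field of `X`. -/
def oneParam (G : Type*) [TopologicalSpace G] [ChartedSpace E G] [Group G]
    [LieGroup 𝓘(ℝ, E) ∞ G] [T2Space G] (X : E) : ℝ → G :=
  (exists_integralCurve E (G := G) X).choose

/-- The exponential map of `G`. -/
def lieExp (G : Type*) [TopologicalSpace G] [ChartedSpace E G] [Group G]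
    [LieGroup 𝓘(ℝ, E) ∞ G] [T2Space G] (X : E) : G :=
  oneParam E G X 1

variable [T2Space G]

theorem oneParam_zero (X : E) : oneParam E G X 0 = 1 := (exists_integralCurve E X).choose_spec.1

theorem isMIntegralCurve_oneParam (X : E) :
    IsMIntegralCurve (oneParam E G X) (leftField E G X) :=
  (exists_integralCurve E X).choose_spec.2

theorem eq_oneParam {X : E} {γ : ℝ → G} (h : IsMIntegralCurve γ (leftField E G X))
    (h0 : γ 0 = 1) : γ = oneParam E G X :=
  isMIntegralCurve_Ioo_eq_of_contMDiff_boundaryless (t₀ := 0) (contMDiff_leftField E X) h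
    (isMIntegralCurve_oneParam E X) (by rw [h0, oneParam_zero])

theorem oneParam_add (X : E) (a b : ℝ) :
    oneParam E G X (a + b) = oneParam E G X a * oneParam E G X b := by
  have h1 : IsMIntegralCurve (fun t => oneParam E G X a * oneParam E G X t) (leftField E G X) := by
    rw [isMIntegralCurve_iff_isMIntegralCurveOn]
    exact isMIntegralCurveOn_mul_left E ((isMIntegralCurve_oneParam E X).isMIntegralCurveOn _) _
  have h2 : IsMIntegralCurve (oneParam E G X ∘ (· + a)) (leftField E G X) :=
    (isMIntegralCurve_oneParam E X).comp_add a
  have := isMIntegralCurve_Ioo_eq_of_contMDiff_boundaryless (t₀ := 0) (contMDiff_leftField E X) h2 h1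
    (by simp [oneParam_zero])
  have := congrFun this b
  simpa [add_comm] using this

theorem oneParam_smul (X : E) (c t : ℝ) : oneParam E G (c • X) t = oneParam E G X (c * t) := by
  have h1 := (isMIntegralCurve_oneParam E (G := G) X).comp_mul c
  have h2 : c • leftField E G X = leftField E G (c • X) :=
    (mulInvariantVectorField_smul (I := 𝓘(ℝ, E)) (G := G) c X).symm
  rw [h2] at h1
  have := congrFun (eq_oneParam E h1 (by simp [oneParam_zero])) t
  rw [← this, Function.comp_apply, mul_comm]

theorem oneParam_eq_lieExp (X : E) (t : ℝ) : oneParam E G X t = lieExp E G (t • X) := by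
  rw [lieExp, oneParam_smul, mul_one]

theorem lieExp_zero : lieExp E G 0 = 1 := by
  rw [← oneParam_zero E (G := G) 0, oneParam_eq_lieExp, zero_smul]

theorem lieExp_add_smul (X : E) (a b : ℝ) :
    lieExp E G ((a + b) • X) = lieExp E G (a • X) * lieExp E G (b • X) := by
  simp only [← oneParam_eq_lieExp, oneParam_add]

theorem lieExp_neg (X : E) : lieExp E G (-X) = (lieExp E G X)⁻¹ := by
  have := lieExp_add_smul E (G := G) X 1 (-1)
  rw [add_neg_cancel, zero_smul, lieExp_zero, one_smul, neg_one_smul] at this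
  exact (inv_eq_of_mul_eq_one_right this.symm).symm

theorem lieExp_nsmul (n : ℕ) (X : E) : lieExp E G (n • X) = lieExp E G X ^ n := by
  induction n with
  | zero => simp [lieExp_zero]
  | succ n ih =>
    have := lieExp_add_smul E (G := G) X n 1
    rw [one_smul, Nat.cast_smul_eq_nsmul, ih] at this
    rw [pow_succ, ← this, ← Nat.cast_smul_eq_nsmul ℝ]
    push_cast
    rfl

theorem lieExp_zsmul (n : ℤ) (X : E) : lieExp E G (n • X) = lieExp E G X ^ n := by
  obtain ⟨m, rfl | rfl⟩ := n.eq_nat_or_neg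
  · rw [natCast_zsmul, lieExp_nsmul, zpow_natCast]
  · rw [neg_smul, lieExp_neg, natCast_zsmul, lieExp_nsmul, zpow_neg, zpow_natCast]

end Exponential

section ExponentialRegularity

set_option linter.unusedSectionVars false

variable (E : Type*) [NormedAddCommGroup E] [NormedSpace ℝ E] [FiniteDimensional ℝ E]
  {G : Type*} [TopologicalSpace G] [ChartedSpace E G] [Group G] [LieGroup 𝓘(ℝ, E) ∞ G]

theorem mdifferentiableAt_chartOne {c : G} (hc : c ∈ (chartOne E G).source) :
    MDifferentiableAt 𝓘(ℝ, E) 𝓘(ℝ, E) (chartOne E G) c :=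
  (contMDiffAt_extChartAt' (n := 1) (by simpa using hc)).mdifferentiableAt (by simp)

/-- In the chart at `1`, the left-invariant field of `X` is `x ↦ leftFrame x X`. -/
theorem eventually_mfderiv_chartOne_leftField : ∀ᶠ c in 𝓝 (1 : G), ∀ X : E,
    mfderiv 𝓘(ℝ, E) 𝓘(ℝ, E) (chartOne E G) c (leftField E G X c) =
      leftFrame E G (chartOne E G c) X := by
  filter_upwards [eventually_hasMFDerivAt_mul_left E (G := G),
    extChartAt_source_mem_nhds (I := 𝓘(ℝ, E)) (1 : G)] with c hc hs X
  have h1 : MDifferentiableAt 𝓘(ℝ, E) 𝓘(ℝ, E) (chartOne E G) (c * 1) :=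
    mdifferentiableAt_chartOne E (by rwa [mul_one])
  have h := mfderiv_comp_apply (I := 𝓘(ℝ, E)) (I' := 𝓘(ℝ, E)) (I'' := 𝓘(ℝ, E))
    (g := chartOne E G) (f := fun z : G => c * z) (x := (1 : G))
    h1 (mdifferentiable_mul_left E c _) (show TangentSpace 𝓘(ℝ, E) (1 : G) from X)
  have h2 : mfderiv 𝓘(ℝ, E) 𝓘(ℝ, E) (chartOne E G ∘ fun z : G => c * z) 1 =
    leftFrame E G (chartOne E G c) := hc.mfderiv
  rw [h2] at h
  refine Eq.trans ?_ h.symm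
  simp only [leftField, mulInvariantVectorField]
  rw [mul_one]

theorem eventually_mdifferentiableAt_chartOne_symm : ∀ᶠ x in 𝓝 (oneCoord E G),
    MDifferentiableAt 𝓘(ℝ, E) 𝓘(ℝ, E) (chartOne E G).symm x := by
  filter_upwards [eventually_mem_nhds_iff.2 (target_mem_nhds E (G := G))] with x hx
  exact ((contMDiffOn_extChartAt_symm (n := 1) (1 : G)).contMDiffAt hx).mdifferentiableAt (by simp)

theorem eventually_mfderiv_chartOne_symm_leftFrame : ∀ᶠ x in 𝓝 (oneCoord E G), ∀ X : E,
    mfderiv 𝓘(ℝ, E) 𝓘(ℝ, E) (chartOne E G).symm x (leftFrame E G x X) =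
      leftField E G X ((chartOne E G).symm x) := by
  have hsymm : Tendsto (chartOne E G).symm (𝓝 (oneCoord E G)) (𝓝 (1 : G)) := by
    have := (contMDiffAt_chart_symm E (G := G)).continuousAt
    rwa [ContinuousAt, symm_oneCoord] at this
  filter_upwards [hsymm.eventually (eventually_mfderiv_chartOne_leftField E (G := G)),
    eventually_mdifferentiableAt_chartOne_symm E (G := G), target_mem_nhds E (G := G)]
    with x h1 h2 hx X
  have hright : chartOne E G ((chartOne E G).symm x) = x := (chartOne E G).right_inv hx
  have hsrc : (chartOne E G).symm x ∈ (chartOne E G).source := (chartOne E G).map_target hx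
  specialize h1 X
  rw [hright] at h1
  have h := mfderiv_comp_apply (I := 𝓘(ℝ, E)) (I' := 𝓘(ℝ, E)) (I'' := 𝓘(ℝ, E))
    (g := (chartOne E G).symm) (f := chartOne E G) (x := (chartOne E G).symm x)
    (by rw [hright]; exact h2) (mdifferentiableAt_chartOne E hsrc)
    (leftField E G X ((chartOne E G).symm x))
  replace h := h.trans (congrArg (show E →L[ℝ] E from mfderiv 𝓘(ℝ, E) 𝓘(ℝ, E) (chartOne E G).symm
    (chartOne E G ((chartOne E G).symm x))) h1)
  have h3 : mfderiv 𝓘(ℝ, E) 𝓘(ℝ, E) ((chartOne E G).symm ∘ chartOne E G) ((chartOne E G).symm x) =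
      ContinuousLinearMap.id ℝ E := by
    refine ((hasMFDerivAt_id _).congr_of_eventuallyEq ?_).mfderiv
    filter_upwards [(isOpen_extChartAt_source (I := 𝓘(ℝ, E)) (1 : G)).mem_nhds hsrc] with z hz
    exact (chartOne E G).left_inv hz
  rw [h3] at h
  refine Eq.trans ?_ h.symm
  rw [hright]
  rfl

variable [T2Space G]

/-- Near `0` the exponential map takes values in the chart at `1`, and there it is strictly
differentiable at `0` with derivative the identity. -/
theorem lieExp_strict : (∀ᶠ X in 𝓝 (0 : E), lieExp E G X ∈ (chartOne E G).source) ∧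
    HasStrictFDerivAt (fun X => chartOne E G (lieExp E G X)) (ContinuousLinearMap.id ℝ E) 0 := by
  obtain ⟨ε, hε, Ψ, hΨ, hΨ0, hΨs⟩ := exists_flow_hasStrictFDerivAt
    ((contDiffAt_leftMatrix (contDiffAt_localMul E (G := G))).of_le (m := 1) (by simp))
    (leftFrame_oneCoord E (G := G))
    (inter_mem (target_mem_nhds E (G := G)) (inter_mem
      (eventually_mfderiv_chartOne_symm_leftFrame E (G := G))
      (eventually_mdifferentiableAt_chartOne_symm E (G := G))))
  set τ := ε / 2 with hτ
  have hτ0 : 0 < τ := by positivity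
  have key : ∀ᶠ X in 𝓝 (0 : E), Ψ X τ ∈ (chartOne E G).target ∧
      lieExp E G (τ • X) = (chartOne E G).symm (Ψ X τ) := by
    filter_upwards [hΨ] with X ⟨h0, hX⟩
    refine ⟨(hX τ ⟨by linarith, by linarith⟩).1.1, ?_⟩
    have hint : IsMIntegralCurveOn (fun t => (chartOne E G).symm (Ψ X t)) (leftField E G X)
        (Ioo (-ε) ε) := by
      intro t ht
      obtain ⟨⟨_, hf, hm⟩, hd⟩ := hX t (Ioo_subset_Icc_self ht)
      have hd' : HasDerivAt (Ψ X) (leftFrame E G (Ψ X t) X) t :=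
        hd.hasDerivAt (Icc_mem_nhds ht.1 ht.2)
      have h1 := HasMFDerivAt.comp t hm.hasMFDerivAt hd'.hasFDerivAt.hasMFDerivAt
      refine (h1.congr_mfderiv ?_).hasMFDerivWithinAt
      refine (comp_smulRight_one (show E →L[ℝ] E from
        mfderiv 𝓘(ℝ, E) 𝓘(ℝ, E) (chartOne E G).symm (Ψ X t)) _).trans
        (congrArg (fun v : E => (1 : ℝ →L[ℝ] ℝ).smulRight v) (hf X))
    have := isMIntegralCurveOn_Ioo_eqOn_of_contMDiff_boundaryless (t₀ := 0)
      (⟨by linarith, hε⟩ : (0 : ℝ) ∈ Ioo (-ε) ε) (contMDiff_leftField E X)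
      ((isMIntegralCurve_oneParam E (G := G) X).isMIntegralCurveOn _) hint
      (by rw [oneParam_zero, h0, symm_oneCoord])
    rw [← oneParam_eq_lieExp]
    exact this ⟨by linarith, by linarith⟩
  have hsc : Tendsto (fun Y : E => τ⁻¹ • Y) (𝓝 0) (𝓝 0) := by
    have : Continuous fun Y : E => τ⁻¹ • Y := by fun_prop
    simpa using this.tendsto 0
  have key' := hsc.eventually key
  constructor
  · filter_upwards [key'] with Y ⟨h1, h2⟩
    rw [smul_inv_smul₀ hτ0.ne'] at h2
    rw [h2]
    exact (chartOne E G).map_target h1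
  · have h1 : HasStrictFDerivAt (fun Y : E => τ⁻¹ • Y) (τ⁻¹ • ContinuousLinearMap.id ℝ E) 0 :=
      (hasStrictFDerivAt_id (𝕜 := ℝ) (0 : E)).const_smul τ⁻¹
    have h2 := hΨs τ ⟨by linarith, by linarith⟩
    have h3 : HasStrictFDerivAt (fun Y : E => Ψ (τ⁻¹ • Y) τ)
        ((τ • ContinuousLinearMap.id ℝ E).comp (τ⁻¹ • ContinuousLinearMap.id ℝ E)) 0 :=
      HasStrictFDerivAt.comp (g := fun X => Ψ X τ) (f := fun Y : E => τ⁻¹ • Y) 0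
        (by rwa [smul_zero]) h1
    have h4 : (τ • ContinuousLinearMap.id ℝ E).comp (τ⁻¹ • ContinuousLinearMap.id ℝ E) =
        ContinuousLinearMap.id ℝ E := by
      ext v; simp [smul_smul, hτ0.ne']
    rw [h4] at h3
    refine h3.congr_of_eventuallyEq ?_
    filter_upwards [key'] with Y ⟨h1, h2⟩
    rw [smul_inv_smul₀ hτ0.ne'] at h2
    rw [h2]
    exact ((chartOne E G).right_inv h1).symm

theorem tendsto_lieExp_zero : Tendsto (lieExp E G) (𝓝 0) (𝓝 1) := by
  have h1 := (lieExp_strict E (G := G)).2.continuousAt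
  have h2 : Tendsto (fun X => (chartOne E G).symm (chartOne E G (lieExp E G X))) (𝓝 0) (𝓝 1) := by
    have h3 := (contMDiffAt_chart_symm E (G := G)).continuousAt
    have h4 : ContinuousAt (fun X => (chartOne E G).symm (chartOne E G (lieExp E G X))) 0 := by
      refine ContinuousAt.comp_of_eq h3 h1 ?_
      rw [lieExp_zero]; rfl
    simpa [ContinuousAt, lieExp_zero] using h4
  refine h2.congr' ?_
  filter_upwards [(lieExp_strict E (G := G)).1] with X hX
  exact (chartOne E G).left_inv hX

theorem continuous_lieExp [IsTopologicalGroup G] : Continuous (lieExp E G) := by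
  obtain ⟨K, s, hs, hK⟩ := (lieExp_strict E (G := G)).2.exists_lipschitzOnWith
  have hnear : ∀ᶠ X in 𝓝 (0 : E), ContinuousAt (lieExp E G) X := by
    filter_upwards [eventually_mem_nhds_iff.2 hs, eventually_mem_nhds_iff.2
      (lieExp_strict E (G := G)).1] with X h1 h2
    have h3 : ContinuousAt (fun X => chartOne E G (lieExp E G X)) X :=
      hK.continuousOn.continuousAt h1
    have h4 : ContinuousAt (chartOne E G).symm (chartOne E G (lieExp E G X)) :=
      continuousAt_extChartAt_symm' (by simpa using mem_of_mem_nhds h2)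
    refine (ContinuousAt.comp (f := fun X => chartOne E G (lieExp E G X)) h4 h3).congr ?_
    filter_upwards [h2] with Y hY
    exact (chartOne E G).left_inv hY
  rw [continuous_iff_continuousAt]
  intro X
  have hlim : Tendsto (fun n : ℕ => ((n : ℝ) + 1)⁻¹ • X) atTop (𝓝 0) := by
    have := (tendsto_one_div_add_atTop_nhds_zero_nat (𝕜 := ℝ)).smul_const X
    simpa using this
  obtain ⟨n, hn⟩ := (hlim.eventually hnear).exists
  have h1 : lieExp E G = fun Y => lieExp E G (((n : ℝ) + 1)⁻¹ • Y) ^ (n + 1) := by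
    ext Y
    rw [← lieExp_nsmul, ← Nat.cast_smul_eq_nsmul ℝ, Nat.cast_add_one, smul_inv_smul₀ (by positivity)]
  rw [h1]
  exact (ContinuousAt.comp (f := fun Y : E => ((n : ℝ) + 1)⁻¹ • Y) hn (by fun_prop)).pow _

theorem continuous_oneParam (X : E) : Continuous (oneParam E G X) :=
  (isMIntegralCurve_oneParam E X).continuous

/-- One-parameter subgroups are smooth: near `0` they solve a smooth differential equation in the
chart, and elsewhere they are translates of that piece. -/
theorem contMDiff_oneParam (X : E) : ContMDiff 𝓘(ℝ, ℝ) 𝓘(ℝ, E) ∞ (oneParam E G X) := by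
  have h0 : ∀ n : ℕ, ContMDiffAt 𝓘(ℝ, ℝ) 𝓘(ℝ, E) n (oneParam E G X) 0 := by
    intro n
    obtain ⟨u, hu, hcu⟩ := ((contDiffAt_leftMatrix (contDiffAt_localMul E (G := G))).of_le (m := n)
      (WithTop.coe_le_coe.2 le_top)).contDiffOn le_rfl (by simp)
    have hcont : Tendsto (oneParam E G X) (𝓝 0) (𝓝 1) := by
      have := (continuous_oneParam E (G := G) X).tendsto 0
      rwa [oneParam_zero] at this
    have hev : ∀ᶠ t in 𝓝 (0 : ℝ), oneParam E G X t ∈ (chartOne E G).source ∧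
        chartOne E G (oneParam E G X t) ∈ u ∧
        HasDerivAt (fun t => chartOne E G (oneParam E G X t))
          (leftFrame E G (chartOne E G (oneParam E G X t)) X) t := by
      filter_upwards [hcont.eventually (extChartAt_source_mem_nhds (I := 𝓘(ℝ, E)) (1 : G)),
        hcont.eventually ((tendsto_chart E (G := G)).eventually hu),
        hcont.eventually (eventually_mfderiv_chartOne_leftField E (G := G))] with t h1 h2 h3
      refine ⟨h1, h2, ?_⟩
      have h4 := HasMFDerivAt.comp t (mdifferentiableAt_chartOne E h1).hasMFDerivAt
        (isMIntegralCurve_oneParam E (G := G) X t)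
      have h5 := h4.congr_mfderiv ((comp_smulRight_one (show E →L[ℝ] E from
        mfderiv 𝓘(ℝ, E) 𝓘(ℝ, E) (chartOne E G) (oneParam E G X t)) _).trans
        (congrArg (fun v : E => (1 : ℝ →L[ℝ] ℝ).smulRight v) (h3 X)))
      exact h5.hasFDerivAt
    obtain ⟨δ, hδ, hδ'⟩ := Metric.eventually_nhds_iff.1 hev
    have hI : ∀ t ∈ Icc (-(δ / 2)) (δ / 2), dist t 0 < δ := by
      intro t ht
      rw [Real.dist_eq, sub_zero, abs_lt]
      exact ⟨by linarith [ht.1], by linarith [ht.2]⟩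
    have hsm : ContDiffOn ℝ n (fun t => chartOne E G (oneParam E G X t))
        (Icc (-(δ / 2)) (δ / 2)) := by
      refine ODE.contDiffOn_enat_Icc_of_hasDerivWithinAt (n := n)
        (f := fun _ x => leftFrame E G x X) (u := u) ?_
        (fun t ht => (hδ' (hI t ht)).2.2.hasDerivWithinAt) (fun t ht => (hδ' (hI t ht)).2.1)
      exact (hcu.comp contDiffOn_snd (fun p hp => hp.2)).clm_apply contDiffOn_const
    have hsm0 : ContDiffAt ℝ n (fun t => chartOne E G (oneParam E G X t)) 0 :=
      hsm.contDiffAt (Icc_mem_nhds (by linarith) (by linarith))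
    have h6 : ContMDiffAt 𝓘(ℝ, ℝ) 𝓘(ℝ, E) n
        (fun t => (chartOne E G).symm (chartOne E G (oneParam E G X t))) 0 := by
      refine ContMDiffAt.comp_of_eq (g := (chartOne E G).symm)
        ((contMDiffAt_chart_symm E (G := G)).of_le (WithTop.coe_le_coe.2 le_top))
        hsm0.contMDiffAt ?_
      rw [oneParam_zero]; rfl
    refine h6.congr_of_eventuallyEq ?_
    filter_upwards [hev] with t ht
    exact ((chartOne E G).left_inv ht.1).symm
  have h0' : ContMDiffAt 𝓘(ℝ, ℝ) 𝓘(ℝ, E) ∞ (oneParam E G X) 0 := contMDiffAt_infty.2 h0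
  intro t₀
  have h1 : oneParam E G X = fun t => oneParam E G X t₀ * oneParam E G X (t - t₀) := by
    ext t
    rw [← oneParam_add, add_sub_cancel]
  rw [h1]
  have h2 : ContMDiffAt 𝓘(ℝ, ℝ) 𝓘(ℝ, E) ∞ (fun t => oneParam E G X (t - t₀)) t₀ := by
    refine ContMDiffAt.comp_of_eq (f := fun t : ℝ => t - t₀) h0' ?_ (sub_self _)
    exact (contDiffAt_id.sub contDiffAt_const).contMDiffAt
  exact contMDiffAt_const.mul h2

theorem hasMFDerivAt_oneParam_zero (X : E) : HasMFDerivAt 𝓘(ℝ, ℝ) 𝓘(ℝ, E) (oneParam E G X) 0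
    ((1 : ℝ →L[ℝ] ℝ).smulRight (show E from X)) := by
  have h := isMIntegralCurve_oneParam E (G := G) X 0
  have h1 : HasMFDerivAt 𝓘(ℝ, E) 𝓘(ℝ, E) (fun z : G => 1 * z) 1 (ContinuousLinearMap.id ℝ E) :=
    (hasMFDerivAt_id (1 : G)).congr_of_eventuallyEq (Eventually.of_forall fun z => one_mul z)
  have h2 : (leftField E G X (oneParam E G X 0) : E) = X := by
    rw [oneParam_zero]
    exact congrArg (fun f : E →L[ℝ] E => f X) h1.mfderiv
  exact h.congr_mfderiv (congrArg (fun v : E => (1 : ℝ →L[ℝ] ℝ).smulRight v) h2)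

theorem velocity_oneParam (X : E) : velocity E (oneParam E G X) = X := by
  have h := (hasMFDerivAt_oneParam_zero E (G := G) X).mfderiv
  refine (congrArg (fun f : ℝ →L[ℝ] E => f 1) h).trans ?_
  exact one_smul ℝ X

/-- A homomorphism `ℝ → G` that is differentiable at `0` is the one-parameter subgroup of its
velocity. -/
theorem eq_oneParam_of_hom {X : E} {ψ : ℝ → G} (hadd : ∀ a b, ψ (a + b) = ψ a * ψ b)
    (hψ0 : ψ 0 = 1) (hψ : MDifferentiableAt 𝓘(ℝ, ℝ) 𝓘(ℝ, E) ψ 0) (hX : velocity E ψ = X) :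
    ψ = oneParam E G X := by
  refine eq_oneParam E (fun t => ?_) hψ0
  have h1 : HasMFDerivAt 𝓘(ℝ, ℝ) 𝓘(ℝ, ℝ) (fun s : ℝ => s - t) t (ContinuousLinearMap.id ℝ ℝ) :=
    ((hasFDerivAt_id t).sub_const t).hasMFDerivAt
  have h2 : HasMFDerivAt 𝓘(ℝ, ℝ) 𝓘(ℝ, E) ψ (t - t)
      (show ℝ →L[ℝ] E from mfderiv 𝓘(ℝ, ℝ) 𝓘(ℝ, E) ψ 0) := by
    rw [sub_self]; exact hψ.hasMFDerivAt
  have h3 : HasMFDerivAt 𝓘(ℝ, E) 𝓘(ℝ, E) (fun z : G => ψ t * z) (ψ (t - t))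
      (show E →L[ℝ] E from mfderiv 𝓘(ℝ, E) 𝓘(ℝ, E) (fun z : G => ψ t * z) 1) := by
    rw [sub_self, hψ0]; exact (mdifferentiable_mul_left E (ψ t) 1).hasMFDerivAt
  have h4 := HasMFDerivAt.comp (f := ψ ∘ fun s : ℝ => s - t) t h3
    (HasMFDerivAt.comp (f := fun s : ℝ => s - t) t h2 h1)
  have h5 : (fun z : G => ψ t * z) ∘ (ψ ∘ fun s => s - t) = ψ := by
    ext s
    simp [← hadd]
  rw [h5] at h4
  refine h4.congr_mfderiv ?_
  refine ContinuousLinearMap.ext_ring (R₁ := ℝ) (M₁ := E) ?_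
  have h6 : (show ℝ →L[ℝ] E from mfderiv 𝓘(ℝ, ℝ) 𝓘(ℝ, E) ψ 0) 1 = X := hX
  have h7 : leftField E G X (ψ t) =
    (show E →L[ℝ] E from mfderiv 𝓘(ℝ, E) 𝓘(ℝ, E) (fun z : G => ψ t * z) 1) X := rfl
  refine Eq.trans (congrArg (fun v : E => (show E →L[ℝ] E from
    mfderiv 𝓘(ℝ, E) 𝓘(ℝ, E) (fun z : G => ψ t * z) 1) v) h6) ?_
  exact (one_smul ℝ ((show E →L[ℝ] E from
    mfderiv 𝓘(ℝ, E) 𝓘(ℝ, E) (fun z : G => ψ t * z) 1) X)).symm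

end ExponentialRegularity

/-! ### The adjoint representation and the Lie bracket -/

section Adjoint

set_option linter.unusedSectionVars false

variable (E : Type*) [NormedAddCommGroup E] [NormedSpace ℝ E] [FiniteDimensional ℝ E]
  {G : Type*} [TopologicalSpace G] [ChartedSpace E G] [Group G] [LieGroup 𝓘(ℝ, E) ∞ G]

/-- The differential at `1` of an automorphism, acting on the model space `E = T₁G`, which carries
the norm and the topology needed for calculus. -/
def diffOne (μ : MulAut G) : E →L[ℝ] E :=
  show E →L[ℝ] E from mfderiv 𝓘(ℝ, E) 𝓘(ℝ, E) μ 1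

/-- The adjoint representation, acting on the model space `E = T₁G`. -/
def adRep (c : G) : E →L[ℝ] E := diffOne E (MulAut.conj c)

/-- The Lie bracket of `𝔤`, on the model space `E = T₁G`. -/
def bracketE (G : Type*) [TopologicalSpace G] [ChartedSpace E G] [Group G]
    [LieGroup 𝓘(ℝ, E) ∞ G] (X Y : E) : E :=
  Bracket.bracket (L := RealLieAlg E G) (M := RealLieAlg E G) X Y

theorem contMDiff_conj (c : G) : ContMDiff 𝓘(ℝ, E) 𝓘(ℝ, E) ∞ (MulAut.conj c) := by
  have : ContMDiff 𝓘(ℝ, E) 𝓘(ℝ, E) ∞ (fun z : G => c * z * c⁻¹) :=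
    (contMDiff_const.mul contMDiff_id).mul contMDiff_const
  exact this

theorem velocity_comp {μ : MulAut G} (hμ : ContMDiff 𝓘(ℝ, E) 𝓘(ℝ, E) ∞ μ) {γ : ℝ → G}
    (hγ : MDifferentiableAt 𝓘(ℝ, ℝ) 𝓘(ℝ, E) γ 0) (h0 : γ 0 = 1) :
    velocity E (fun t => μ (γ t)) = diffOne E μ (velocity E γ) := by
  have h1 : HasMFDerivAt 𝓘(ℝ, E) 𝓘(ℝ, E) μ (γ 0)
      (show E →L[ℝ] E from mfderiv 𝓘(ℝ, E) 𝓘(ℝ, E) μ 1) := by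
    rw [h0]; exact (hμ.mdifferentiable (by simp) 1).hasMFDerivAt
  have h2 := (HasMFDerivAt.comp (0 : ℝ) h1 hγ.hasMFDerivAt).mfderiv
  exact congrArg (fun f : ℝ →L[ℝ] E => f 1) h2

variable [T2Space G]

theorem mdifferentiableAt_oneParam (X : E) :
    MDifferentiableAt 𝓘(ℝ, ℝ) 𝓘(ℝ, E) (oneParam E G X) 0 :=
  (contMDiff_oneParam E X).mdifferentiable (by simp) 0

theorem map_oneParam {μ : MulAut G} (hμ : ContMDiff 𝓘(ℝ, E) 𝓘(ℝ, E) ∞ μ) (X : E) (t : ℝ) :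
    μ (oneParam E G X t) = oneParam E G (diffOne E μ X) t := by
  refine congrFun (eq_oneParam_of_hom E (ψ := fun t => μ (oneParam E G X t)) ?_ ?_ ?_ ?_) t
  · intro a b; rw [oneParam_add, map_mul]
  · rw [oneParam_zero, map_one]
  · exact (hμ.comp (contMDiff_oneParam E X)).mdifferentiable (by simp) 0
  · exact (velocity_comp E hμ (mdifferentiableAt_oneParam E X) (oneParam_zero E X)).trans
      (congrArg (diffOne E μ) (velocity_oneParam E X))

theorem map_lieExp {μ : MulAut G} (hμ : ContMDiff 𝓘(ℝ, E) 𝓘(ℝ, E) ∞ μ) (X : E) :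
    μ (lieExp E G X) = lieExp E G (diffOne E μ X) :=
  map_oneParam E hμ X 1

theorem conj_lieExp (c : G) (X : E) :
    c * lieExp E G X * c⁻¹ = lieExp E G (adRep E c X) :=
  map_lieExp E (contMDiff_conj E c) X

theorem oneParam_injective {X Y : E} (h : ∀ t, oneParam E G X t = oneParam E G Y t) : X = Y := by
  rw [← velocity_oneParam E (G := G) X, ← velocity_oneParam E (G := G) Y, funext h]

theorem diffOne_mul {μ ν : MulAut G} (hμ : ContMDiff 𝓘(ℝ, E) 𝓘(ℝ, E) ∞ μ)
    (hν : ContMDiff 𝓘(ℝ, E) 𝓘(ℝ, E) ∞ ν) (X : E) :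
    diffOne E (μ * ν) X = diffOne E μ (diffOne E ν X) := by
  refine oneParam_injective E (G := G) fun t => ?_
  have hμν : ContMDiff 𝓘(ℝ, E) 𝓘(ℝ, E) ∞ (μ * ν : MulAut G) := hμ.comp hν
  rw [← map_oneParam E hμν, ← map_oneParam E hμ, ← map_oneParam E hν, MulAut.mul_apply]

theorem diffOne_one (X : E) : diffOne E (1 : MulAut G) X = X := by
  refine oneParam_injective E (G := G) fun t => ?_
  have h1 : ContMDiff 𝓘(ℝ, E) 𝓘(ℝ, E) ∞ (1 : MulAut G) := contMDiff_id
  rw [← map_oneParam E h1, MulAut.one_apply]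

theorem adRep_mul (a b : G) (X : E) : adRep E (a * b) X = adRep E a (adRep E b X) := by
  have := diffOne_mul E (contMDiff_conj E a) (contMDiff_conj E b) X
  rwa [← map_mul] at this

theorem adRep_one (X : E) : adRep E (1 : G) X = X := by
  have := diffOne_one E (G := G) X
  rwa [← map_one MulAut.conj] at this

theorem adRep_inv_adRep (a : G) (X : E) : adRep E a⁻¹ (adRep E a X) = X := by
  rw [← adRep_mul, inv_mul_cancel, adRep_one]

theorem adRep_adRep_inv (a : G) (X : E) : adRep E a (adRep E a⁻¹ X) = X := by
  rw [← adRep_mul, mul_inv_cancel, adRep_one]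

theorem diffOne_adRep {μ : MulAut G} (hμ : ContMDiff 𝓘(ℝ, E) 𝓘(ℝ, E) ∞ μ) (c : G) (X : E) :
    diffOne E μ (adRep E c X) = adRep E (μ c) (diffOne E μ X) := by
  have h1 := diffOne_mul E hμ (contMDiff_conj E c) X
  have h2 := diffOne_mul E (contMDiff_conj E (μ c)) hμ X
  have h3 : μ * MulAut.conj c = MulAut.conj (μ c) * μ := by
    ext z; simp
  rw [h3] at h1
  exact h1.symm.trans h2

/-- Left translation by `c` is conjugation by `c` followed by right translation by `c`; hence `Ad c`
is the change from the left-invariant to the right-invariant frame. -/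
theorem eventually_leftFrame_eq : ∀ᶠ c in 𝓝 (1 : G), ∀ Y : E,
    leftFrame E G (chartOne E G c) Y = rightFrame E G (chartOne E G c) (adRep E c Y) := by
  filter_upwards [eventually_hasMFDerivAt_mul_left E (G := G),
    eventually_hasMFDerivAt_mul_right E (G := G)] with c hl hr Y
  have h1 : HasMFDerivAt 𝓘(ℝ, E) 𝓘(ℝ, E) (MulAut.conj c) (1 : G)
      (show E →L[ℝ] E from mfderiv 𝓘(ℝ, E) 𝓘(ℝ, E) (MulAut.conj c) 1) :=
    ((contMDiff_conj E c).mdifferentiable (by simp) 1).hasMFDerivAt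
  have h2 : HasMFDerivAt 𝓘(ℝ, E) 𝓘(ℝ, E) (fun z => chartOne E G (z * c)) (MulAut.conj c (1 : G))
      (rightFrame E G (chartOne E G c)) := by
    rw [map_one]; exact hr
  have h3 := HasMFDerivAt.comp (1 : G) h2 h1
  have h4 : (fun z => chartOne E G (z * c)) ∘ MulAut.conj c = fun z => chartOne E G (c * z) := by
    ext z; simp
  rw [h4] at h3
  have h5 := hl.mfderiv.symm.trans h3.mfderiv
  exact congrArg (fun f : E →L[ℝ] E => f Y) h5

/-- The expression of `Ad` in the chart at `1`. -/
def adChart (G : Type*) [TopologicalSpace G] [ChartedSpace E G] [Group G] (Y x : E) : E :=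
  Ring.inverse (rightFrame E G x) (leftFrame E G x Y)

theorem eventually_adRep_eq_adChart : ∀ᶠ c in 𝓝 (1 : G), ∀ Y : E,
    adRep E c Y = adChart E G Y (chartOne E G c) := by
  have h1 : ∀ᶠ x in 𝓝 (oneCoord E G), IsUnit (rightFrame E G x) := by
    have hc := (contDiffAt_rightMatrix (contDiffAt_localMul E (G := G))).continuousAt
    refine hc.eventually ?_
    have h2 : rightFrame E G (oneCoord E G) = ((1 : (E →L[ℝ] E)ˣ) : E →L[ℝ] E) :=
      rightFrame_oneCoord E
    rw [show rightMatrix (localMul E G) (oneCoord E G) (oneCoord E G) =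
      ((1 : (E →L[ℝ] E)ˣ) : E →L[ℝ] E) from h2]
    exact Units.nhds _
  filter_upwards [eventually_leftFrame_eq E (G := G), (tendsto_chart E (G := G)).eventually h1]
    with c h2 h3 Y
  rw [adChart, h2 Y]
  exact (congrArg (fun f : E →L[ℝ] E => f (adRep E c Y)) (Ring.inverse_mul_cancel _ h3)).symm

/-- The derivative of `x ↦ R(x)⁻¹ L(x) Y` at the identity, where `R` and `L` are the right- and the
left-invariant frame; that of `R` is rewritten through the symmetry of second derivatives. -/
theorem hasFDerivAt_adChart (Y : E) : ∃ D : E →L[ℝ] E,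
    HasFDerivAt (adChart E G Y) D (oneCoord E G) ∧ ∀ X, D X =
      fderiv ℝ (fun x => leftFrame E G x Y) (oneCoord E G) X -
        fderiv ℝ (fun x => leftFrame E G x X) (oneCoord E G) Y := by
  have hL := ((contDiffAt_leftMatrix (contDiffAt_localMul E (G := G))).differentiableAt
    (by simp)).hasFDerivAt
  have hR := ((contDiffAt_rightMatrix (contDiffAt_localMul E (G := G))).differentiableAt
    (by simp)).hasFDerivAt
  have hI : HasFDerivAt Ring.inverse (-ContinuousLinearMap.id ℝ (E →L[ℝ] E))
      (rightFrame E G (oneCoord E G)) := by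
    have := hasFDerivAt_ringInverse (𝕜 := ℝ) (1 : (E →L[ℝ] E)ˣ)
    rw [rightFrame_oneCoord]
    convert! this using 1
  have hLY := hL.clm_apply (hasFDerivAt_const Y _)
  have hRY := hR.clm_apply (hasFDerivAt_const Y _)
  have hQ := (hI.comp (oneCoord E G) hR).clm_apply hLY
  refine ⟨_, hQ, fun X => ?_⟩
  rw [hLY.fderiv, ← fderiv_rightMatrix_apply (contDiffAt_localMul E (G := G)), hRY.fderiv]
  have e1 : leftMatrix (localMul E G) (oneCoord E G) (oneCoord E G) = ContinuousLinearMap.id ℝ E :=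
    leftFrame_oneCoord E
  have e2 : Ring.inverse (rightMatrix (localMul E G) (oneCoord E G) (oneCoord E G)) =
      ContinuousLinearMap.id ℝ E :=
    (congrArg Ring.inverse (rightFrame_oneCoord E)).trans (Ring.inverse_one _)
  simp [e1, e2, sub_eq_add_neg]

/-- The Lie bracket of two left-invariant fields, computed in the chart at `1`. -/
theorem bracketE_eq_fderiv (X Y : E) : bracketE E G X Y =
    fderiv ℝ (fun x => leftFrame E G x Y) (oneCoord E G) X -
      fderiv ℝ (fun x => leftFrame E G x X) (oneCoord E G) Y := by
  have hpull : ∀ Z : E, VectorField.mpullbackWithin 𝓘(ℝ, E) 𝓘(ℝ, E) (chartOne E G).symm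
      (leftField E G Z) (range 𝓘(ℝ, E)) =ᶠ[𝓝 (oneCoord E G)] fun x => leftFrame E G x Z := by
    intro Z
    filter_upwards [target_mem_nhds E (G := G),
      eventually_mfderiv_chartOne_symm_leftFrame E (G := G)] with x hx hf
    have hi := isInvertible_mfderivWithin_extChartAt_symm (I := 𝓘(ℝ, E)) (x := (1 : G)) hx
    refine hi.inverse_apply_eq.2 ((hf Z).symm.trans ?_)
    simp only [modelWithCornersSelf_coe, range_id, mfderivWithin_univ]
  have hid : (mfderiv 𝓘(ℝ, E) 𝓘(ℝ, E) (chartOne E G) 1) = ContinuousLinearMap.id ℝ E :=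
    (hasMFDerivAt_chart_one E).mfderiv
  let w : E := VectorField.lieBracketWithin ℝ
    (VectorField.mpullbackWithin 𝓘(ℝ, E) 𝓘(ℝ, E) (chartOne E G).symm (leftField E G X)
      (range 𝓘(ℝ, E)))
    (VectorField.mpullbackWithin 𝓘(ℝ, E) 𝓘(ℝ, E) (chartOne E G).symm (leftField E G Y)
      (range 𝓘(ℝ, E)))
    ((chartOne E G).symm ⁻¹' univ ∩ range 𝓘(ℝ, E)) (oneCoord E G)
  have hb : bracketE E G X Y = w := by
    have h1 : (mfderiv 𝓘(ℝ, E) 𝓘(ℝ, E) (chartOne E G) 1).inverse = ContinuousLinearMap.id ℝ E :=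
      (congrArg ContinuousLinearMap.inverse hid).trans ContinuousLinearMap.inverse_id
    exact congrArg (fun f : E →L[ℝ] E => f w) h1
  simp only [w] at hb
  rw [hb, (hpull X).lieBracketWithin_vectorField_eq_nhds (hpull Y)]
  have hu : (chartOne E G).symm ⁻¹' univ ∩ range 𝓘(ℝ, E) = univ := by simp
  rw [hu, VectorField.lieBracketWithin_univ, VectorField.lieBracket_eq]
  have e1 : leftMatrix (localMul E G) (oneCoord E G) (oneCoord E G) = ContinuousLinearMap.id ℝ E :=
    leftFrame_oneCoord E
  simp [e1]

theorem continuous_adRep [IsTopologicalGroup G] (Y : E) : Continuous fun c : G => adRep E c Y := by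
  have h1 : ∀ Y : E, ContinuousAt (fun c : G => adRep E c Y) 1 := by
    intro Y
    obtain ⟨D, hD, _⟩ := hasFDerivAt_adChart E (G := G) Y
    have h2 : ContinuousAt (fun c : G => adChart E G Y (chartOne E G c)) 1 :=
      ContinuousAt.comp (f := chartOne E G) hD.continuousAt (continuousAt_extChartAt 1)
    exact h2.congr ((eventually_adRep_eq_adChart E (G := G)).mono fun c hc => (hc Y).symm)
  rw [continuous_iff_continuousAt]
  intro a
  have h3 : (fun c : G => adRep E c Y) = fun c => adRep E a (adRep E (a⁻¹ * c) Y) := by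
    ext c; rw [← adRep_mul, mul_inv_cancel_left]
  rw [h3]
  refine (adRep E a).continuous.continuousAt.comp (f := fun c => adRep E (a⁻¹ * c) Y) ?_
  exact ContinuousAt.comp_of_eq (g := fun c : G => adRep E c Y) (h1 Y)
    (continuous_const_mul a⁻¹).continuousAt (inv_mul_cancel a)

/-- The derivative of `Ad` along one-parameter subgroups is the Lie bracket. -/
theorem hasDerivAt_adRep (X Y : E) (t : ℝ) :
    HasDerivAt (fun t => adRep E (oneParam E G X t) Y)
      (adRep E (oneParam E G X t) (bracketE E G X Y)) t := by
  have h0 : HasDerivAt (fun t => adRep E (oneParam E G X t) Y) (bracketE E G X Y) 0 := by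
    obtain ⟨D, hD, hDX⟩ := hasFDerivAt_adChart E (G := G) Y
    have h1 : HasDerivAt (fun t => chartOne E G (oneParam E G X t)) X 0 := by
      have h2 : HasMFDerivAt 𝓘(ℝ, E) 𝓘(ℝ, E) (chartOne E G) (oneParam E G X 0)
          (ContinuousLinearMap.id ℝ E) := by
        rw [oneParam_zero]; exact hasMFDerivAt_chart_one E
      have h3 := HasMFDerivAt.comp (0 : ℝ) h2 (hasMFDerivAt_oneParam_zero E (G := G) X)
      have h4 := h3.congr_mfderiv (comp_smulRight_one (ContinuousLinearMap.id ℝ E) X)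
      exact h4.hasFDerivAt
    have h5 : HasFDerivAt (adChart E G Y) D (chartOne E G (oneParam E G X 0)) := by
      rw [oneParam_zero]; exact hD
    have h6 := h5.comp_hasDerivAt (0 : ℝ) h1
    rw [hDX, ← bracketE_eq_fderiv] at h6
    refine h6.congr_of_eventuallyEq ?_
    have h7 : Tendsto (oneParam E G X) (𝓝 0) (𝓝 1) := by
      have := (continuous_oneParam E (G := G) X).tendsto 0
      rwa [oneParam_zero] at this
    exact (h7.eventually (eventually_adRep_eq_adChart E (G := G))).mono fun t ht => ht Y
  have h1 : (fun s => adRep E (oneParam E G X s) Y) =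
      fun s => adRep E (oneParam E G X t) (adRep E (oneParam E G X (s - t)) Y) := by
    ext s; rw [← adRep_mul, ← oneParam_add, add_sub_cancel]
  rw [h1]
  have h2 : HasDerivAt (fun s => adRep E (oneParam E G X (s - t)) Y) (bracketE E G X Y) t := by
    have h3 : HasDerivAt (fun t => adRep E (oneParam E G X t) Y) (bracketE E G X Y) (t - t) := by
      rwa [sub_self]
    exact h3.comp_sub_const t t
  exact (adRep E (oneParam E G X t)).hasFDerivAt.comp_hasDerivAt t h2

theorem adRep_oneParam_of_bracketE_eq_zero {X Y : E} (h : bracketE E G X Y = 0) (t : ℝ) :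
    adRep E (oneParam E G X t) Y = Y := by
  have h1 : ∀ t, HasDerivAt (fun t => adRep E (oneParam E G X t) Y) 0 t := by
    intro t
    have := hasDerivAt_adRep E (G := G) X Y t
    rwa [h, map_zero] at this
  have h2 := is_const_of_deriv_eq_zero (fun t => (h1 t).differentiableAt) (fun t => (h1 t).deriv) t 0
  simpa [oneParam_zero, adRep_one] using h2

theorem bracketE_eq_zero_of_adRep {X Y : E} (h : ∀ t, adRep E (oneParam E G X t) Y = Y) :
    bracketE E G X Y = 0 := by
  have h1 := hasDerivAt_adRep E (G := G) X Y 0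
  rw [oneParam_zero, adRep_one] at h1
  have h2 : (fun t => adRep E (oneParam E G X t) Y) = fun _ => Y := funext h
  rw [h2] at h1
  exact h1.unique (hasDerivAt_const _ _)

theorem diffOne_bracketE {μ : MulAut G} (hμ : ContMDiff 𝓘(ℝ, E) 𝓘(ℝ, E) ∞ μ) (X Y : E) :
    diffOne E μ (bracketE E G X Y) = bracketE E G (diffOne E μ X) (diffOne E μ Y) := by
  have h1 := hasDerivAt_adRep E (G := G) X Y 0
  have h2 := hasDerivAt_adRep E (G := G) (diffOne E μ X) (diffOne E μ Y) 0
  rw [oneParam_zero, adRep_one] at h1 h2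
  have h3 := (diffOne E μ).hasFDerivAt.comp_hasDerivAt (0 : ℝ) h1
  refine h3.unique (h2.congr_of_eventuallyEq (Eventually.of_forall fun t => ?_))
  change diffOne E μ (adRep E (oneParam E G X t) Y) =
    adRep E (oneParam E G (diffOne E μ X) t) (diffOne E μ Y)
  rw [← map_oneParam E hμ, ← diffOne_adRep E hμ]

theorem adRep_bracketE (c : G) (X Y : E) :
    adRep E c (bracketE E G X Y) = bracketE E G (adRep E c X) (adRep E c Y) :=
  diffOne_bracketE E (contMDiff_conj E c) X Y

theorem bracketE_skew (X Y : E) : bracketE E G X Y = -bracketE E G Y X :=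
  (lie_skew (L := RealLieAlg E G) X Y).symm

/-- An `Ad`-invariant bilinear form is invariant under the Lie algebra. -/
theorem form_bracketE (B : E →ₗ[ℝ] E →ₗ[ℝ] ℝ) (hB : ∀ (c : G) X Y, B (adRep E c X) (adRep E c Y) = B X Y)
    (X Y Z : E) : B (bracketE E G X Y) Z = -B Y (bracketE E G X Z) := by
  have h1 := hasDerivAt_adRep E (G := G) X Y 0
  have h2 := hasDerivAt_adRep E (G := G) X Z 0
  rw [oneParam_zero, adRep_one] at h1 h2
  have h3 : HasDerivAt (fun t => adRep E (oneParam E G X (-t)) Z) (-bracketE E G X Z) 0 := by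
    have h4 : HasDerivAt (fun t => adRep E (oneParam E G X t) Z) (bracketE E G X Z) (-0) := by
      rwa [neg_zero]
    have := h4.scomp (0 : ℝ) (hasDerivAt_neg 0)
    simpa [Function.comp_def] using this
  have h5 := (LinearMap.toContinuousLinearMap (B.flip Z)).hasFDerivAt.comp_hasDerivAt (0 : ℝ) h1
  have h6 := (LinearMap.toContinuousLinearMap (B Y)).hasFDerivAt.comp_hasDerivAt (0 : ℝ) h3
  have h7 : ∀ t, B (adRep E (oneParam E G X t) Y) Z = B Y (adRep E (oneParam E G X (-t)) Z) := by
    intro t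
    rw [← hB (oneParam E G X t) Y, ← adRep_mul, ← oneParam_add, add_neg_cancel, oneParam_zero, adRep_one]
  have := h5.unique (h6.congr_of_eventuallyEq (Eventually.of_forall h7))
  simpa using this

theorem commute_oneParam {X Y : E} (h : bracketE E G X Y = 0) (s t : ℝ) :
    oneParam E G X s * oneParam E G Y t = oneParam E G Y t * oneParam E G X s := by
  have h1 := map_oneParam E (contMDiff_conj E (oneParam E G X s)) Y t
  have h2 : diffOne E (MulAut.conj (oneParam E G X s)) Y = Y :=
    adRep_oneParam_of_bracketE_eq_zero E h s
  rw [h2, MulAut.conj_apply, mul_inv_eq_iff_eq_mul] at h1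
  exact h1

theorem bracketE_eq_zero_of_commute {X Y : E}
    (h : ∀ a b, oneParam E G X a * oneParam E G Y b = oneParam E G Y b * oneParam E G X a) :
    bracketE E G X Y = 0 := by
  refine bracketE_eq_zero_of_adRep E fun a => oneParam_injective E (G := G) fun b => ?_
  have h1 := map_oneParam E (contMDiff_conj E (oneParam E G X a)) Y b
  rw [MulAut.conj_apply, h, mul_inv_cancel_right] at h1
  exact h1.symm

theorem lieExp_add {X Y : E} (h : bracketE E G X Y = 0) :
    lieExp E G (X + Y) = lieExp E G X * lieExp E G Y := by
  refine (congrFun (eq_oneParam_of_hom E (ψ := fun t => oneParam E G X t * oneParam E G Y t)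
    ?_ ?_ ?_ ?_) 1).symm
  · intro a b
    simp only [oneParam_add]
    rw [mul_assoc, ← mul_assoc (oneParam E G X b), commute_oneParam E h b a]
    simp only [mul_assoc]
  · simp [oneParam_zero]
  · exact ((contMDiff_oneParam E X).mul (contMDiff_oneParam E Y)).mdifferentiable (by simp) 0
  · refine (velocity_mul (contMDiff_oneParam E X) (contMDiff_oneParam E Y) (oneParam_zero E X)
      (oneParam_zero E Y)).trans ?_
    exact congrArg₂ (fun a b : E => a + b) (velocity_oneParam E X) (velocity_oneParam E Y)

end Adjoint

/-! ### Closed subgroups -/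

section ClosedSubgroups

set_option linter.unusedSectionVars false

variable (E : Type*) [NormedAddCommGroup E] [NormedSpace ℝ E] [FiniteDimensional ℝ E]
  {G : Type*} [TopologicalSpace G] [ChartedSpace E G] [Group G] [LieGroup 𝓘(ℝ, E) ∞ G] [T2Space G]

/-- A local inverse of the exponential map in the chart at `1`. -/
theorem exists_local_log : ∃ ℓ : E → E, ℓ (oneCoord E G) = 0 ∧
    HasStrictFDerivAt ℓ (ContinuousLinearMap.id ℝ E) (oneCoord E G) ∧
    ∀ᶠ c in 𝓝 (1 : G), lieExp E G (ℓ (chartOne E G c)) = c := by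
  have hf : HasStrictFDerivAt (fun X => chartOne E G (lieExp E G X))
      ((ContinuousLinearEquiv.refl ℝ E : E ≃L[ℝ] E) : E →L[ℝ] E) 0 := (lieExp_strict E (G := G)).2
  have h0 : chartOne E G (lieExp E G 0) = oneCoord E G := by rw [lieExp_zero]; rfl
  have hl := hf.to_localInverse
  have h1 := hf.eventually_right_inverse
  have h2 : hf.localInverse _ _ _ (oneCoord E G) = 0 := by
    have := hf.localInverse_apply_image
    rwa [h0] at this
  rw [h0] at hl h1
  refine ⟨hf.localInverse _ _ _, h2, hl, ?_⟩
  have h3 : Tendsto (fun c : G => hf.localInverse _ _ _ (chartOne E G c)) (𝓝 1) (𝓝 0) := by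
    have := hl.continuousAt.tendsto
    rw [h2] at this
    exact this.comp (tendsto_chart E)
  filter_upwards [(tendsto_chart E (G := G)).eventually h1,
    h3.eventually (lieExp_strict E (G := G)).1,
    extChartAt_source_mem_nhds (I := 𝓘(ℝ, E)) (1 : G)] with c hc hs hc'
  exact (chartOne E G).injOn hs hc' hc

/-- `f` maps `0` to `1` and is strictly differentiable at `0` with derivative `f'` in the chart at
`1`, whose derivative at `1` identifies `T₁G` with `E`. -/
structure HasStrictDerivAtOne {F : Type*} [NormedAddCommGroup F] [NormedSpace ℝ F] (f : F → G)
    (f' : F →L[ℝ] E) : Prop where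
  map_zero : f 0 = 1
  continuousAt : ContinuousAt f 0
  hasStrictFDerivAt : HasStrictFDerivAt (fun v => chartOne E G (f v)) f' 0

section Products

variable {F : Type*} [NormedAddCommGroup F] [NormedSpace ℝ F] {E}

theorem hasStrictDerivAtOne_lieExp (L : F →L[ℝ] E) :
    HasStrictDerivAtOne E (fun v => lieExp E G (L v)) L where
  map_zero := by rw [map_zero, lieExp_zero]
  continuousAt := by
    have h := (tendsto_lieExp_zero E (G := G))
    have hL : Tendsto L (𝓝 0) (𝓝 0) := by simpa using L.continuous.tendsto 0
    have := h.comp hL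
    simpa [ContinuousAt, lieExp_zero, Function.comp_def] using this
  hasStrictFDerivAt := by
    have h := HasStrictFDerivAt.comp (g := fun X => chartOne E G (lieExp E G X)) (f := L) (0 : F)
      (by rw [map_zero]; exact (lieExp_strict E (G := G)).2) L.hasStrictFDerivAt
    exact h

theorem HasStrictDerivAtOne.mul [IsTopologicalGroup G] {f g : F → G} {f' g' : F →L[ℝ] E}
    (hf : HasStrictDerivAtOne E f f') (hg : HasStrictDerivAtOne E g g') :
    HasStrictDerivAtOne E (fun v => f v * g v) (f' + g') where
  map_zero := by rw [hf.map_zero, hg.map_zero, mul_one]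
  continuousAt := hf.continuousAt.mul hg.continuousAt
  hasStrictFDerivAt := by
    have hm : HasStrictFDerivAt (localMul E G)
        (ContinuousLinearMap.fst ℝ E E + ContinuousLinearMap.snd ℝ E E)
        (oneCoord E G, oneCoord E G) := by
      have h1 := (contDiffAt_localMul E (G := G)).hasStrictFDerivAt (by simp)
      convert! h1 using 1
      have e1 := leftFrame_oneCoord E (G := G)
      have e2 := rightFrame_oneCoord E (G := G)
      ext v
      · simpa [rightFrame, rightMatrix] using (congrArg (fun f : E →L[ℝ] E => f v) e2).symm
      · simpa [leftFrame, leftMatrix] using (congrArg (fun f : E →L[ℝ] E => f v) e1).symm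
    have hm' : HasStrictFDerivAt (localMul E G)
        (ContinuousLinearMap.fst ℝ E E + ContinuousLinearMap.snd ℝ E E)
        (chartOne E G (f 0), chartOne E G (g 0)) := by
      rw [hf.map_zero, hg.map_zero]; exact hm
    have h := HasStrictFDerivAt.comp (g := localMul E G)
      (f := fun v => (chartOne E G (f v), chartOne E G (g v))) (0 : F) hm'
      (hf.hasStrictFDerivAt.prodMk hg.hasStrictFDerivAt)
    have hsum : (ContinuousLinearMap.fst ℝ E E + ContinuousLinearMap.snd ℝ E E).comp (f'.prod g') =
        f' + g' := by
      ext v; simp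
    rw [hsum] at h
    refine h.congr_of_eventuallyEq ?_
    have hs := extChartAt_source_mem_nhds (I := 𝓘(ℝ, E)) (1 : G)
    have hf1 := hf.continuousAt.tendsto
    have hg1 := hg.continuousAt.tendsto
    rw [hf.map_zero] at hf1
    rw [hg.map_zero] at hg1
    filter_upwards [hf1.eventually hs, hg1.eventually hs] with v h1 h2
    exact localMul_chart E h1 h2

/-- A map to `G` whose derivative at `0` is onto is locally onto. -/
theorem HasStrictDerivAtOne.image_mem_nhds [CompleteSpace F] {f : F → G} {f' : F →L[ℝ] E}
    (hf : HasStrictDerivAtOne E f f') (hsurj : Function.Surjective f') {s : Set F}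
    (hs : s ∈ 𝓝 (0 : F)) : f '' s ∈ 𝓝 (1 : G) := by
  have hsrc := extChartAt_source_mem_nhds (I := 𝓘(ℝ, E)) (1 : G)
  have hf1 := hf.continuousAt.tendsto
  rw [hf.map_zero] at hf1
  have h1 := hf.hasStrictFDerivAt.map_nhds_eq_of_surj (LinearMap.range_eq_top.2 hsurj)
  rw [hf.map_zero] at h1
  have h2 : (fun v => chartOne E G (f v)) '' (s ∩ f ⁻¹' (chartOne E G).source) ∈
      𝓝 (oneCoord E G) := by
    change _ ∈ 𝓝 (chartOne E G 1)
    rw [← h1]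
    exact image_mem_map (inter_mem hs (hf1 hsrc))
  filter_upwards [(tendsto_chart E (G := G)) h2, hsrc] with c hc hc'
  obtain ⟨v, ⟨hv, hv'⟩, hvc⟩ := hc
  exact ⟨v, hv, (chartOne E G).injOn hv' hc' hvc⟩

end Products

/-- The Lie algebra of a subgroup, as a subspace of the model space `E = T₁G`. -/
def subLie (H : Subgroup G) : Submodule ℝ E := realLieSubspace E H

variable {E} in
theorem mem_subLie_of_oneParam_mem {H : Subgroup G} {X : E} (h : ∀ t, oneParam E G X t ∈ H) :
    X ∈ subLie E H :=
  ⟨oneParam E G X, contMDiff_oneParam E X, oneParam_zero E X, h, velocity_oneParam E X⟩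

variable {E} in
/-- If `U n → 0`, `k n U n → V` for integers `k n` and all `exp (U n)` lie in a closed subgroup,
then so does `exp V`. -/
theorem lieExp_mem_of_tendsto [IsTopologicalGroup G] {H : Subgroup G} (hH : IsClosed (H : Set G))
    {U : ℕ → E} {k : ℕ → ℤ} {V : E} (hU : ∀ᶠ n in atTop, lieExp E G (U n) ∈ H)
    (hk : Tendsto (fun n => k n • U n) atTop (𝓝 V)) : lieExp E G V ∈ H := by
  refine hH.mem_of_tendsto (((continuous_lieExp E (G := G)).tendsto V).comp hk) ?_
  filter_upwards [hU] with n hn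
  simp only [Function.comp_apply, lieExp_zsmul]
  exact H.zpow_mem hn _

variable {E} in
/-- The Lie algebra of a closed subgroup `H` consists of the generators of the one-parameter
subgroups that run in `H`: if `X` is the velocity of a curve `γ` in `H`, then
`exp (t X) = lim γ (t / n) ^ n`. -/
theorem mem_subLie_iff [IsTopologicalGroup G] {H : Subgroup G} (hH : IsClosed (H : Set G)) {X : E} :
    X ∈ subLie E H ↔ ∀ t, oneParam E G X t ∈ H := by
  refine ⟨?_, mem_subLie_of_oneParam_mem⟩
  rintro ⟨γ, hγ, hγ0, hγH, hX⟩ t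
  obtain ⟨ℓ, hℓ0, hℓ, hℓe⟩ := exists_local_log E (G := G)
  have hγd : HasMFDerivAt 𝓘(ℝ, ℝ) 𝓘(ℝ, E) γ 0
      (show ℝ →L[ℝ] E from mfderiv 𝓘(ℝ, ℝ) 𝓘(ℝ, E) γ 0) :=
    (hγ.mdifferentiable (by simp) 0).hasMFDerivAt
  have h1 : HasMFDerivAt 𝓘(ℝ, E) 𝓘(ℝ, E) (chartOne E G) (γ 0) (ContinuousLinearMap.id ℝ E) := by
    rw [hγ0]; exact hasMFDerivAt_chart_one E
  have h2 : HasFDerivAt (fun s => chartOne E G (γ s)) ((ContinuousLinearMap.id ℝ E).comp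
      (show ℝ →L[ℝ] E from mfderiv 𝓘(ℝ, ℝ) 𝓘(ℝ, E) γ 0)) 0 :=
    (HasMFDerivAt.comp (0 : ℝ) h1 hγd).hasFDerivAt
  have h3 : HasDerivAt (fun s => chartOne E G (γ s)) X 0 := h2.hasDerivAt.congr_deriv hX
  have h4 : HasDerivAt (fun s => ℓ (chartOne E G (γ s))) X 0 := by
    have h5 : HasFDerivAt ℓ (ContinuousLinearMap.id ℝ E) (chartOne E G (γ 0)) := by
      rw [hγ0]; exact hℓ.hasFDerivAt
    exact h5.comp_hasDerivAt (0 : ℝ) h3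
  have hU0 : ℓ (chartOne E G (γ 0)) = 0 := by rw [hγ0]; exact hℓ0
  rcases eq_or_ne t 0 with rfl | ht
  · rw [oneParam_zero]; exact H.one_mem
  have hlim0 : Tendsto (fun n : ℕ => t / ((n : ℝ) + 1)) atTop (𝓝 0) := by
    have := (tendsto_one_div_add_atTop_nhds_zero_nat (𝕜 := ℝ)).const_mul t
    simpa [div_eq_mul_inv] using this
  have hlim : Tendsto (fun n : ℕ => t / ((n : ℝ) + 1)) atTop (𝓝[≠] 0) := by
    refine tendsto_nhdsWithin_iff.2 ⟨hlim0, Eventually.of_forall fun n => ?_⟩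
    exact div_ne_zero ht (by positivity)
  rw [oneParam_eq_lieExp]
  refine lieExp_mem_of_tendsto hH (U := fun n => ℓ (chartOne E G (γ (t / ((n : ℝ) + 1)))))
    (k := fun n => (n : ℤ) + 1) ?_ ?_
  · have hγc : Tendsto γ (𝓝 0) (𝓝 1) := by
      have := hγ.continuous.tendsto 0
      rwa [hγ0] at this
    filter_upwards [(hγc.comp hlim0).eventually hℓe] with n hn
    simp only [Function.comp_apply] at hn
    rw [hn]
    exact hγH _
  · have h6 := (h4.tendsto_slope_zero.comp hlim).const_smul t
    simp only [zero_add, hU0, sub_zero] at h6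
    refine h6.congr fun n => ?_
    simp only [Function.comp_apply, smul_smul]
    rw [← Int.cast_smul_eq_zsmul ℝ]
    congr 1
    push_cast
    field_simp

variable {E} in
/-- A closed subgroup meets the exponential of a small piece of a complement of its Lie algebra
only in `1`: the directions of a sequence of exceptions tending to `0` would accumulate at a unit
vector of that complement that is tangent to `H`. -/
theorem eventually_eq_zero_of_lieExp_mem [IsTopologicalGroup G] {H : Subgroup G}
    (hH : IsClosed (H : Set G)) {m : Submodule ℝ E} (hm : Disjoint m (subLie E H)) :
    ∀ᶠ U in 𝓝 (0 : E), U ∈ m → lieExp E G U ∈ H → U = 0 := by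
  by_contra hcon
  have hfr : ∃ᶠ U in 𝓝 (0 : E), U ∈ m ∧ lieExp E G U ∈ H ∧ U ≠ 0 := by
    refine (not_eventually.1 hcon).mono fun U hU => ?_
    push Not at hU
    exact hU
  obtain ⟨U, hU, hUp⟩ := exists_seq_forall_of_frequently hfr
  have hsph : ∀ n, ‖U n‖⁻¹ • U n ∈ Metric.sphere (0 : E) 1 := by
    intro n
    rw [mem_sphere_zero_iff_norm, norm_smul, norm_inv, norm_norm,
      inv_mul_cancel₀ (norm_ne_zero_iff.2 (hUp n).2.2)]
  obtain ⟨V, hV, φ, hφ, hlim⟩ := (isCompact_sphere (0 : E) 1).tendsto_subseq hsph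
  have hVm : V ∈ m := by
    refine (Submodule.closed_of_finiteDimensional m).mem_of_tendsto hlim
      (Eventually.of_forall fun n => m.smul_mem _ (hUp _).1)
  have hVH : V ∈ subLie E H := by
    refine mem_subLie_of_oneParam_mem fun t => ?_
    rw [oneParam_eq_lieExp]
    refine lieExp_mem_of_tendsto hH (U := fun n => U (φ n)) (k := fun n => ⌊t / ‖U (φ n)‖⌋)
      (Eventually.of_forall fun n => (hUp _).2.1) ?_
    have hn0 : Tendsto (fun n => ‖U (φ n)‖) atTop (𝓝 0) := by
      simpa using (hU.comp hφ.tendsto_atTop).norm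
    have hkt : Tendsto (fun n => (⌊t / ‖U (φ n)‖⌋ : ℝ) * ‖U (φ n)‖) atTop (𝓝 t) := by
      rw [tendsto_iff_norm_sub_tendsto_zero]
      refine squeeze_zero (fun n => norm_nonneg _) (fun n => ?_) hn0
      have hpos : 0 < ‖U (φ n)‖ := norm_pos_iff.2 (hUp _).2.2
      have e1 : (⌊t / ‖U (φ n)‖⌋ : ℝ) * ‖U (φ n)‖ - t =
          -(Int.fract (t / ‖U (φ n)‖) * ‖U (φ n)‖) := by
        rw [Int.fract]; field_simp; ring
      rw [e1, norm_neg, norm_mul, norm_norm, Real.norm_eq_abs, Int.abs_fract]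
      exact mul_le_of_le_one_left hpos.le (Int.fract_lt_one _).le
    refine (hkt.smul hlim).congr fun n => ?_
    have hpos : ‖U (φ n)‖ ≠ 0 := norm_ne_zero_iff.2 (hUp _).2.2
    simp only [Function.comp_apply]
    rw [smul_smul, mul_assoc, mul_inv_cancel₀ hpos, mul_one, Int.cast_smul_eq_zsmul]
  have := Submodule.disjoint_def.1 hm V hVm hVH
  rw [this] at hV
  simp at hV

variable {E} in
theorem adRep_mem_subLie [IsTopologicalGroup G] {H : Subgroup G} (hH : IsClosed (H : Set G)) {c : G}
    (hc : c ∈ H) {X : E} (hX : X ∈ subLie E H) : adRep E c X ∈ subLie E H := by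
  refine mem_subLie_of_oneParam_mem fun t => ?_
  have h1 : oneParam E G (adRep E c X) t = c * oneParam E G X t * c⁻¹ :=
    (map_oneParam E (contMDiff_conj E c) X t).symm
  rw [h1]
  exact H.mul_mem (H.mul_mem hc ((mem_subLie_iff hH).1 hX t)) (H.inv_mem hc)

variable {E} in
theorem bracketE_mem_subLie [IsTopologicalGroup G] {H : Subgroup G} (hH : IsClosed (H : Set G))
    {X Y : E} (hX : X ∈ subLie E H) (hY : Y ∈ subLie E H) : bracketE E G X Y ∈ subLie E H := by
  have h1 := hasDerivAt_adRep E (G := G) X Y 0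
  rw [oneParam_zero, adRep_one] at h1
  have h2 := h1.tendsto_slope_zero
  refine (Submodule.closed_of_finiteDimensional (subLie E H)).mem_of_tendsto h2
    (Eventually.of_forall fun t => ?_)
  refine Submodule.smul_mem _ _ (Submodule.sub_mem _ ?_ ?_)
  · exact adRep_mem_subLie hH ((mem_subLie_iff hH).1 hX _) hY
  · exact adRep_mem_subLie hH ((mem_subLie_iff hH).1 hX _) hY

end ClosedSubgroups

/-! ### Surjectivity of the exponential map -/

section Surjectivity

set_option linter.unusedSectionVars false

variable {E : Type*} [NormedAddCommGroup E] [NormedSpace ℝ E] [FiniteDimensional ℝ E]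
  {G : Type*} [TopologicalSpace G] [ChartedSpace E G] [Group G] [LieGroup 𝓘(ℝ, E) ∞ G] [T2Space G]
  [IsTopologicalGroup G]

/-- An `Ad`-invariant negative definite symmetric form on `T₁G`. -/
structure IsInvariantForm (G : Type*) [TopologicalSpace G] [ChartedSpace E G] [Group G]
    (B : E →ₗ[ℝ] E →ₗ[ℝ] ℝ) : Prop where
  symm : ∀ X Y, B X Y = B Y X
  neg : ∀ X, X ≠ 0 → B X X < 0
  invariant : ∀ (c : G) X Y, B (adRep E c X) (adRep E c Y) = B X Y

theorem IsInvariantForm.eq_zero {B : E →ₗ[ℝ] E →ₗ[ℝ] ℝ} (hB : IsInvariantForm G B) {X : E}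
    (h : B X X = 0) : X = 0 := by
  by_contra hX
  exact (hB.neg X hX).ne h

/-- In a compact group every `X` can be moved by `Ad` into the centralizer of `Z`: the minimum of
`c ↦ B(Ad c X, Z)` does it. -/
theorem exists_bracketE_adRep_eq_zero [CompactSpace G] {B : E →ₗ[ℝ] E →ₗ[ℝ] ℝ}
    (hB : IsInvariantForm G B) {H : Subgroup G} (hH : IsClosed (H : Set G)) {X Z : E}
    (hX : X ∈ subLie E H) (hZ : Z ∈ subLie E H) :
    ∃ c ∈ H, bracketE E G (adRep E c X) Z = 0 := by
  have hcont : Continuous fun c : G => B (adRep E c X) Z :=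
    (LinearMap.continuous_of_finiteDimensional (B.flip Z)).comp (continuous_adRep E X)
  obtain ⟨c, hc, hmin⟩ := hH.isCompact.exists_isMinOn ⟨1, H.one_mem⟩ hcont.continuousOn
  refine ⟨c, hc, ?_⟩
  set X' := adRep E c X with hX'
  set W := bracketE E G X' Z with hW
  have hWH : W ∈ subLie E H := bracketE_mem_subLie hH (adRep_mem_subLie hH hc hX) hZ
  have h1 := hasDerivAt_adRep E (G := G) W X' 0
  rw [oneParam_zero, adRep_one] at h1
  have h2 : HasDerivAt (fun t => B (adRep E (oneParam E G W t) X') Z) (B (bracketE E G W X') Z) 0 :=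
    (LinearMap.toContinuousLinearMap (B.flip Z)).hasFDerivAt.comp_hasDerivAt (0 : ℝ) h1
  have h3 : IsLocalMin (fun t => B (adRep E (oneParam E G W t) X') Z) 0 := by
    refine Eventually.of_forall fun t => ?_
    simp only [oneParam_zero, adRep_one]
    rw [hX', ← adRep_mul]
    exact hmin (H.mul_mem ((mem_subLie_iff hH).1 hWH t) hc)
  have h4 := h3.hasDerivAt_eq_zero h2
  rw [bracketE_skew, map_neg, LinearMap.neg_apply, form_bracketE E B hB.invariant, neg_neg,
    hB.symm] at h4
  exact hB.eq_zero (by rwa [hB.symm] at h4)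

theorem isClosed_centralizer_singleton (x : G) :
    IsClosed (Subgroup.centralizer {x} : Set G) := by
  have : (Subgroup.centralizer {x} : Set G) = {c | x * c = c * x} := by
    ext c; simp [Subgroup.mem_centralizer_iff]
  rw [this]
  exact isClosed_eq (by fun_prop) (by fun_prop)

theorem oneParam_mem_centralizer {x : G} {Z : E} (h : adRep E x Z = Z) (t : ℝ) :
    oneParam E G Z t ∈ Subgroup.centralizer {x} := by
  have h1 := map_oneParam E (contMDiff_conj E x) Z t
  have h2 : diffOne E (MulAut.conj x) Z = Z := h
  rw [h2, MulAut.conj_apply, mul_inv_eq_iff_eq_mul] at h1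
  simpa [Subgroup.mem_centralizer_iff] using h1

theorem adRep_lieExp_self (X : E) : adRep E (lieExp E G X) X = X := by
  have h : bracketE E G X X = 0 := lie_self (L := RealLieAlg E G) X
  exact adRep_oneParam_of_bracketE_eq_zero E h 1

variable [CompactSpace G]

/-- If `x = exp X` and `Z` is fixed by `Ad x`, then `x exp Z` is an exponential: move `X` by the
centralizer of `x` until it commutes with `Z`. -/
theorem exists_lieExp_mul {B : E →ₗ[ℝ] E →ₗ[ℝ] ℝ} (hB : IsInvariantForm G B) {H : Subgroup G}
    (hH : IsClosed (H : Set G)) {X Z : E} (hX : X ∈ subLie E H) (hZ : Z ∈ subLie E H)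
    (hfix : adRep E (lieExp E G X) Z = Z) :
    ∃ Y ∈ subLie E H, lieExp E G Y = lieExp E G X * lieExp E G Z := by
  set x := lieExp E G X with hx
  have hcl : IsClosed ((H ⊓ Subgroup.centralizer {x} : Subgroup G) : Set G) :=
    hH.inter (isClosed_centralizer_singleton x)
  have hX' : X ∈ subLie E (H ⊓ Subgroup.centralizer {x}) :=
    mem_subLie_of_oneParam_mem fun t =>
      ⟨(mem_subLie_iff hH).1 hX t, oneParam_mem_centralizer (adRep_lieExp_self X) t⟩
  have hZ' : Z ∈ subLie E (H ⊓ Subgroup.centralizer {x}) :=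
    mem_subLie_of_oneParam_mem fun t =>
      ⟨(mem_subLie_iff hH).1 hZ t, oneParam_mem_centralizer hfix t⟩
  obtain ⟨c, ⟨hcH, hcx⟩, hc⟩ := exists_bracketE_adRep_eq_zero hB hcl hX' hZ'
  refine ⟨adRep E c X + Z, Submodule.add_mem _ (adRep_mem_subLie hH hcH hX) hZ, ?_⟩
  rw [lieExp_add E hc]
  congr 1
  have h1 : c * lieExp E G X * c⁻¹ = lieExp E G (adRep E c X) := conj_lieExp E c X
  rw [← h1, mul_inv_eq_iff_eq_mul]
  simpa [Subgroup.mem_centralizer_iff] using (Subgroup.mem_centralizer_iff.1 hcx x rfl).symm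

/-- For an orthogonal transformation `a` of `h`, `h` is the sum of the image of `a - 1` and the
fixed vectors of `a`. -/
theorem exists_sub_add_fixed {V : Type*} [AddCommGroup V] [Module ℝ V] [FiniteDimensional ℝ V]
    {B : V →ₗ[ℝ] V →ₗ[ℝ] ℝ} (hneg : ∀ X, X ≠ 0 → B X X < 0) {a : V →ₗ[ℝ] V}
    (ha : ∀ X Y, B (a X) (a Y) = B X Y) (v : V) : ∃ w z, a z = z ∧ v = a w - w + z := by
  set T : V →ₗ[ℝ] V := a - LinearMap.id with hT
  have hdis : Disjoint (LinearMap.range T) (LinearMap.ker T) := by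
    rw [Submodule.disjoint_def]
    rintro z ⟨w, rfl⟩ hz
    set z := T w with hzdef
    have haz : a z = z := by
      have : a z - z = 0 := hz
      exact sub_eq_zero.1 this
    by_contra hne
    refine (hneg z hne).ne ?_
    have h1 : B z z = B z (a w) - B z w := by
      conv_lhs => rw [hzdef]
      rw [← map_sub]; rfl
    rw [h1, ← ha z w, haz, sub_self]
  have htop := Submodule.eq_top_of_disjoint _ _ (LinearMap.finrank_range_add_finrank_ker T).ge hdis
  obtain ⟨u, ⟨w, rfl⟩, z, hz, rfl⟩ := Submodule.mem_sup.1 (htop ▸ Submodule.mem_top : v ∈ _)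
  exact ⟨w, z, sub_eq_zero.1 hz, rfl⟩

/-- Near `x ∈ H` every element of `H` is conjugate in `H` to some `x exp Z` with `Z` fixed by
`Ad x`. For a complement `m` of the Lie algebra `h` of `H` and the fixed space `f` of `Ad x` in `h`,
the map `(u, w, z) ↦ exp u · x⁻¹ (exp w) x · exp z · (exp w)⁻¹` on `m × h × f` is a submersion at
`0`, and its values lie in `H` only for `u = 0`. -/
theorem eventually_conj_mul_lieExp {B : E →ₗ[ℝ] E →ₗ[ℝ] ℝ} (hB : IsInvariantForm G B)
    {H : Subgroup G} (hH : IsClosed (H : Set G)) {x : G} (hx : x ∈ H) :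
    ∀ᶠ y in 𝓝 x, y ∈ H → ∃ c ∈ H, ∃ Z ∈ subLie E H, adRep E x Z = Z ∧
      y = c * (x * lieExp E G Z) * c⁻¹ := by
  obtain ⟨m, hm⟩ := Submodule.exists_isCompl (subLie E H)
  set h := subLie E H with hh
  set f : Submodule ℝ E := h ⊓ LinearMap.ker ((adRep E x : E →L[ℝ] E) - ContinuousLinearMap.id ℝ E :
    E →L[ℝ] E).toLinearMap with hf
  have hfix : ∀ Z ∈ f, adRep E x Z = Z := by
    intro Z hZ
    have : adRep E x Z - Z = 0 := hZ.2
    exact sub_eq_zero.1 this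
  let L₁ : (m × h × f) →L[ℝ] E := m.subtypeL.comp (ContinuousLinearMap.fst ℝ m (h × f))
  let L₂ : (m × h × f) →L[ℝ] E := h.subtypeL.comp
    ((ContinuousLinearMap.fst ℝ h f).comp (ContinuousLinearMap.snd ℝ m (h × f)))
  let L₃ : (m × h × f) →L[ℝ] E := f.subtypeL.comp
    ((ContinuousLinearMap.snd ℝ h f).comp (ContinuousLinearMap.snd ℝ m (h × f)))
  have hstrict := (((hasStrictDerivAtOne_lieExp (G := G) L₁).mul
    (hasStrictDerivAtOne_lieExp (G := G) ((adRep E x⁻¹).comp L₂))).mul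
    (hasStrictDerivAtOne_lieExp (G := G) L₃)).mul (hasStrictDerivAtOne_lieExp (G := G) (-L₂))
  have hsurj : Function.Surjective (L₁ + (adRep E x⁻¹).comp L₂ + L₃ + -L₂) := by
    intro v
    obtain ⟨w, hw, u, hu, rfl⟩ := Submodule.mem_sup.1
      (hm.sup_eq_top ▸ Submodule.mem_top : v ∈ h ⊔ m)
    have hinv : ∀ z ∈ h, (adRep E x⁻¹ : E →L[ℝ] E).toLinearMap z ∈ h := fun z hz =>
      adRep_mem_subLie hH (H.inv_mem hx) hz
    obtain ⟨w₁, z, hz, hwz⟩ := exists_sub_add_fixed (V := h)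
      (B := (B.compl₁₂ h.subtype h.subtype)) (a := (adRep E x⁻¹).toLinearMap.restrict hinv)
      (fun X hX => hB.neg X (fun h0 => hX (Subtype.ext h0)))
      (fun X Y => hB.invariant x⁻¹ X Y) ⟨w, hw⟩
    have hz' : adRep E x⁻¹ (z : E) = z := congrArg Subtype.val hz
    have hzf : (z : E) ∈ f := by
      refine ⟨z.2, ?_⟩
      change adRep E x (z : E) - (z : E) = 0
      rw [sub_eq_zero]
      conv_lhs => rw [← hz']
      exact adRep_adRep_inv E x _
    refine ⟨(⟨u, hu⟩, w₁, ⟨z, hzf⟩), ?_⟩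
    have hwz' : w = adRep E x⁻¹ (w₁ : E) - w₁ + z := congrArg Subtype.val hwz
    rw [hwz']
    change u + adRep E x⁻¹ (w₁ : E) + z + -(w₁ : E) = _
    abel
  have hL₁ : Tendsto L₁ (𝓝 0) (𝓝 0) := by simpa using L₁.continuous.tendsto 0
  have himg := hstrict.image_mem_nhds hsurj
    (hL₁.eventually (eventually_eq_zero_of_lieExp_mem hH hm.disjoint.symm))
  have hlim : Tendsto (fun y => x⁻¹ * y) (𝓝 x) (𝓝 1) := by
    have := (continuous_const_mul x⁻¹).tendsto x
    rwa [inv_mul_cancel] at this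
  filter_upwards [hlim himg] with y hy hyH
  obtain ⟨p, hp, hpy⟩ := hy
  change lieExp E G (L₁ p) * lieExp E G (((adRep E x⁻¹).comp L₂) p) * lieExp E G (L₃ p) *
    lieExp E G ((-L₂) p) = x⁻¹ * y at hpy
  have hexp : ∀ Z ∈ h, lieExp E G Z ∈ H := fun Z hZ => (mem_subLie_iff hH).1 hZ 1
  have hm2 : ((adRep E x⁻¹).comp L₂) p ∈ h := adRep_mem_subLie hH (H.inv_mem hx) p.2.1.2
  have hL1 : lieExp E G (L₁ p) ∈ H := by
    have h1 : lieExp E G (L₁ p) = x⁻¹ * y * (lieExp E G ((-L₂) p))⁻¹ * (lieExp E G (L₃ p))⁻¹ *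
        (lieExp E G (((adRep E x⁻¹).comp L₂) p))⁻¹ := by
      rw [← hpy]; group
    rw [h1]
    refine H.mul_mem (H.mul_mem (H.mul_mem (H.mul_mem (H.inv_mem hx) hyH) ?_) ?_) ?_
    · exact H.inv_mem (hexp _ (h.neg_mem p.2.1.2))
    · exact H.inv_mem (hexp _ p.2.2.2.1)
    · exact H.inv_mem (hexp _ hm2)
  have hp0 : L₁ p = 0 := hp p.1.2 hL1
  refine ⟨lieExp E G (L₂ p), hexp _ p.2.1.2, L₃ p, p.2.2.2.1, hfix _ p.2.2.2, ?_⟩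
  have h2 : lieExp E G (((adRep E x⁻¹).comp L₂) p) = x⁻¹ * lieExp E G (L₂ p) * x := by
    have : x⁻¹ * lieExp E G (L₂ p) * x⁻¹⁻¹ = lieExp E G (adRep E x⁻¹ (L₂ p)) := conj_lieExp E _ _
    rw [inv_inv] at this
    exact this.symm
  have h3 : lieExp E G ((-L₂) p) = (lieExp E G (L₂ p))⁻¹ := lieExp_neg E (L₂ p)
  simp only [hp0, lieExp_zero, one_mul, h2, h3] at hpy
  have h4 : y = x * (x⁻¹ * y) := by group
  rw [h4, ← hpy]
  group

/-- The exponential map of a compact connected group is onto: being an exponential is a locally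
constant property on `H`, as nearby elements are conjugate to `x exp Z` with `Z` fixed by `Ad x`. -/
theorem exists_lieExp_eq {B : E →ₗ[ℝ] E →ₗ[ℝ] ℝ} (hB : IsInvariantForm G B)
    {H : Subgroup G} (hH : IsClosed (H : Set G)) (hc : IsPreconnected (H : Set G)) {x : G}
    (hx : x ∈ H) : ∃ X ∈ subLie E H, lieExp E G X = x := by
  set A : Set G := {x | ∃ X ∈ subLie E H, lieExp E G X = x} with hA
  have hconj : ∀ c ∈ H, ∀ y ∈ A, c * y * c⁻¹ ∈ A := by
    rintro c hc _ ⟨Y, hY, rfl⟩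
    exact ⟨adRep E c Y, adRep_mem_subLie hH hc hY, (conj_lieExp E c Y).symm⟩
  have hloc : ∀ x ∈ (H : Set G), ∀ᶠ y in 𝓝[(H : Set G)] x, (x ∈ A ↔ y ∈ A) := by
    intro x hx
    filter_upwards [nhdsWithin_le_nhds (eventually_conj_mul_lieExp hB hH hx),
      self_mem_nhdsWithin] with y hy hyH
    obtain ⟨c, hcH, Z, hZ, hfix, rfl⟩ := hy hyH
    constructor
    · rintro ⟨X, hX, rfl⟩
      exact hconj c hcH _ (exists_lieExp_mul hB hH hX hZ hfix)
    · intro hA'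
      have h1 := hconj c⁻¹ (H.inv_mem hcH) _ hA'
      have h2 : c⁻¹ * (c * (x * lieExp E G Z) * c⁻¹) * c⁻¹⁻¹ = x * lieExp E G Z := by group
      rw [h2] at h1
      obtain ⟨X, hX, hXe⟩ := h1
      have hfix' : adRep E (lieExp E G X) (-Z) = -Z := by
        rw [hXe, adRep_mul, map_neg, adRep_lieExp_self, map_neg, hfix]
      obtain ⟨Y, hY, hYe⟩ := exists_lieExp_mul hB hH hX (Submodule.neg_mem _ hZ) hfix'
      exact ⟨Y, hY, by rw [hYe, hXe, lieExp_neg, mul_inv_cancel_right]⟩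
  have h := hc.induction₂ (fun x y => x ∈ A ↔ y ∈ A) hloc
    (fun _ _ _ _ _ _ h1 h2 => h1.trans h2) (fun _ _ _ _ h => h.symm) H.one_mem hx
  exact h.1 ⟨0, Submodule.zero_mem _, lieExp_zero E⟩

/-- The stabilizer of `Y` under the adjoint representation. -/
def adStabilizer (G : Type*) [TopologicalSpace G] [ChartedSpace E G] [Group G]
    [LieGroup 𝓘(ℝ, E) ∞ G] [T2Space G] (Y : E) : Subgroup G where
  carrier := {c | adRep E c Y = Y}
  one_mem' := adRep_one E Y
  mul_mem' {a b} ha hb := by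
    change adRep E (a * b) Y = Y
    rw [adRep_mul, hb, ha]
  inv_mem' {a} ha := by
    change adRep E a⁻¹ Y = Y
    conv_lhs => rw [← (ha : adRep E a Y = Y)]
    exact adRep_inv_adRep E a Y

/-- Simultaneous version of `exists_bracketE_adRep_eq_zero` for commuting elements. -/
theorem exists_adRep_commute_list {B : E →ₗ[ℝ] E →ₗ[ℝ] ℝ} (hB : IsInvariantForm G B) (l : List E) :
    ∀ {H : Subgroup G}, IsClosed (H : Set G) → ∀ {X : E}, X ∈ subLie E H →
      (∀ Y ∈ l, Y ∈ subLie E H) → (∀ Y ∈ l, ∀ Z ∈ l, bracketE E G Y Z = 0) →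
      ∃ c ∈ H, ∀ Y ∈ l, bracketE E G (adRep E c X) Y = 0 := by
  induction l with
  | nil => exact fun _ _ _ _ _ => ⟨1, Subgroup.one_mem _, by simp⟩
  | cons Y l ih =>
    intro H hH X hX hl hcomm
    obtain ⟨c₁, hc₁, h1⟩ := exists_bracketE_adRep_eq_zero hB hH hX (hl Y (by simp))
    have hcl : IsClosed ((H ⊓ adStabilizer G Y : Subgroup G) : Set G) :=
      hH.inter (isClosed_eq (continuous_adRep E Y) continuous_const)
    have hmem : ∀ W ∈ subLie E H, bracketE E G W Y = 0 → W ∈ subLie E (H ⊓ adStabilizer G Y) :=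
      fun W hW hWY => mem_subLie_of_oneParam_mem fun t =>
        ⟨(mem_subLie_iff hH).1 hW t, adRep_oneParam_of_bracketE_eq_zero E hWY t⟩
    obtain ⟨c₂, ⟨hc₂H, hc₂Y⟩, h2⟩ := ih hcl (hmem _ (adRep_mem_subLie hH hc₁ hX) h1)
      (fun Z hZ => hmem Z (hl Z (by simp [hZ])) (hcomm Z (by simp [hZ]) Y (by simp)))
      (fun Z hZ W hW => hcomm Z (by simp [hZ]) W (by simp [hW]))
    refine ⟨c₂ * c₁, H.mul_mem hc₂H hc₁, fun Z hZ => ?_⟩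
    rw [adRep_mul]
    rcases List.mem_cons.1 hZ with rfl | hZ
    · conv_lhs => rw [← (hc₂Y : adRep E c₂ Z = Z)]
      rw [← adRep_bracketE, h1, map_zero]
    · exact h2 Z hZ

/-- An element of a compact connected group `K` that centralizes an abelian closed subgroup `S` of
`K` is the exponential of an element of the Lie algebra of `K` that commutes with that of `S`. -/
theorem exists_lieExp_eq_of_centralizes {B : E →ₗ[ℝ] E →ₗ[ℝ] ℝ} (hB : IsInvariantForm G B)
    {K S : Subgroup G} (hK : IsClosed (K : Set G)) (hKc : IsPreconnected (K : Set G))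
    (hS : IsClosed (S : Set G)) (hSK : S ≤ K) (hSc : ∀ x ∈ S, ∀ y ∈ S, x * y = y * x) {g : G}
    (hg : g ∈ K) (hgS : ∀ x ∈ S, x * g = g * x) :
    ∃ X ∈ subLie E K, lieExp E G X = g ∧ ∀ Y ∈ subLie E S, bracketE E G Y X = 0 := by
  obtain ⟨X₀, hX₀, hX₀g⟩ := exists_lieExp_eq hB hK hKc hg
  have hcl : IsClosed ((K ⊓ Subgroup.centralizer {g} : Subgroup G) : Set G) :=
    hK.inter (isClosed_centralizer_singleton g)
  have hX₀' : X₀ ∈ subLie E (K ⊓ Subgroup.centralizer {g}) :=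
    mem_subLie_of_oneParam_mem fun t => ⟨(mem_subLie_iff hK).1 hX₀ t, by
      rw [← hX₀g]; exact oneParam_mem_centralizer (adRep_lieExp_self X₀) t⟩
  obtain ⟨b, hb⟩ := Submodule.fg_def.1 (IsNoetherian.noetherian (subLie E S))
  obtain ⟨hbf, hbs⟩ := hb
  have hbS : ∀ Y ∈ hbf.toFinset.toList, Y ∈ subLie E S := fun Y hY => by
    rw [← hbs]; exact Submodule.subset_span (by simpa using hY)
  have habel : ∀ Y ∈ subLie E S, ∀ Z ∈ subLie E S, bracketE E G Y Z = 0 := fun Y hY Z hZ =>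
    bracketE_eq_zero_of_commute E fun a b =>
      hSc _ ((mem_subLie_iff hS).1 hY a) _ ((mem_subLie_iff hS).1 hZ b)
  obtain ⟨c, ⟨hcK, hcg⟩, hc⟩ := exists_adRep_commute_list hB hbf.toFinset.toList hcl hX₀'
    (fun Y hY => mem_subLie_of_oneParam_mem fun t =>
      ⟨hSK ((mem_subLie_iff hS).1 (hbS Y hY) t), Subgroup.mem_centralizer_iff.2 (by
        rintro _ rfl
        exact (hgS _ ((mem_subLie_iff hS).1 (hbS Y hY) t)).symm)⟩)
    (fun Y hY Z hZ => habel Y (hbS Y hY) Z (hbS Z hZ))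
  refine ⟨adRep E c X₀, adRep_mem_subLie hK hcK hX₀, ?_, ?_⟩
  · have h1 : c * lieExp E G X₀ * c⁻¹ = lieExp E G (adRep E c X₀) := conj_lieExp E c X₀
    rw [← h1, hX₀g, mul_inv_eq_iff_eq_mul]
    exact (Subgroup.mem_centralizer_iff.1 hcg g rfl).symm
  · intro Y hY
    let T : E →ₗ[ℝ] E := ((LieAlgebra.ad ℝ (RealLieAlg E G) (adRep E c X₀)) :
      RealLieAlg E G →ₗ[ℝ] RealLieAlg E G)
    have hT : subLie E S ≤ LinearMap.ker T := by
      rw [← hbs, Submodule.span_le]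
      intro Z hZ
      exact hc Z (by simpa using hZ)
    rw [bracketE_skew, neg_eq_zero]
    exact hT hY

end Surjectivity

end LieGroups

/-! ### Complexification of a real Lie algebra -/

section Complexification

open TensorProduct

variable {L : Type*} [AddCommGroup L] [Module ℝ L]

/-- The real part of an element of `ℂ ⊗ L`. -/
def rePart : ℂ ⊗[ℝ] L →ₗ[ℝ] L :=
  (TensorProduct.lid ℝ L).toLinearMap ∘ₗ LinearMap.rTensor L Complex.reLm

/-- The imaginary part of an element of `ℂ ⊗ L`. -/
def imPart : ℂ ⊗[ℝ] L →ₗ[ℝ] L :=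
  (TensorProduct.lid ℝ L).toLinearMap ∘ₗ LinearMap.rTensor L Complex.imLm

/-- Complex conjugation on `ℂ ⊗ L`. -/
def conjC : ℂ ⊗[ℝ] L →ₗ[ℝ] ℂ ⊗[ℝ] L :=
  LinearMap.rTensor L Complex.conjAe.toLinearMap

@[simp] theorem rePart_tmul (z : ℂ) (x : L) : rePart (z ⊗ₜ[ℝ] x) = z.re • x := by simp [rePart]

@[simp] theorem imPart_tmul (z : ℂ) (x : L) : imPart (z ⊗ₜ[ℝ] x) = z.im • x := by simp [imPart]

@[simp] theorem conjC_tmul (z : ℂ) (x : L) :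
    conjC (z ⊗ₜ[ℝ] x) = (starRingEnd ℂ z) ⊗ₜ[ℝ] x := by simp [conjC]

theorem rePart_add_imPart (w : ℂ ⊗[ℝ] L) :
    w = (1 : ℂ) ⊗ₜ[ℝ] rePart w + Complex.I ⊗ₜ[ℝ] imPart w := by
  induction w with
  | zero => simp
  | tmul z x =>
    rw [rePart_tmul, imPart_tmul, ← smul_tmul, ← smul_tmul, ← add_tmul]
    congr 1
    apply Complex.ext <;> simp
  | add u v hu hv =>
    rw [map_add, map_add, tmul_add, tmul_add]
    conv_lhs => rw [hu, hv]
    abel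

@[simp] theorem conjC_conjC (w : ℂ ⊗[ℝ] L) : conjC (conjC w) = w := by
  induction w with
  | zero => simp
  | tmul z x => simp
  | add u v hu hv => rw [map_add, map_add, hu, hv]

theorem conjC_smul (c : ℂ) (w : ℂ ⊗[ℝ] L) : conjC (c • w) = starRingEnd ℂ c • conjC w := by
  induction w with
  | zero => simp
  | tmul z x => simp [smul_tmul']
  | add u v hu hv => rw [smul_add, map_add, map_add, smul_add, hu, hv]

theorem mem_baseChange_iff (V : Submodule ℝ L) (w : ℂ ⊗[ℝ] L) :
    w ∈ V.baseChange ℂ ↔ rePart w ∈ V ∧ imPart w ∈ V := by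
  constructor
  · intro h
    rw [Submodule.baseChange_eq_span] at h
    induction h using Submodule.span_induction with
    | mem x hx =>
      obtain ⟨y, hy, rfl⟩ := hx
      simpa using hy
    | zero => simp
    | add u v _ _ hu hv =>
      rw [map_add, map_add]
      exact ⟨V.add_mem hu.1 hv.1, V.add_mem hu.2 hv.2⟩
    | smul c u _ hu =>
      have h1 : c • u = (c : ℂ) ⊗ₜ[ℝ] rePart u + (c * Complex.I) ⊗ₜ[ℝ] imPart u := by
        conv_lhs => rw [rePart_add_imPart u]
        simp [smul_tmul']
      rw [h1]
      simp only [map_add, rePart_tmul, imPart_tmul]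
      exact ⟨V.add_mem (V.smul_mem _ hu.1) (V.smul_mem _ hu.2),
        V.add_mem (V.smul_mem _ hu.1) (V.smul_mem _ hu.2)⟩
  · rintro ⟨h1, h2⟩
    rw [rePart_add_imPart w]
    exact Submodule.add_mem _ (Submodule.tmul_mem_baseChange_of_mem _ h1)
      (Submodule.tmul_mem_baseChange_of_mem _ h2)

theorem conjC_mem_baseChange {V : Submodule ℝ L} {w : ℂ ⊗[ℝ] L} (h : w ∈ V.baseChange ℂ) :
    conjC w ∈ V.baseChange ℂ := by
  rw [mem_baseChange_iff] at h
  rw [rePart_add_imPart w, map_add]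
  refine Submodule.add_mem _ ?_ ?_ <;> rw [conjC_tmul]
  · exact Submodule.tmul_mem_baseChange_of_mem _ h.1
  · exact Submodule.tmul_mem_baseChange_of_mem _ h.2

theorem baseChange_conjC (θ : L →ₗ[ℝ] L) (w : ℂ ⊗[ℝ] L) :
    θ.baseChange ℂ (conjC w) = conjC (θ.baseChange ℂ w) := by
  induction w with
  | zero => simp
  | tmul z x => simp
  | add u v hu hv => simp only [map_add, hu, hv]

theorem rePart_baseChange (θ : L →ₗ[ℝ] L) (w : ℂ ⊗[ℝ] L) :
    rePart (θ.baseChange ℂ w) = θ (rePart w) := by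
  induction w with
  | zero => simp
  | tmul z x => simp
  | add u v hu hv => simp only [map_add, hu, hv]

theorem imPart_baseChange (θ : L →ₗ[ℝ] L) (w : ℂ ⊗[ℝ] L) :
    imPart (θ.baseChange ℂ w) = θ (imPart w) := by
  induction w with
  | zero => simp
  | tmul z x => simp
  | add u v hu hv => simp only [map_add, hu, hv]

section Form

variable (B : LinearMap.BilinForm ℝ L)

theorem baseChange_conjC_conjC (u v : ℂ ⊗[ℝ] L) :
    B.baseChange ℂ (conjC u) (conjC v) = starRingEnd ℂ (B.baseChange ℂ u v) := by
  induction u with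
  | zero => simp
  | add u₁ u₂ h₁ h₂ => simp only [map_add, LinearMap.add_apply, h₁, h₂]
  | tmul z x =>
    induction v with
    | zero => simp
    | add v₁ v₂ h₁ h₂ => simp only [map_add, h₁, h₂]
    | tmul w y => simp

theorem baseChange_comm (hsymm : ∀ X Y, B X Y = B Y X) (u v : ℂ ⊗[ℝ] L) :
    B.baseChange ℂ u v = B.baseChange ℂ v u :=
  (LinearMap.BilinForm.IsSymm.baseChange ℂ (B₂ := B) ⟨hsymm⟩).eq u v

/-- `u ↦ -B(u, ū)` is positive definite. -/
theorem eq_zero_of_baseChange_conjC (hsymm : ∀ X Y, B X Y = B Y X)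
    (hneg : ∀ X, X ≠ 0 → B X X < 0) {u : ℂ ⊗[ℝ] L} (h : B.baseChange ℂ u (conjC u) = 0) : u = 0 := by
  have hle : ∀ X, B X X ≤ 0 := fun X => by
    rcases eq_or_ne X 0 with rfl | hX
    · simp
    · exact (hneg X hX).le
  have h1 : B.baseChange ℂ u (conjC u) =
      ((B (rePart u) (rePart u) + B (imPart u) (imPart u) : ℝ) : ℂ) := by
    conv_lhs => rw [rePart_add_imPart u]
    simp only [map_add, LinearMap.add_apply, conjC_tmul, LinearMap.BilinForm.baseChange_tmul,
      hsymm (imPart u) (rePart u)]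
    apply Complex.ext <;> simp
  rw [h1, Complex.ofReal_eq_zero] at h
  have hr : rePart u = 0 := by
    by_contra hne
    linarith [hneg _ hne, hle (imPart u)]
  have hi : imPart u = 0 := by
    by_contra hne
    linarith [hneg _ hne, hle (rePart u)]
  rw [rePart_add_imPart u, hr, hi]
  simp

end Form

end Complexification

section ComplexificationLie

open TensorProduct

variable {L : Type*} [LieRing L] [LieAlgebra ℝ L]

-- The bracket on `ℂ ⊗ L` that instance search finds is not syntactically the one of its Lie ring
-- structure; the Lie ring identities are restated for it so that they can be rewritten with.

theorem tensor_add_lie (u v w : ℂ ⊗[ℝ] L) : ⁅u + v, w⁆ = ⁅u, w⁆ + ⁅v, w⁆ := add_lie u v w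

theorem tensor_lie_add (u v w : ℂ ⊗[ℝ] L) : ⁅u, v + w⁆ = ⁅u, v⁆ + ⁅u, w⁆ := lie_add u v w

theorem tensor_lie_zero (u : ℂ ⊗[ℝ] L) : ⁅u, (0 : ℂ ⊗[ℝ] L)⁆ = 0 := lie_zero u

theorem tensor_smul_lie (c : ℂ) (u v : ℂ ⊗[ℝ] L) : ⁅c • u, v⁆ = c • ⁅u, v⁆ := smul_lie c u v

theorem tensor_lie_smul (c : ℂ) (u v : ℂ ⊗[ℝ] L) : ⁅u, c • v⁆ = c • ⁅u, v⁆ := lie_smul c u v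

theorem tensor_lie_skew (u v : ℂ ⊗[ℝ] L) : -⁅v, u⁆ = ⁅u, v⁆ := lie_skew u v

theorem tensor_lie_lie (u v w : ℂ ⊗[ℝ] L) : ⁅⁅u, v⁆, w⁆ = ⁅u, ⁅v, w⁆⁆ - ⁅v, ⁅u, w⁆⁆ :=
  lie_lie u v w

theorem conjC_lie (u v : ℂ ⊗[ℝ] L) : conjC ⁅u, v⁆ = ⁅conjC u, conjC v⁆ := by
  induction u with
  | zero => simp
  | add u₁ u₂ h₁ h₂ => simp only [map_add, tensor_add_lie, h₁, h₂]
  | tmul z x =>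
    induction v with
    | zero => simp [tensor_lie_zero]
    | add v₁ v₂ h₁ h₂ => simp only [map_add, tensor_lie_add, h₁, h₂]
    | tmul w y => simp

theorem baseChange_lie {θ : L →ₗ[ℝ] L} (hθ : ∀ X Y : L, θ ⁅X, Y⁆ = ⁅θ X, θ Y⁆) (u v : ℂ ⊗[ℝ] L) :
    θ.baseChange ℂ ⁅u, v⁆ = ⁅θ.baseChange ℂ u, θ.baseChange ℂ v⁆ := by
  induction u with
  | zero => simp
  | add u₁ u₂ h₁ h₂ => simp only [map_add, tensor_add_lie, h₁, h₂]
  | tmul z x =>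
    induction v with
    | zero => simp [tensor_lie_zero]
    | add v₁ v₂ h₁ h₂ => simp only [map_add, tensor_lie_add, h₁, h₂]
    | tmul w y => simp [hθ]

theorem baseChange_form_lie {B : LinearMap.BilinForm ℝ L}
    (hinv : ∀ X Y Z : L, B ⁅X, Y⁆ Z = -B Y ⁅X, Z⁆) (u v w : ℂ ⊗[ℝ] L) :
    B.baseChange ℂ ⁅u, v⁆ w = -B.baseChange ℂ v ⁅u, w⁆ := by
  induction u with
  | zero => simp
  | add u₁ u₂ h₁ h₂ => simp only [map_add, tensor_add_lie, LinearMap.add_apply, h₁, h₂]; ring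
  | tmul z x =>
    induction v with
    | zero => simp [tensor_lie_zero]
    | add v₁ v₂ h₁ h₂ => simp only [map_add, tensor_lie_add, LinearMap.add_apply, h₁, h₂]; ring
    | tmul z' y =>
      induction w with
      | zero => simp [tensor_lie_zero]
      | add w₁ w₂ h₁ h₂ => simp only [map_add, tensor_lie_add, h₁, h₂]; ring
      | tmul z'' y' =>
        simp only [LieAlgebra.ExtendScalars.bracket_tmul, LinearMap.BilinForm.baseChange_tmul, hinv,
          neg_smul, Complex.real_smul]
        ring

theorem lie_eq_of_re_im (u w : ℂ ⊗[ℝ] L) :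
    ⁅u, w⁆ = ⁅(1 : ℂ) ⊗ₜ[ℝ] rePart u, w⁆ + Complex.I • ⁅(1 : ℂ) ⊗ₜ[ℝ] imPart u, w⁆ := by
  conv_lhs => rw [rePart_add_imPart u]
  rw [tensor_add_lie, ← tensor_smul_lie, smul_tmul', smul_eq_mul, mul_one]

theorem rePart_one_tmul_lie (Y : L) (w : ℂ ⊗[ℝ] L) :
    rePart ⁅(1 : ℂ) ⊗ₜ[ℝ] Y, w⁆ = ⁅Y, rePart w⁆ := by
  conv_lhs => rw [rePart_add_imPart w]
  simp [tensor_lie_add]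

theorem imPart_one_tmul_lie (Y : L) (w : ℂ ⊗[ℝ] L) :
    imPart ⁅(1 : ℂ) ⊗ₜ[ℝ] Y, w⁆ = ⁅Y, imPart w⁆ := by
  conv_lhs => rw [rePart_add_imPart w]
  simp [tensor_lie_add]

theorem one_tmul_lie_eq_zero_iff (Y : L) (w : ℂ ⊗[ℝ] L) :
    ⁅(1 : ℂ) ⊗ₜ[ℝ] Y, w⁆ = 0 ↔ ⁅Y, rePart w⁆ = 0 ∧ ⁅Y, imPart w⁆ = 0 := by
  rw [← rePart_one_tmul_lie, ← imPart_one_tmul_lie]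
  refine ⟨fun h => by simp [h], fun h => ?_⟩
  rw [rePart_add_imPart ⁅(1 : ℂ) ⊗ₜ[ℝ] Y, w⁆, h.1, h.2]
  simp

/-! ### Automorphisms of finite order with central fixed points -/

variable {B : LinearMap.BilinForm ℝ L}

/-- If `x` and its conjugate have commuting adjoint actions, then `ad x` is normal for the positive
definite Hermitian form `-B(u, v̄)`, so that its kernel and the kernel of its square agree. -/
theorem lie_eq_zero_of_lie_lie_eq_zero (hsymm : ∀ X Y : L, B X Y = B Y X)
    (hneg : ∀ X, X ≠ 0 → B X X < 0) (hinv : ∀ X Y Z : L, B ⁅X, Y⁆ Z = -B Y ⁅X, Z⁆)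
    {x : ℂ ⊗[ℝ] L} (hx : ∀ v : ℂ ⊗[ℝ] L, ⁅x, ⁅conjC x, v⁆⁆ = ⁅conjC x, ⁅x, v⁆⁆) {v : ℂ ⊗[ℝ] L}
    (h : ⁅x, ⁅x, v⁆⁆ = 0) : ⁅x, v⁆ = 0 := by
  have h1 : ⁅conjC x, ⁅x, v⁆⁆ = 0 := by
    refine eq_zero_of_baseChange_conjC B hsymm hneg ?_
    rw [conjC_lie, conjC_lie, conjC_conjC, baseChange_form_lie hinv, ← hx, baseChange_comm B hsymm,
      baseChange_form_lie hinv, h]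
    simp
  refine eq_zero_of_baseChange_conjC B hsymm hneg ?_
  rw [conjC_lie, baseChange_comm B hsymm, baseChange_form_lie hinv, h1]
  simp

/-- If `ad x` is normal, a vector killed by a power of `ad x` is killed by `ad x`. -/
theorem lie_eq_zero_of_iterate (hsymm : ∀ X Y : L, B X Y = B Y X)
    (hneg : ∀ X, X ≠ 0 → B X X < 0) (hinv : ∀ X Y Z : L, B ⁅X, Y⁆ Z = -B Y ⁅X, Z⁆)
    {x : ℂ ⊗[ℝ] L} (hx : ∀ v : ℂ ⊗[ℝ] L, ⁅x, ⁅conjC x, v⁆⁆ = ⁅conjC x, ⁅x, v⁆⁆) {v : ℂ ⊗[ℝ] L}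
    (k : ℕ) (h : (fun v => ⁅x, v⁆)^[k + 1] v = 0) : ⁅x, v⁆ = 0 := by
  induction k with
  | zero => simpa using h
  | succ k ih =>
    apply ih
    rw [Function.iterate_succ_apply', Function.iterate_succ_apply'] at h
    rw [Function.iterate_succ_apply']
    exact lie_eq_zero_of_lie_lie_eq_zero hsymm hneg hinv hx h

/-- A compact Lie algebra is abelian as soon as it has an automorphism `θ` of finite order with
central fixed points. With `ζ` a primitive `n`-th root of unity, the `ζ ^ s`-eigenspaces of `θ` are
shown to be central by induction on `s`: repeated bracketing with such an eigenvector `x` leads from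
any eigenspace into one with a smaller exponent, so `ad x` is nilpotent on eigenvectors, while it is
normal because `[x, x̄]` is fixed by `θ`. -/
theorem lie_eq_zero_of_fixed_central [FiniteDimensional ℝ L] (hsymm : ∀ X Y : L, B X Y = B Y X)
    (hneg : ∀ X, X ≠ 0 → B X X < 0) (hinv : ∀ X Y Z : L, B ⁅X, Y⁆ Z = -B Y ⁅X, Z⁆)
    {θ : L →ₗ[ℝ] L} (hθ : ∀ X Y : L, θ ⁅X, Y⁆ = ⁅θ X, θ Y⁆) {n : ℕ} (hn : 0 < n)
    (hθn : ∀ X, θ^[n] X = X) (hfix : ∀ X, θ X = X → ∀ Y : L, ⁅X, Y⁆ = 0) (X Y : L) : ⁅X, Y⁆ = 0 := by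
  set T : Module.End ℂ (ℂ ⊗[ℝ] L) := θ.baseChange ℂ with hT
  have hTn : T ^ n = 1 := by
    have h1 : θ ^ n = LinearMap.id := by
      ext X; rw [Module.End.pow_apply]; exact hθn X
    have h2 : (θ ^ n).baseChange ℂ = T ^ n := LinearMap.baseChange_pow _ _ _ θ n
    rw [← h2, h1, LinearMap.baseChange_id]
    rfl
  have hTlie : ∀ u v, T ⁅u, v⁆ = ⁅T u, T v⁆ := baseChange_lie hθ
  obtain ⟨ζ, hζ⟩ : ∃ ζ : ℂ, IsPrimitiveRoot ζ n :=
    ⟨_, Complex.isPrimitiveRoot_exp n hn.ne'⟩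
  have hζconj : ∀ s : ℕ, ζ ^ s * starRingEnd ℂ (ζ ^ s) = 1 := by
    intro s
    rw [Complex.mul_conj, Complex.normSq_eq_norm_sq, norm_pow,
      Complex.norm_eq_one_of_pow_eq_one hζ.pow_eq_one hn.ne']
    simp
  have hspan : ⨆ μ : ℂ, Module.End.eigenspace T μ = ⊤ := by
    refine Module.End.IsSemisimple.iSup_eigenspace_eq_top ?_
    refine Module.End.isSemisimple_of_squarefree_aeval_eq_zero
      (p := (Polynomial.X ^ n - 1 : Polynomial ℂ)) ?_ ?_
    · exact (Polynomial.separable_X_pow_sub_C (1 : ℂ) (by exact_mod_cast hn.ne')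
        one_ne_zero).squarefree
    · simp [hTn]
  have hcent0 : ∀ x, T x = x → ∀ y : ℂ ⊗[ℝ] L, ⁅x, y⁆ = 0 := by
    intro x hx y
    have hre : θ (rePart x) = rePart x := by rw [← rePart_baseChange]; exact congrArg _ hx
    have him : θ (imPart x) = imPart x := by rw [← imPart_baseChange]; exact congrArg _ hx
    rw [lie_eq_of_re_im, (one_tmul_lie_eq_zero_iff _ _).2 ⟨hfix _ hre _, hfix _ hre _⟩,
      (one_tmul_lie_eq_zero_iff _ _).2 ⟨hfix _ him _, hfix _ him _⟩, smul_zero, add_zero]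
  -- It suffices to bracket with eigenvectors.
  have hred : ∀ x : ℂ ⊗[ℝ] L, (∀ j < n, ∀ y, T y = ζ ^ j • y → ⁅x, y⁆ = 0) →
      ∀ y : ℂ ⊗[ℝ] L, ⁅x, y⁆ = 0 := by
    intro x hx y
    have hy : y ∈ ⨆ μ : ℂ, Module.End.eigenspace T μ := hspan ▸ Submodule.mem_top
    induction hy using Submodule.iSup_induction' with
    | zero => exact tensor_lie_zero x
    | add u v _ _ hu hv => rw [tensor_lie_add, hu, hv, add_zero]
    | mem μ y hy =>
      rcases eq_or_ne y 0 with rfl | hy0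
      · exact tensor_lie_zero x
      rw [Module.End.mem_eigenspace_iff] at hy
      have hpow : ∀ k : ℕ, (T ^ k) y = μ ^ k • y := by
        intro k
        induction k with
        | zero => simp
        | succ k ih => rw [pow_succ', Module.End.mul_apply, ih, map_smul, hy, smul_smul, pow_succ]
      have hμ : μ ^ n = 1 := by
        have h1 := hpow n
        rw [hTn, Module.End.one_apply] at h1
        have h2 : (μ ^ n - 1) • y = 0 := by rw [sub_smul, one_smul, ← h1, sub_self]
        exact sub_eq_zero.1 ((smul_eq_zero.1 h2).resolve_right hy0)
      have : NeZero n := ⟨hn.ne'⟩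
      obtain ⟨j, hj, rfl⟩ := hζ.eq_pow_of_pow_eq_one hμ
      exact hx j hj y hy
  have hcent : ∀ s, s < n → ∀ x, T x = ζ ^ s • x → ∀ y : ℂ ⊗[ℝ] L, ⁅x, y⁆ = 0 := by
    intro s
    induction s using Nat.strong_induction_on with
    | _ s ih =>
      intro hs x hx
      rcases Nat.eq_zero_or_pos s with rfl | hs0
      · exact hcent0 x (by simpa using hx)
      have hxbar : T (conjC x) = starRingEnd ℂ (ζ ^ s) • conjC x := by
        rw [hT, baseChange_conjC, ← hT, hx, conjC_smul]
      have hnorm : ∀ v : ℂ ⊗[ℝ] L, ⁅x, ⁅conjC x, v⁆⁆ = ⁅conjC x, ⁅x, v⁆⁆ := by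
        intro v
        have h1 : ⁅⁅x, conjC x⁆, v⁆ = 0 := by
          refine hcent0 _ ?_ v
          rw [hTlie, hx, hxbar, tensor_smul_lie, tensor_lie_smul, smul_smul, hζconj, one_smul]
        rw [tensor_lie_lie] at h1
        exact sub_eq_zero.1 h1
      refine hred x fun j hj y hy => ?_
      have hiter : ∀ k : ℕ, T ((fun v => ⁅x, v⁆)^[k] y) = ζ ^ (j + k * s) • (fun v => ⁅x, v⁆)^[k] y := by
        intro k
        induction k with
        | zero => simpa using hy
        | succ k ihk =>
          rw [Function.iterate_succ_apply', hTlie, ihk, hx, tensor_smul_lie, tensor_lie_smul, smul_smul]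
          congr 1
          ring
      -- The first exponent `j + k s` beyond `n` exceeds it by less than `s`.
      obtain ⟨k, r, hr, hkr⟩ : ∃ k r, r < s ∧ j + k * s = n + r := by
        refine ⟨(n - j + s - 1) / s, j + (n - j + s - 1) / s * s - n, ?_, ?_⟩
        · have h1 := Nat.div_mul_le_self (n - j + s - 1) s
          omega
        · have h1 := Nat.lt_div_mul_add (a := n - j + s - 1) hs0
          omega
      have hk := hiter k
      rw [hkr, pow_add, hζ.pow_eq_one, one_mul] at hk
      refine lie_eq_zero_of_iterate hsymm hneg hinv hnorm k ?_
      rw [Function.iterate_succ_apply', ← tensor_lie_skew, ih r hr (hr.trans hs) _ hk, neg_zero]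
  have hall : ∀ y x : ℂ ⊗[ℝ] L, ⁅y, x⁆ = 0 := fun y => hred y fun j hj x hx => by
    rw [← tensor_lie_skew, hcent j hj x hx y, neg_zero]
  have := hall ((1 : ℂ) ⊗ₜ[ℝ] X) ((1 : ℂ) ⊗ₜ[ℝ] Y)
  simpa using ((one_tmul_lie_eq_zero_iff X _).1 this).1

end ComplexificationLie

/-! ### Roots that vanish on the smaller torus -/

section CoreAlgebra

open TensorProduct

variable {L : Type*} [LieRing L] [LieAlgebra ℝ L]

/-- The situation on the level of real Lie algebras: a compact Lie algebra `L` with invariant form `B`, an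
involution `θ` of `L`, a subspace `s`, the centralizer `t₁` of `s` in the fixed space of `θ`, and
the centralizer `t` of `t₁` in `L`, which is assumed to be abelian. -/
structure InvolutionTorusData (B : LinearMap.BilinForm ℝ L) (θ : L →ₗ[ℝ] L)
    (s t₁ t : Submodule ℝ L) : Prop where
  symm : ∀ X Y : L, B X Y = B Y X
  neg : ∀ X, X ≠ 0 → B X X < 0
  invariant : ∀ X Y Z : L, B ⁅X, Y⁆ Z = -B Y ⁅X, Z⁆
  map_lie : ∀ X Y : L, θ ⁅X, Y⁆ = ⁅θ X, θ Y⁆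
  involutive : ∀ X, θ (θ X) = X
  s_le : s ≤ t₁
  t₁_le : t₁ ≤ t
  mem_t₁ : ∀ X : L, X ∈ t₁ ↔ θ X = X ∧ ∀ Y ∈ s, ⁅Y, X⁆ = 0
  mem_t : ∀ X : L, X ∈ t ↔ ∀ Y ∈ t₁, ⁅Y, X⁆ = 0
  abelian : ∀ X ∈ t, ∀ Y ∈ t, ⁅X, Y⁆ = 0

theorem mem_rootSpace_iff {t : Submodule ℂ (ℂ ⊗[ℝ] L)} {α : Module.Dual ℂ t} {x : ℂ ⊗[ℝ] L} :
    x ∈ rootSpace t α ↔ ∀ h : t, ⁅(h : ℂ ⊗[ℝ] L), x⁆ = α h • x := Iff.rfl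

theorem lie_mem_rootSpace_add {t : Submodule ℂ (ℂ ⊗[ℝ] L)} {α β : Module.Dual ℂ t}
    {x y : ℂ ⊗[ℝ] L} (hx : x ∈ rootSpace t α) (hy : y ∈ rootSpace t β) :
    ⁅x, y⁆ ∈ rootSpace t (α + β) := by
  rw [mem_rootSpace_iff] at *
  intro h
  have h1 : ⁅(h : ℂ ⊗[ℝ] L), ⁅x, y⁆⁆ = ⁅⁅(h : ℂ ⊗[ℝ] L), x⁆, y⁆ + ⁅x, ⁅(h : ℂ ⊗[ℝ] L), y⁆⁆ :=
    leibniz_lie _ _ _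
  rw [h1, hx h, hy h, tensor_smul_lie, tensor_lie_smul, LinearMap.add_apply, add_smul]

theorem exists_ne_zero_of_mem_roots {t : Submodule ℂ (ℂ ⊗[ℝ] L)} {α : Module.Dual ℂ t}
    (hα : α ∈ roots t) : ∃ x ∈ rootSpace t α, x ≠ 0 :=
  (Submodule.ne_bot_iff _).1 hα.2

theorem mem_roots_of_mem_rootSpace {t : Submodule ℂ (ℂ ⊗[ℝ] L)} {α : Module.Dual ℂ t}
    (h0 : α ≠ 0) {x : ℂ ⊗[ℝ] L} (hx : x ∈ rootSpace t α) (hx0 : x ≠ 0) : α ∈ roots t :=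
  ⟨h0, (Submodule.ne_bot_iff _).2 ⟨x, hx, hx0⟩⟩

namespace InvolutionTorusData

variable {B : LinearMap.BilinForm ℝ L} {θ : L →ₗ[ℝ] L} {s t₁ t : Submodule ℝ L}

theorem mem_baseChange_t₁ (d : InvolutionTorusData B θ s t₁ t) {u : ℂ ⊗[ℝ] L}
    (hu : θ.baseChange ℂ u = u) (hs : ∀ Y ∈ s, ⁅(1 : ℂ) ⊗ₜ[ℝ] Y, u⁆ = 0) :
    u ∈ t₁.baseChange ℂ := by
  rw [mem_baseChange_iff, d.mem_t₁, d.mem_t₁, ← rePart_baseChange, ← imPart_baseChange, hu]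
  exact ⟨⟨rfl, fun Y hY => ((one_tmul_lie_eq_zero_iff Y u).1 (hs Y hY)).1⟩,
    ⟨rfl, fun Y hY => ((one_tmul_lie_eq_zero_iff Y u).1 (hs Y hY)).2⟩⟩

theorem mem_baseChange_t (d : InvolutionTorusData B θ s t₁ t) {u : ℂ ⊗[ℝ] L}
    (h : ∀ Y ∈ t₁, ⁅(1 : ℂ) ⊗ₜ[ℝ] Y, u⁆ = 0) : u ∈ t.baseChange ℂ := by
  rw [mem_baseChange_iff, d.mem_t, d.mem_t]
  exact ⟨fun Y hY => ((one_tmul_lie_eq_zero_iff Y u).1 (h Y hY)).1,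
    fun Y hY => ((one_tmul_lie_eq_zero_iff Y u).1 (h Y hY)).2⟩

theorem lie_eq_zero (d : InvolutionTorusData B θ s t₁ t) {u v : ℂ ⊗[ℝ] L}
    (hu : u ∈ t.baseChange ℂ) (hv : v ∈ t.baseChange ℂ) : ⁅u, v⁆ = 0 := by
  rw [mem_baseChange_iff] at hu hv
  rw [lie_eq_of_re_im, (one_tmul_lie_eq_zero_iff _ _).2
    ⟨d.abelian _ hu.1 _ hv.1, d.abelian _ hu.1 _ hv.2⟩, (one_tmul_lie_eq_zero_iff _ _).2
    ⟨d.abelian _ hu.2 _ hv.1, d.abelian _ hu.2 _ hv.2⟩, smul_zero, add_zero]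

theorem one_tmul_mem (d : InvolutionTorusData B θ s t₁ t) {Y : L} (hY : Y ∈ t₁) :
    (1 : ℂ) ⊗ₜ[ℝ] Y ∈ t.baseChange ℂ :=
  Submodule.tmul_mem_baseChange_of_mem _ (d.t₁_le hY)

theorem involutive_baseChange (d : InvolutionTorusData B θ s t₁ t) (u : ℂ ⊗[ℝ] L) :
    θ.baseChange ℂ (θ.baseChange ℂ u) = u := by
  rw [rePart_add_imPart (θ.baseChange ℂ (θ.baseChange ℂ u))]
  simp only [rePart_baseChange, imPart_baseChange, d.involutive]
  exact (rePart_add_imPart u).symm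

theorem baseChange_mem (d : InvolutionTorusData B θ s t₁ t) {u : ℂ ⊗[ℝ] L}
    (hu : u ∈ t.baseChange ℂ) : θ.baseChange ℂ u ∈ t.baseChange ℂ := by
  have h : ∀ X ∈ t, θ X ∈ t := by
    intro X hX
    rw [d.mem_t] at hX ⊢
    intro Y hY
    rw [← ((d.mem_t₁ Y).1 hY).1, ← d.map_lie, hX Y hY, map_zero]
  rw [mem_baseChange_iff] at hu ⊢
  rw [rePart_baseChange, imPart_baseChange]
  exact ⟨h _ hu.1, h _ hu.2⟩

theorem eq_zero_of_mem_rootSpace (d : InvolutionTorusData B θ s t₁ t)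
    {α : Module.Dual ℂ (t.baseChange ℂ)} (hα : α ≠ 0) {x : ℂ ⊗[ℝ] L}
    (hx : x ∈ rootSpace (t.baseChange ℂ) α) (hxt : x ∈ t.baseChange ℂ) : x = 0 := by
  by_contra hx0
  refine hα (LinearMap.ext fun h => ?_)
  have h1 := mem_rootSpace_iff.1 hx h
  rw [d.lie_eq_zero h.2 hxt] at h1
  exact (smul_eq_zero.1 h1.symm).resolve_right hx0

/-- If `α ∈ Ω` and `x ∈ 𝔤_α`, then `x + θ x` is fixed by `θ` and commutes with `s`, hence lies in
`t₁`, so that `α` vanishes on `t₁` unless `x + θ x = 0`; but then `x` would lie in `t`. -/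
theorem baseChange_apply_eq_neg (d : InvolutionTorusData B θ s t₁ t)
    {α : Module.Dual ℂ (t.baseChange ℂ)}
    (hα : α ∈ rootsVanishingOn (t.baseChange ℂ) (s.baseChange ℂ)) {x : ℂ ⊗[ℝ] L}
    (hx : x ∈ rootSpace (t.baseChange ℂ) α) : θ.baseChange ℂ x = -x := by
  rw [mem_rootSpace_iff] at hx
  set u := x + θ.baseChange ℂ x with hu
  have hTY : ∀ Y ∈ t₁, θ.baseChange ℂ ((1 : ℂ) ⊗ₜ[ℝ] Y) = (1 : ℂ) ⊗ₜ[ℝ] Y := fun Y hY => by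
    rw [LinearMap.baseChange_tmul, ((d.mem_t₁ Y).1 hY).1]
  have hYu : ∀ Y (hY : Y ∈ t₁), ⁅(1 : ℂ) ⊗ₜ[ℝ] Y, u⁆ = α ⟨_, d.one_tmul_mem hY⟩ • u := by
    intro Y hY
    have h1 := hx ⟨_, d.one_tmul_mem hY⟩
    have h2 : ⁅(1 : ℂ) ⊗ₜ[ℝ] Y, θ.baseChange ℂ x⁆ = θ.baseChange ℂ ⁅(1 : ℂ) ⊗ₜ[ℝ] Y, x⁆ := by
      rw [baseChange_lie d.map_lie, hTY Y hY]
    rw [hu, tensor_lie_add, h2, h1, map_smul, smul_add]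
  have hTu : θ.baseChange ℂ u = u := by
    rw [hu, map_add, d.involutive_baseChange, add_comm]
  have hut : u ∈ t₁.baseChange ℂ := by
    refine d.mem_baseChange_t₁ hTu fun Y hY => ?_
    rw [hYu Y (d.s_le hY), hα.2 _ (Submodule.tmul_mem_baseChange_of_mem _ hY), zero_smul]
  have hut' : u ∈ t.baseChange ℂ := by
    rw [mem_baseChange_iff] at hut ⊢
    exact ⟨d.t₁_le hut.1, d.t₁_le hut.2⟩
  have hu0 : u = 0 := by
    by_contra hu0
    have hα1 : ∀ Y (hY : Y ∈ t₁), α ⟨_, d.one_tmul_mem hY⟩ = 0 := by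
      intro Y hY
      have h1 := hYu Y hY
      rw [d.lie_eq_zero (d.one_tmul_mem hY) hut'] at h1
      exact (smul_eq_zero.1 h1.symm).resolve_right hu0
    have hxt : x ∈ t.baseChange ℂ := d.mem_baseChange_t fun Y hY => by
      have h1 := hx ⟨_, d.one_tmul_mem hY⟩
      rw [hα1 Y hY, zero_smul] at h1
      exact h1
    have hx0 := d.eq_zero_of_mem_rootSpace hα.1.1 hx hxt
    exact hu0 (by rw [hu, hx0, map_zero, add_zero])
  exact (neg_eq_of_add_eq_zero_right hu0).symm

theorem apply_baseChange (d : InvolutionTorusData B θ s t₁ t)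
    {α : Module.Dual ℂ (t.baseChange ℂ)}
    (hα : α ∈ rootsVanishingOn (t.baseChange ℂ) (s.baseChange ℂ)) (h : t.baseChange ℂ) :
    α ⟨θ.baseChange ℂ h, d.baseChange_mem h.2⟩ = α h := by
  obtain ⟨x, hx, hx0⟩ := exists_ne_zero_of_mem_roots hα.1
  have h1 := mem_rootSpace_iff.1 hx h
  have h2 := mem_rootSpace_iff.1 hx ⟨θ.baseChange ℂ h, d.baseChange_mem h.2⟩
  have h3 := congrArg (θ.baseChange ℂ) h1
  rw [baseChange_lie d.map_lie, map_smul, d.baseChange_apply_eq_neg hα hx, smul_neg] at h3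
  have h4 : ⁅θ.baseChange ℂ (h : ℂ ⊗[ℝ] L), -x⁆ = -⁅θ.baseChange ℂ (h : ℂ ⊗[ℝ] L), x⁆ :=
    lie_neg _ _
  rw [h4, neg_inj] at h3
  exact smul_left_injective ℂ hx0 (h2.symm.trans h3)

theorem add_mem_rootsVanishingOn {α β : Module.Dual ℂ (t.baseChange ℂ)}
    (hα : α ∈ rootsVanishingOn (t.baseChange ℂ) (s.baseChange ℂ))
    (hβ : β ∈ rootsVanishingOn (t.baseChange ℂ) (s.baseChange ℂ))
    (h : α + β ∈ roots (t.baseChange ℂ)) :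
    α + β ∈ rootsVanishingOn (t.baseChange ℂ) (s.baseChange ℂ) :=
  ⟨h, fun v hv => by rw [LinearMap.add_apply, hα.2 v hv, hβ.2 v hv, add_zero]⟩

/-- The bracket of two `(-1)`-eigenvectors of `θ` is fixed by `θ`. -/
theorem lie_rootSpace_eq_zero (d : InvolutionTorusData B θ s t₁ t)
    {α β : Module.Dual ℂ (t.baseChange ℂ)}
    (hα : α ∈ rootsVanishingOn (t.baseChange ℂ) (s.baseChange ℂ))
    (hβ : β ∈ rootsVanishingOn (t.baseChange ℂ) (s.baseChange ℂ)) (hne : α + β ≠ 0)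
    {x y : ℂ ⊗[ℝ] L} (hx : x ∈ rootSpace (t.baseChange ℂ) α)
    (hy : y ∈ rootSpace (t.baseChange ℂ) β) : ⁅x, y⁆ = 0 := by
  by_contra h0
  have hxy := lie_mem_rootSpace_add hx hy
  have hr := add_mem_rootsVanishingOn hα hβ (mem_roots_of_mem_rootSpace hne hxy h0)
  have h1 := d.baseChange_apply_eq_neg hr hxy
  have h2 : ⁅-x, -y⁆ = ⁅x, y⁆ := (neg_lie x (-y)).trans (by
    have : ⁅x, -y⁆ = -⁅x, y⁆ := lie_neg x y
    exact (congrArg Neg.neg this).trans (neg_neg _))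
  rw [baseChange_lie d.map_lie, d.baseChange_apply_eq_neg hα hx, d.baseChange_apply_eq_neg hβ hy,
    h2] at h1
  have h3 : (2 : ℂ) • ⁅x, y⁆ = 0 := by
    rw [two_smul]
    nth_rewrite 1 [h1]
    exact neg_add_cancel _
  exact h0 ((smul_eq_zero.1 h3).resolve_left two_ne_zero)

theorem baseChange_form_conjC_ne_zero (d : InvolutionTorusData B θ s t₁ t) {x : ℂ ⊗[ℝ] L}
    (hx : x ≠ 0) : B.baseChange ℂ x (conjC x) ≠ 0 := fun h =>
  hx (eq_zero_of_baseChange_conjC B d.symm d.neg h)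

/-- Roots are purely imaginary on the real form. -/
theorem apply_conjC (d : InvolutionTorusData B θ s t₁ t) {α : Module.Dual ℂ (t.baseChange ℂ)}
    (hα : α ∈ roots (t.baseChange ℂ)) (h : t.baseChange ℂ) :
    starRingEnd ℂ (α ⟨conjC (h : ℂ ⊗[ℝ] L), conjC_mem_baseChange h.2⟩) = -α h := by
  obtain ⟨x, hx, hx0⟩ := exists_ne_zero_of_mem_roots hα
  have h1 := mem_rootSpace_iff.1 hx h
  have h2 := mem_rootSpace_iff.1 hx ⟨conjC (h : ℂ ⊗[ℝ] L), conjC_mem_baseChange h.2⟩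
  have h3 := congrArg conjC h2
  rw [conjC_lie, conjC_conjC, conjC_smul] at h3
  have h4 := baseChange_form_lie d.invariant (h : ℂ ⊗[ℝ] L) x (conjC x)
  rw [h1, h3, map_smul, map_smul, LinearMap.smul_apply, smul_eq_mul, smul_eq_mul,
    ← neg_mul] at h4
  rw [mul_right_cancel₀ (d.baseChange_form_conjC_ne_zero hx0) h4, neg_neg]

theorem conjC_mem_rootSpace (d : InvolutionTorusData B θ s t₁ t)
    {α : Module.Dual ℂ (t.baseChange ℂ)} (hα : α ∈ roots (t.baseChange ℂ)) {x : ℂ ⊗[ℝ] L}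
    (hx : x ∈ rootSpace (t.baseChange ℂ) α) : conjC x ∈ rootSpace (t.baseChange ℂ) (-α) := by
  rw [mem_rootSpace_iff]
  intro h
  have h3 := congrArg conjC
    (mem_rootSpace_iff.1 hx ⟨conjC (h : ℂ ⊗[ℝ] L), conjC_mem_baseChange h.2⟩)
  rw [conjC_lie, conjC_conjC, conjC_smul, d.apply_conjC hα] at h3
  exact h3

theorem neg_mem_roots (d : InvolutionTorusData B θ s t₁ t) {α : Module.Dual ℂ (t.baseChange ℂ)}
    (hα : α ∈ roots (t.baseChange ℂ)) : -α ∈ roots (t.baseChange ℂ) := by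
  obtain ⟨x, hx, hx0⟩ := exists_ne_zero_of_mem_roots hα
  refine mem_roots_of_mem_rootSpace (neg_ne_zero.2 hα.1) (d.conjC_mem_rootSpace hα hx) fun h => ?_
  exact hx0 (by rw [← conjC_conjC x, h, map_zero])

theorem neg_mem_rootsVanishingOn (d : InvolutionTorusData B θ s t₁ t)
    {α : Module.Dual ℂ (t.baseChange ℂ)}
    (hα : α ∈ rootsVanishingOn (t.baseChange ℂ) (s.baseChange ℂ)) :
    -α ∈ rootsVanishingOn (t.baseChange ℂ) (s.baseChange ℂ) :=
  ⟨d.neg_mem_roots hα.1, fun h hs => by rw [LinearMap.neg_apply, hα.2 h hs, neg_zero]⟩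

theorem eq_of_forall_form_eq (d : InvolutionTorusData B θ s t₁ t) {v w : t.baseChange ℂ}
    (h : ∀ x : t.baseChange ℂ, B.baseChange ℂ (v : ℂ ⊗[ℝ] L) x = B.baseChange ℂ (w : ℂ ⊗[ℝ] L) x) :
    v = w := by
  have h1 : B.baseChange ℂ ((v : ℂ ⊗[ℝ] L) - w) (conjC ((v : ℂ ⊗[ℝ] L) - w)) = 0 := by
    have := h ⟨_, conjC_mem_baseChange (t.baseChange ℂ |>.sub_mem v.2 w.2)⟩
    rw [map_sub (B.baseChange ℂ), LinearMap.sub_apply]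
    exact sub_eq_zero.2 this
  exact Subtype.ext (sub_eq_zero.1 (eq_zero_of_baseChange_conjC B d.symm d.neg h1))

theorem existsUnique_isDualVector [FiniteDimensional ℝ L] (d : InvolutionTorusData B θ s t₁ t)
    (α : Module.Dual ℂ (t.baseChange ℂ)) :
    ∃! v, IsDualVector (t.baseChange ℂ) (B.baseChange ℂ) α v := by
  let D : t.baseChange ℂ →ₗ[ℂ] Module.Dual ℂ (t.baseChange ℂ) :=
    (B.baseChange ℂ).compl₁₂ (t.baseChange ℂ).subtype (t.baseChange ℂ).subtype
  have hD : ∀ v h, D v h = B.baseChange ℂ (v : ℂ ⊗[ℝ] L) h := fun v h => rfl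
  have hinj : Function.Injective D := fun v w hvw => d.eq_of_forall_form_eq fun x => by
    rw [← hD, ← hD, hvw]
  have hsurj : Function.Surjective D :=
    (LinearMap.injective_iff_surjective_of_finrank_eq_finrank
      Subspace.dual_finrank_eq.symm).1 hinj
  obtain ⟨v, hv⟩ := hsurj α
  refine ⟨v, fun h => by rw [← hD, hv], fun w hw => hinj ?_⟩
  rw [hv]
  exact LinearMap.ext hw

/-- The dual vector of a root is purely imaginary, so the form is definite on it. -/
theorem apply_dualVector_ne_zero (d : InvolutionTorusData B θ s t₁ t)
    {α : Module.Dual ℂ (t.baseChange ℂ)} (hα : α ∈ roots (t.baseChange ℂ)) {v : t.baseChange ℂ}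
    (hv : IsDualVector (t.baseChange ℂ) (B.baseChange ℂ) α v) : α v ≠ 0 := by
  have hconj : (⟨conjC (v : ℂ ⊗[ℝ] L), conjC_mem_baseChange v.2⟩ : t.baseChange ℂ) = -v := by
    refine d.eq_of_forall_form_eq fun x => ?_
    have h1 := baseChange_conjC_conjC B (v : ℂ ⊗[ℝ] L) (conjC (x : ℂ ⊗[ℝ] L))
    rw [conjC_conjC, hv ⟨conjC (x : ℂ ⊗[ℝ] L), conjC_mem_baseChange x.2⟩, d.apply_conjC hα] at h1
    refine h1.trans ?_
    rw [Submodule.coe_neg, map_neg, LinearMap.neg_apply, hv]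
  have hconj' : conjC (v : ℂ ⊗[ℝ] L) = -(v : ℂ ⊗[ℝ] L) := congrArg Subtype.val hconj
  intro h0
  rw [← hv] at h0
  refine hα.1 (LinearMap.ext fun h => ?_)
  have hv0 : (v : ℂ ⊗[ℝ] L) = 0 := by
    by_contra hne
    refine d.baseChange_form_conjC_ne_zero hne ?_
    rw [hconj', map_neg, h0, neg_zero]
  rw [← hv, hv0]
  simp

/-- For `y ∈ 𝔤_β` the bracket `[y, ȳ]` is a nonzero multiple of `H_β`, and it commutes with `𝔤_γ`
because `y` and `ȳ` do. -/
theorem apply_dualVector_eq_zero (d : InvolutionTorusData B θ s t₁ t)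
    {γ β : Module.Dual ℂ (t.baseChange ℂ)}
    (hγ : γ ∈ rootsVanishingOn (t.baseChange ℂ) (s.baseChange ℂ))
    (hβ : β ∈ rootsVanishingOn (t.baseChange ℂ) (s.baseChange ℂ)) (h1 : γ ≠ β) (h2 : γ ≠ -β)
    {v : t.baseChange ℂ} (hv : IsDualVector (t.baseChange ℂ) (B.baseChange ℂ) β v) : γ v = 0 := by
  obtain ⟨y, hy, hy0⟩ := exists_ne_zero_of_mem_roots hβ.1
  obtain ⟨z, hz, hz0⟩ := exists_ne_zero_of_mem_roots hγ.1
  have hy' := d.conjC_mem_rootSpace hβ.1 hy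
  have hw : ⁅y, conjC y⁆ ∈ rootSpace (t.baseChange ℂ) (β + -β) := lie_mem_rootSpace_add hy hy'
  rw [add_neg_cancel] at hw
  have hwt : ⁅y, conjC y⁆ ∈ t.baseChange ℂ := d.mem_baseChange_t fun Y hY => by
    have h3 := mem_rootSpace_iff.1 hw ⟨_, d.one_tmul_mem hY⟩
    rw [LinearMap.zero_apply, zero_smul] at h3
    exact h3
  have hwv : (⟨_, hwt⟩ : t.baseChange ℂ) = B.baseChange ℂ y (conjC y) • v := by
    refine d.eq_of_forall_form_eq fun h => ?_
    have h3 : B.baseChange ℂ ⁅y, conjC y⁆ (h : ℂ ⊗[ℝ] L) =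
        B.baseChange ℂ (conjC y) ⁅(h : ℂ ⊗[ℝ] L), y⁆ := by
      rw [baseChange_form_lie d.invariant, ← tensor_lie_skew (h : ℂ ⊗[ℝ] L) y, map_neg]
    rw [mem_rootSpace_iff.1 hy h, map_smul, baseChange_comm B d.symm (conjC y)] at h3
    refine h3.trans ?_
    rw [Submodule.coe_smul, map_smul, LinearMap.smul_apply, hv, smul_eq_mul, smul_eq_mul, mul_comm]
  have h5 : ⁅y, z⁆ = 0 := d.lie_rootSpace_eq_zero hβ hγ
    (fun h => h2 (eq_neg_of_add_eq_zero_right h)) hy hz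
  have h6 : ⁅conjC y, z⁆ = 0 := d.lie_rootSpace_eq_zero (d.neg_mem_rootsVanishingOn hβ) hγ
    (fun h => h1 (neg_add_eq_zero.1 h).symm) hy' hz
  have h7 := mem_rootSpace_iff.1 hz ⟨_, hwt⟩
  rw [tensor_lie_lie, h5, h6, tensor_lie_zero, tensor_lie_zero, sub_zero, hwv, map_smul,
    smul_eq_mul] at h7
  exact (mul_eq_zero.1 ((smul_eq_zero.1 h7.symm).resolve_right hz0)).resolve_left
    (d.baseChange_form_conjC_ne_zero hy0)

/-- If `γ = α + β` were a root, it would lie in `Ω` and differ from `±α`, so `γ(H_α)` would vanish;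
but `γ(H_α)` is `α(H_α)` for `β ≠ α` and `2 α(H_α)` for `β = α`. -/
theorem add_not_mem_roots [FiniteDimensional ℝ L] (d : InvolutionTorusData B θ s t₁ t)
    {α β : Module.Dual ℂ (t.baseChange ℂ)}
    (hα : α ∈ rootsVanishingOn (t.baseChange ℂ) (s.baseChange ℂ))
    (hβ : β ∈ rootsVanishingOn (t.baseChange ℂ) (s.baseChange ℂ)) :
    α + β ∉ roots (t.baseChange ℂ) := by
  intro hr
  have hγ := add_mem_rootsVanishingOn hα hβ hr
  obtain ⟨v, hv, -⟩ := d.existsUnique_isDualVector α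
  obtain ⟨w, hw, -⟩ := d.existsUnique_isDualVector β
  have hαv := d.apply_dualVector_ne_zero hα.1 hv
  have hαβ : α ≠ -β := fun h => hr.1 (by rw [h, neg_add_cancel])
  have hγα : α + β ≠ α := fun h => hβ.1.1 (add_eq_left.1 h)
  rcases eq_or_ne β α with rfl | hne
  · have h2 : β + β ≠ -β := fun h => by
      have h3 := congrArg (fun f : Module.Dual ℂ (t.baseChange ℂ) => f v) h
      simp only [LinearMap.add_apply, LinearMap.neg_apply] at h3
      exact hαv (by linear_combination h3 / 3)
    have h4 := d.apply_dualVector_eq_zero hγ hβ hγα h2 hv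
    rw [LinearMap.add_apply] at h4
    exact hαv (by linear_combination h4 / 2)
  · have hβv : β v = 0 := d.apply_dualVector_eq_zero hβ hα hne
      (fun h => hαβ (by rw [h, neg_neg])) hv
    have h2 : α + β ≠ -α := fun h => by
      have h3 := congrArg (fun f : Module.Dual ℂ (t.baseChange ℂ) => f v) h
      simp only [LinearMap.add_apply, LinearMap.neg_apply, hβv] at h3
      exact hαv (by linear_combination h3 / 2)
    have h4 := d.apply_dualVector_eq_zero hγ hα hγα h2 hv
    rw [LinearMap.add_apply, hβv, add_zero] at h4
    exact hαv h4

theorem stronglyOrthogonal [FiniteDimensional ℝ L] (d : InvolutionTorusData B θ s t₁ t)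
    {α β : Module.Dual ℂ (t.baseChange ℂ)}
    (hα : α ∈ rootsVanishingOn (t.baseChange ℂ) (s.baseChange ℂ))
    (hβ : β ∈ rootsVanishingOn (t.baseChange ℂ) (s.baseChange ℂ)) :
    StronglyOrthogonal (t.baseChange ℂ) α β :=
  ⟨d.add_not_mem_roots hα hβ, by
    rw [sub_eq_add_neg]
    exact d.add_not_mem_roots hα (d.neg_mem_rootsVanishingOn hβ)⟩

end InvolutionTorusData

end CoreAlgebra

/-! ### Orthogonal decomposition of the Cartan subalgebra -/

section Decomposition

variable {V : Type*} [LieRing V] [LieAlgebra ℂ V]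

/-- Functionals and vectors with `α (H β) = 0` for `α ≠ β` and `α (H α) ≠ 0` split the space into
the common kernel of the functionals and the lines through the vectors. -/
theorem isInternal_kernelAndLines {t : Submodule ℂ V} [FiniteDimensional ℂ t]
    {P : Set (Module.Dual ℂ t)} [DecidableEq (Option P)] {H : P → t}
    (hne : ∀ α : P, (α : Module.Dual ℂ t) (H α) ≠ 0)
    (horth : ∀ α β : P, α ≠ β → (α : Module.Dual ℂ t) (H β) = 0) :
    DirectSum.IsInternal (kernelAndLines t P H) := by
  have happ : ∀ (F : Finset P) (c : P → ℂ) (α : P), α ∈ F →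
      (α : Module.Dual ℂ t) (∑ β ∈ F, c β • H β) = c α * (α : Module.Dual ℂ t) (H α) := by
    intro F c α hα
    rw [map_sum, Finset.sum_eq_single_of_mem α hα fun β _ hβ => by
      rw [map_smul, horth α β hβ.symm, smul_zero], map_smul, smul_eq_mul]
  have hli : LinearIndependent ℂ H := by
    rw [linearIndependent_iff']
    intro F c hc α hα
    have h1 := happ F c α hα
    rw [hc, map_zero] at h1
    exact (mul_eq_zero.1 h1.symm).resolve_right (hne α)
  have : Finite P := hli.finite
  have : Fintype P := Fintype.ofFinite P
  rw [DirectSum.isInternal_submodule_iff_iSupIndep_and_iSup_eq_top]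
  refine ⟨?_, ?_⟩
  · intro i
    rw [Submodule.disjoint_def]
    rintro x hx hx'
    cases i with
    | none =>
      have hle : ⨆ j, ⨆ (_ : j ≠ none), kernelAndLines t P H j ≤
          Submodule.span ℂ (Set.range H) := by
        refine iSup₂_le fun j hj => ?_
        cases j with
        | none => exact absurd rfl hj
        | some β => exact Submodule.span_mono (Set.singleton_subset_iff.2 ⟨β, rfl⟩)
      obtain ⟨c, rfl⟩ := (Submodule.mem_span_range_iff_exists_fun ℂ).1 (hle hx')
      refine Finset.sum_eq_zero fun β _ => ?_
      have h1 : (β : Module.Dual ℂ t) (∑ i, c i • H i) = 0 := by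
        have h2 : _ ∈ ⨅ α ∈ P, LinearMap.ker α := hx
        simp only [Submodule.mem_iInf] at h2
        exact h2 β β.2
      rw [happ _ _ _ (Finset.mem_univ β)] at h1
      rw [(mul_eq_zero.1 h1).resolve_right (hne β), zero_smul]
    | some α =>
      have hle : ⨆ j, ⨆ (_ : j ≠ some α), kernelAndLines t P H j ≤
          LinearMap.ker (α : Module.Dual ℂ t) := by
        refine iSup₂_le fun j hj => ?_
        cases j with
        | none => exact iInf₂_le (α : Module.Dual ℂ t) α.2
        | some β =>
          refine (Submodule.span_singleton_le_iff_mem _ _).2 (horth α β ?_)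
          rintro rfl
          exact hj rfl
      obtain ⟨c, rfl⟩ := Submodule.mem_span_singleton.1 hx
      have h1 : (α : Module.Dual ℂ t) (c • H α) = 0 := hle hx'
      rw [map_smul, smul_eq_mul] at h1
      rw [(mul_eq_zero.1 h1).resolve_right (hne α), zero_smul]
  · rw [eq_top_iff]
    intro h _
    set v : t := ∑ β : P, ((β : Module.Dual ℂ t) h / (β : Module.Dual ℂ t) (H β)) • H β with hv
    have hmem : h - v ∈ kernelAndLines t P H none := by
      have : h - v ∈ ⨅ α ∈ P, LinearMap.ker α := by
        simp only [Submodule.mem_iInf]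
        intro α hα
        rw [LinearMap.mem_ker, map_sub, hv]
        have h1 := happ Finset.univ (fun β => (β : Module.Dual ℂ t) h / (β : Module.Dual ℂ t) (H β))
          ⟨α, hα⟩ (Finset.mem_univ _)
        rw [div_mul_cancel₀ _ (hne ⟨α, hα⟩)] at h1
        exact sub_eq_zero.2 h1.symm
      exact this
    rw [← sub_add_cancel h v]
    refine Submodule.add_mem _ (Submodule.mem_iSup_of_mem none hmem) ?_
    exact Submodule.sum_mem _ fun β _ => Submodule.mem_iSup_of_mem (some β)
      (Submodule.smul_mem _ _ (Submodule.mem_span_singleton_self (H β)))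

end Decomposition

/-! ### Commutativity of the centralizers -/

section Centralizers

variable {L : Type*} [LieRing L] [LieAlgebra ℝ L] [FiniteDimensional ℝ L]
  {B : LinearMap.BilinForm ℝ L}

theorem lie_eq_zero_of_fixed_central_subalgebra (hsymm : ∀ X Y : L, B X Y = B Y X)
    (hneg : ∀ X, X ≠ 0 → B X X < 0) (hinv : ∀ X Y Z : L, B ⁅X, Y⁆ Z = -B Y ⁅X, Z⁆)
    {θ : L →ₗ[ℝ] L} (hθ : ∀ X Y : L, θ ⁅X, Y⁆ = ⁅θ X, θ Y⁆) {n : ℕ} (hn : 0 < n)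
    (hθn : ∀ X, θ^[n] X = X) (V : LieSubalgebra ℝ L) (hV : ∀ X ∈ V, θ X ∈ V)
    (hfix : ∀ X ∈ V, θ X = X → ∀ Y ∈ V, ⁅X, Y⁆ = 0) {X Y : L} (hX : X ∈ V) (hY : Y ∈ V) :
    ⁅X, Y⁆ = 0 := by
  let θV : V →ₗ[ℝ] V := LinearMap.restrict θ (p := V.toSubmodule) (q := V.toSubmodule) hV
  let BV : LinearMap.BilinForm ℝ V := B.compl₁₂ V.toSubmodule.subtype V.toSubmodule.subtype
  have hiter : ∀ (k : ℕ) (Z : V), ((θV^[k] Z : V) : L) = θ^[k] (Z : L) := by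
    intro k
    induction k with
    | zero => exact fun Z => rfl
    | succ k ih => exact fun Z => ih (θV Z)
  have h := lie_eq_zero_of_fixed_central (L := V) (B := BV) (θ := θV) (n := n)
    (fun X Y => hsymm X Y) (fun X hX => hneg X fun h => hX (Subtype.ext h))
    (fun X Y Z => hinv X Y Z) (fun X Y => Subtype.ext (hθ X Y)) hn
    (fun X => Subtype.ext ((hiter n X).trans (hθn X)))
    (fun X hX Y => Subtype.ext (hfix X X.2 (congrArg Subtype.val hX) Y Y.2)) ⟨X, hX⟩ ⟨Y, hY⟩
  exact congrArg Subtype.val h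

/-- If `s` is maximal among the commuting fixed vectors of the two automorphisms `θ₁`, `θ₂`, then
the centralizer `t₁` of `s` in the fixed algebra of `θ₁` is abelian, since the fixed points of `θ₂`
in it lie in `s`; and the centralizer `t` of `t₁` is abelian, since the fixed points of `θ₁` in it
lie in `t₁`. -/
theorem InvolutionTorusData.of_maximal {θ₁ θ₂ : L →ₗ[ℝ] L} {s t₁ t : Submodule ℝ L}
    (hsymm : ∀ X Y : L, B X Y = B Y X)
    (hneg : ∀ X, X ≠ 0 → B X X < 0) (hinv : ∀ X Y Z : L, B ⁅X, Y⁆ Z = -B Y ⁅X, Z⁆)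
    (hθ₁ : ∀ X Y : L, θ₁ ⁅X, Y⁆ = ⁅θ₁ X, θ₁ Y⁆) (hθ₂ : ∀ X Y : L, θ₂ ⁅X, Y⁆ = ⁅θ₂ X, θ₂ Y⁆)
    (hinvol : ∀ X, θ₁ (θ₁ X) = X) {n : ℕ} (hn : 0 < n) (hθn : ∀ X, θ₂^[n] X = X)
    (hcomm : ∀ X, θ₁ (θ₂ X) = θ₂ (θ₁ X)) (hs₁ : ∀ X ∈ s, θ₁ X = X) (hs₂ : ∀ X ∈ s, θ₂ X = X)
    (hs : ∀ X ∈ s, ∀ Y ∈ s, ⁅X, Y⁆ = 0)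
    (hmax : ∀ X, θ₁ X = X → θ₂ X = X → (∀ Y ∈ s, ⁅Y, X⁆ = 0) → X ∈ s)
    (ht₁ : ∀ X : L, X ∈ t₁ ↔ θ₁ X = X ∧ ∀ Y ∈ s, ⁅Y, X⁆ = 0)
    (ht : ∀ X : L, X ∈ t ↔ ∀ Y ∈ t₁, ⁅Y, X⁆ = 0) : InvolutionTorusData B θ₁ s t₁ t := by
  have hlie : ∀ X Y Z : L, ⁅Z, X⁆ = 0 → ⁅Z, Y⁆ = 0 → ⁅Z, ⁅X, Y⁆⁆ = 0 := fun X Y Z h1 h2 => by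
    rw [leibniz_lie, h1, h2, zero_lie, lie_zero, add_zero]
  have hs_le : s ≤ t₁ := fun X hX => (ht₁ X).2 ⟨hs₁ X hX, fun Y hY => hs Y hY X hX⟩
  have hab₁ : ∀ X ∈ t₁, ∀ Y ∈ t₁, ⁅X, Y⁆ = 0 := by
    intro X hX Y hY
    refine lie_eq_zero_of_fixed_central_subalgebra hsymm hneg hinv hθ₂ hn hθn
      { t₁ with lie_mem' := ?_ } ?_ ?_ hX hY
    · intro X Y hX hY
      have hX' := (ht₁ X).1 hX
      have hY' := (ht₁ Y).1 hY
      exact (ht₁ _).2 ⟨by rw [hθ₁, hX'.1, hY'.1],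
        fun Z hZ => hlie X Y Z (hX'.2 Z hZ) (hY'.2 Z hZ)⟩
    · intro X hX
      have hX' := (ht₁ X).1 hX
      refine (ht₁ _).2 ⟨by rw [hcomm, hX'.1], fun Z hZ => ?_⟩
      rw [← hs₂ Z hZ, ← hθ₂, hX'.2 Z hZ, map_zero]
    · intro X hX hX2 Y hY
      have hX' := (ht₁ X).1 hX
      exact ((ht₁ Y).1 hY).2 X (hmax X hX'.1 hX2 hX'.2)
  have ht₁_le : t₁ ≤ t := fun X hX => (ht X).2 fun Y hY => hab₁ Y hY X hX
  refine ⟨hsymm, hneg, hinv, hθ₁, hinvol, hs_le, ht₁_le, ht₁, ht, fun X hX Y hY => ?_⟩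
  refine lie_eq_zero_of_fixed_central_subalgebra hsymm hneg hinv hθ₁ two_pos hinvol
    { t with lie_mem' := ?_ } ?_ ?_ hX hY
  · exact fun {X Y} hX hY => (ht _).2 fun Z hZ => hlie X Y Z ((ht X).1 hX Z hZ) ((ht Y).1 hY Z hZ)
  · intro X hX
    refine (ht _).2 fun Z hZ => ?_
    rw [← ((ht₁ Z).1 hZ).1, ← hθ₁, (ht X).1 hX Z hZ, map_zero]
  · intro X hX hX1 Y hY
    exact (ht Y).1 hY X ((ht₁ X).2 ⟨hX1, fun Z hZ => (ht X).1 hX Z (hs_le hZ)⟩)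

end Centralizers

section Assembly

open Filter Topology Set

/-! ### Identity components, fixed points and centralizers -/

section IdentityComponent

set_option linter.unusedSectionVars false

variable {G : Type*} [TopologicalSpace G] [Group G] [IsTopologicalGroup G]

theorem identityComponent_le (H : Subgroup G) : identityComponent H ≤ H := by
  rintro _ ⟨x, -, rfl⟩
  exact x.2

theorem isClosed_identityComponent {H : Subgroup G} (hH : IsClosed (H : Set G)) :
    IsClosed (identityComponent H : Set G) :=
  hH.isClosedEmbedding_subtypeVal.isClosedMap _ isClosed_connectedComponent

theorem isPreconnected_identityComponent (H : Subgroup G) :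
    IsPreconnected (identityComponent H : Set G) :=
  isPreconnected_connectedComponent.image _ continuous_subtype_val.continuousOn

theorem subset_identityComponent {H : Subgroup G} {C : Set G} (hC : IsPreconnected C)
    (h1 : (1 : G) ∈ C) (hCH : C ⊆ H) : C ⊆ identityComponent H := by
  have hpre : IsPreconnected (Subtype.val ⁻¹' C : Set H) := by
    refine (IsInducing.subtypeVal (t := (H : Set G))).isPreconnected_image.1 ?_
    have himage : Subtype.val '' (Subtype.val ⁻¹' C : Set (H : Set G)) = C := by
      rw [Subtype.image_preimage_coe, inter_eq_right.2 hCH]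
    exact himage.symm ▸ hC
  intro x hx
  exact ⟨⟨x, hCH hx⟩, hpre.subset_connectedComponent (x := (1 : H)) h1 hx, rfl⟩

theorem identityComponent_mono {H K : Subgroup G} (h : H ≤ K) :
    identityComponent H ≤ identityComponent K :=
  subset_identityComponent (isPreconnected_identityComponent H) (Subgroup.one_mem _)
    ((identityComponent_le H).trans h)

theorem isClosed_fixedSubgroup [T2Space G] {σ : MulAut G} (hσ : Continuous σ) :
    IsClosed (fixedSubgroup σ : Set G) :=
  isClosed_eq hσ continuous_id

theorem isClosed_centralizer [T2Space G] (H : Subgroup G) :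
    IsClosed (Subgroup.centralizer (H : Set G) : Set G) :=
  Set.isClosed_centralizer _

end IdentityComponent

section SubgroupLieAlgebras

set_option linter.unusedSectionVars false

variable {E : Type*} [NormedAddCommGroup E] [NormedSpace ℝ E] [FiniteDimensional ℝ E]
  {G : Type*} [TopologicalSpace G] [ChartedSpace E G] [Group G] [LieGroup 𝓘(ℝ, E) ∞ G] [T2Space G]
  [IsTopologicalGroup G]

theorem oneParam_mem_identityComponent {H : Subgroup G} {X : E} (h : ∀ t, oneParam E G X t ∈ H)
    (t : ℝ) : oneParam E G X t ∈ identityComponent H :=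
  subset_identityComponent (isPreconnected_range (continuous_oneParam E X))
    ⟨0, oneParam_zero E X⟩ (by rintro _ ⟨t, rfl⟩; exact h t) ⟨t, rfl⟩

theorem oneParam_mem_fixedSubgroup_iff {σ : MulAut G} (hσ : ContMDiff 𝓘(ℝ, E) 𝓘(ℝ, E) ∞ σ) {X : E} :
    (∀ t, oneParam E G X t ∈ fixedSubgroup σ) ↔ diffOne E σ X = X := by
  refine ⟨fun h => oneParam_injective E (G := G) fun t => ?_, fun h t => ?_⟩
  · rw [← map_oneParam E hσ]
    exact h t
  · change σ (oneParam E G X t) = oneParam E G X t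
    rw [map_oneParam E hσ, h]

theorem iterate_diffOne {σ : MulAut G} (hσ : ContMDiff 𝓘(ℝ, E) 𝓘(ℝ, E) ∞ σ) {n : ℕ}
    (hn : σ ^ n = 1) (X : E) : (diffOne E σ)^[n] X = X := by
  have h : ∀ (k : ℕ) (t : ℝ), (σ ^ k) (oneParam E G X t) =
      oneParam E G ((diffOne E σ)^[k] X) t := by
    intro k t
    induction k with
    | zero => rfl
    | succ k ih =>
      rw [pow_succ', MulAut.mul_apply, ih, map_oneParam E hσ, Function.iterate_succ_apply']
  refine oneParam_injective E (G := G) fun t => ?_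
  rw [← h, hn, MulAut.one_apply]

variable [CompactSpace G] {B : E →ₗ[ℝ] E →ₗ[ℝ] ℝ}

theorem commute_oneParam_of_bracketE_eq_zero (hB : IsInvariantForm G B) {S : Subgroup G}
    (hS : IsClosed (S : Set G)) (hSc : IsPreconnected (S : Set G)) {X : E}
    (hX : ∀ Y ∈ subLie E S, bracketE E G Y X = 0) {a : G} (ha : a ∈ S) (t : ℝ) :
    a * oneParam E G X t = oneParam E G X t * a := by
  obtain ⟨Y, hY, rfl⟩ := exists_lieExp_eq hB hS hSc ha
  exact commute_oneParam E (hX Y hY) 1 t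

/-- If `exp (ℝ X)` runs in `K` and centralizes the maximal torus `S` of `K`, then the closure of
`S exp (ℝ X)` is a torus in `K`, so that `X` is tangent to `S`. -/
theorem mem_subLie_of_isMaximalTorusOf (hB : IsInvariantForm G B) {S K : Subgroup G}
    (hK : IsClosed (K : Set G)) (hS : IsMaximalTorusOf S K) {X : E}
    (hXK : ∀ t, oneParam E G X t ∈ K) (hX : ∀ Y ∈ subLie E S, bracketE E G Y X = 0) :
    X ∈ subLie E S := by
  obtain ⟨⟨hT, hSK⟩, hmax⟩ := hS
  have hcomm : ∀ a ∈ S, ∀ t, a * oneParam E G X t = oneParam E G X t * a := fun a ha t =>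
    commute_oneParam_of_bracketE_eq_zero hB hT.isCompact.isClosed hT.isConnected.isPreconnected
      hX ha t
  let A : Subgroup G :=
    { carrier := (fun p : G × ℝ => p.1 * oneParam E G X p.2) '' ((S : Set G) ×ˢ univ)
      one_mem' := ⟨(1, 0), ⟨S.one_mem, mem_univ _⟩, by simp [oneParam_zero]⟩
      mul_mem' := by
        rintro _ _ ⟨⟨a, t⟩, ⟨ha, -⟩, rfl⟩ ⟨⟨b, u⟩, ⟨hb, -⟩, rfl⟩
        refine ⟨(a * b, t + u), ⟨S.mul_mem ha hb, mem_univ _⟩, ?_⟩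
        simp only [oneParam_add]
        rw [mul_assoc, mul_assoc, ← mul_assoc b, hcomm b hb t, mul_assoc]
      inv_mem' := by
        rintro _ ⟨⟨a, t⟩, ⟨ha, -⟩, rfl⟩
        refine ⟨(a⁻¹, -t), ⟨S.inv_mem ha, mem_univ _⟩, ?_⟩
        have h1 : oneParam E G X (-t) = (oneParam E G X t)⁻¹ := by
          refine eq_inv_of_mul_eq_one_left ?_
          rw [← oneParam_add, neg_add_cancel, oneParam_zero]
        simp only
        rw [hcomm _ (S.inv_mem ha), h1, mul_inv_rev] }
  have hSA : S ≤ A := fun a ha => ⟨(a, 0), ⟨ha, mem_univ _⟩, by simp [oneParam_zero]⟩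
  have hXA : ∀ t, oneParam E G X t ∈ A := fun t =>
    ⟨(1, t), ⟨S.one_mem, mem_univ _⟩, one_mul _⟩
  have hAK : A ≤ K := by
    rintro _ ⟨⟨a, t⟩, ⟨ha, -⟩, rfl⟩
    exact K.mul_mem (hSK ha) (hXK t)
  have hAcomm : ∀ x ∈ A, ∀ y ∈ A, x * y = y * x := by
    rintro _ ⟨⟨a, t⟩, ⟨ha, -⟩, rfl⟩ _ ⟨⟨b, u⟩, ⟨hb, -⟩, rfl⟩
    have h1 : oneParam E G X t * oneParam E G X u = oneParam E G X u * oneParam E G X t := by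
      rw [← oneParam_add, ← oneParam_add, add_comm]
    have h2 : Commute (a * oneParam E G X t) (b * oneParam E G X u) :=
      Commute.mul_left (Commute.mul_right (hT.comm a ha b hb) (hcomm a ha u))
        (Commute.mul_right (hcomm b hb t).symm h1)
    exact h2
  have hAconn : IsPreconnected (A : Set G) := by
    refine (hT.isConnected.isPreconnected.prod isPreconnected_univ).image _ ?_
    exact (continuous_fst.mul ((continuous_oneParam E X).comp continuous_snd)).continuousOn
  have hclosed : IsClosed (A.topologicalClosure : Set G) := A.isClosed_topologicalClosure
  have hcent : ∀ (D : Set G), A ≤ Subgroup.centralizer D →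
      A.topologicalClosure ≤ Subgroup.centralizer D := fun D h =>
    A.topologicalClosure_minimal h (Set.isClosed_centralizer D)
  have h1 : A.topologicalClosure ≤ Subgroup.centralizer (A : Set G) :=
    hcent _ fun x hx => Subgroup.mem_centralizer_iff.2 fun y hy => hAcomm y hy x hx
  have h2 : A.topologicalClosure ≤ Subgroup.centralizer (A.topologicalClosure : Set G) :=
    hcent _ fun x hx => Subgroup.mem_centralizer_iff.2 fun y hy =>
      (Subgroup.mem_centralizer_iff.1 (h1 hy) x hx).symm
  have htorus : IsTorus A.topologicalClosure :=
    ⟨hclosed.isCompact, ⟨⟨1, Subgroup.one_mem _⟩, hAconn.closure⟩, fun x hx y hy =>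
      Subgroup.mem_centralizer_iff.1 (h2 hy) x hx⟩
  have hle := hmax ⟨htorus, A.topologicalClosure_minimal hAK hK⟩
    (hSA.trans A.le_topologicalClosure)
  exact mem_subLie_of_oneParam_mem fun t => hle (A.le_topologicalClosure (hXA t))

theorem mem_subLie_centralizerIn_iff (hB : IsInvariantForm G B) {σ : MulAut G}
    (hσ : ContMDiff 𝓘(ℝ, E) 𝓘(ℝ, E) ∞ σ) {S : Subgroup G} (hS : IsTorus S) {X : E} :
    X ∈ subLie E (centralizerIn (identityComponent (fixedSubgroup σ)) S) ↔
      diffOne E σ X = X ∧ ∀ Y ∈ subLie E S, bracketE E G Y X = 0 := by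
  have hScl := hS.isCompact.isClosed
  rw [mem_subLie_iff ((isClosed_identityComponent (isClosed_fixedSubgroup hσ.continuous)).inter
    (isClosed_centralizer S)), ← oneParam_mem_fixedSubgroup_iff hσ]
  refine ⟨fun h => ⟨fun t => identityComponent_le _ (h t).1, fun Y hY => ?_⟩, fun h t =>
    ⟨oneParam_mem_identityComponent h.1 t, Subgroup.mem_centralizer_iff.2 fun a ha => ?_⟩⟩
  · exact bracketE_eq_zero_of_commute E fun a b =>
      Subgroup.mem_centralizer_iff.1 (h b).2 _ ((mem_subLie_iff hScl).1 hY a)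
  · exact commute_oneParam_of_bracketE_eq_zero hB hScl hS.isConnected.isPreconnected h.2 ha t

/-- The Lie algebra of the centralizer of `T₁ = Z_{K₁}(S)` is the centralizer of the Lie algebra of
`T₁`, because `T₁` lies in the image of the exponential map of its Lie algebra. -/
theorem mem_subLie_centralizer_iff (hB : IsInvariantForm G B) {σ : MulAut G}
    (hσ : ContMDiff 𝓘(ℝ, E) 𝓘(ℝ, E) ∞ σ) {S T₁ : Subgroup G} (hS : IsTorus S)
    (hSK : S ≤ identityComponent (fixedSubgroup σ))
    (hT₁ : T₁ = centralizerIn (identityComponent (fixedSubgroup σ)) S) {X : E} :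
    X ∈ subLie E (Subgroup.centralizer (T₁ : Set G)) ↔
      ∀ Y ∈ subLie E T₁, bracketE E G Y X = 0 := by
  have hK := isClosed_identityComponent (isClosed_fixedSubgroup hσ.continuous)
  have hT₁cl : IsClosed (T₁ : Set G) := by
    rw [hT₁]
    exact hK.inter (isClosed_centralizer S)
  rw [mem_subLie_iff (isClosed_centralizer T₁)]
  refine ⟨fun h Y hY => bracketE_eq_zero_of_commute E fun a b =>
    Subgroup.mem_centralizer_iff.1 (h b) _ ((mem_subLie_iff hT₁cl).1 hY a),
    fun h t => Subgroup.mem_centralizer_iff.2 fun a ha => ?_⟩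
  have ha' : a ∈ centralizerIn (identityComponent (fixedSubgroup σ)) S := hT₁ ▸ ha
  obtain ⟨Y, hYK, rfl, hY⟩ := exists_lieExp_eq_of_centralizes hB hK
    (isPreconnected_identityComponent _) hS.isCompact.isClosed hSK hS.comm ha'.1
    (Subgroup.mem_centralizer_iff.1 ha'.2)
  refine commute_oneParam E (h Y ?_) 1 t
  rw [hT₁, mem_subLie_centralizerIn_iff hB hσ hS, ← oneParam_mem_fixedSubgroup_iff hσ]
  exact ⟨fun t => identityComponent_le _ ((mem_subLie_iff hK).1 hYK t), hY⟩

instance instFiniteDimensionalRealLieAlg : FiniteDimensional ℝ (RealLieAlg E G) :=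
  inferInstanceAs (FiniteDimensional ℝ E)

/-- The Lie algebras of `S`, `T₁ = Z_{K₁}(S)` and `T = Z_G(T₁)` fit the algebraic setting. -/
theorem involutionTorusData (σ₁ σ₂ : MulAut G)
    (hσ₁ : ContMDiff 𝓘(ℝ, E) 𝓘(ℝ, E) ∞ σ₁) (hσ₂ : ContMDiff 𝓘(ℝ, E) 𝓘(ℝ, E) ∞ σ₂)
    (hinv : σ₁ ^ 2 = 1) (hfin : IsOfFinOrder σ₂) (hcomm : Commute σ₁ σ₂) {S T₁ : Subgroup G}
    (hS : IsMaximalTorusOf S (identityComponent (fixedSubgroup σ₁ ⊓ fixedSubgroup σ₂)))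
    (hT₁ : T₁ = centralizerIn (identityComponent (fixedSubgroup σ₁)) S)
    {B : LinearMap.BilinForm ℝ (RealLieAlg E G)}
    (hBsymm : ∀ X Y, B X Y = B Y X) (hBneg : ∀ X, X ≠ 0 → B X X < 0)
    (hBAd : ∀ g X Y, B (Ad E g X) (Ad E g Y) = B X Y) :
    InvolutionTorusData B (differential E σ₁) (realLieSubspace E S) (realLieSubspace E T₁)
      (realLieSubspace E (Subgroup.centralizer (T₁ : Set G))) := by
  have hB : IsInvariantForm (E := E) G B := ⟨hBsymm, hBneg, hBAd⟩
  have hKcl := isClosed_identityComponent (H := fixedSubgroup σ₁ ⊓ fixedSubgroup σ₂)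
    ((isClosed_fixedSubgroup hσ₁.continuous).inter (isClosed_fixedSubgroup hσ₂.continuous))
  have hST := hS.1.1
  have hScl := hST.isCompact.isClosed
  obtain ⟨n, hn, hσn⟩ := isOfFinOrder_iff_pow_eq_one.1 hfin
  have hSfix : ∀ X ∈ subLie E S, ∀ t, oneParam E G X t ∈ fixedSubgroup σ₁ ⊓ fixedSubgroup σ₂ :=
    fun X hX t => identityComponent_le _ (hS.1.2 ((mem_subLie_iff hScl).1 hX t))
  refine InvolutionTorusData.of_maximal (L := RealLieAlg E G) (n := n) (θ₂ := differential E σ₂)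
    hBsymm hBneg (form_bracketE E B hBAd) (diffOne_bracketE E hσ₁) (diffOne_bracketE E hσ₂)
    (iterate_diffOne hσ₁ hinv) hn (iterate_diffOne hσ₂ hσn) ?_ ?_ ?_ ?_ ?_ ?_ ?_
  · intro X
    exact (diffOne_mul E hσ₁ hσ₂ X).symm.trans
      ((congrArg (fun μ => diffOne E μ X) hcomm).trans (diffOne_mul E hσ₂ hσ₁ X))
  · exact fun X hX => (oneParam_mem_fixedSubgroup_iff hσ₁).1 fun t => (hSfix X hX t).1
  · exact fun X hX => (oneParam_mem_fixedSubgroup_iff hσ₂).1 fun t => (hSfix X hX t).2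
  · exact fun X hX Y hY => bracketE_eq_zero_of_commute E fun a b =>
      hST.comm _ ((mem_subLie_iff (E := E) hScl).1 hX a) _ ((mem_subLie_iff (E := E) hScl).1 hY b)
  · exact fun X h1 h2 h3 => mem_subLie_of_isMaximalTorusOf hB hKcl hS (oneParam_mem_identityComponent
      fun t => ⟨(oneParam_mem_fixedSubgroup_iff hσ₁).2 h1 t,
        (oneParam_mem_fixedSubgroup_iff hσ₂).2 h2 t⟩) h3
  · intro X
    rw [hT₁]
    exact mem_subLie_centralizerIn_iff hB hσ₁ hST
  · exact fun X => mem_subLie_centralizer_iff hB hσ₁ hST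
      (hS.1.2.trans (identityComponent_mono inf_le_left)) hT₁

end SubgroupLieAlgebras

end Assembly

end

end CommutingAutomorphisms

open CommutingAutomorphisms in
open scoped Classical in
theorem mainTheorem9
    {E : Type*} [NormedAddCommGroup E] [NormedSpace ℝ E] [FiniteDimensional ℝ E]
    {G : Type*} [TopologicalSpace G] [T2Space G] [ChartedSpace E G] [Group G]
    [LieGroup 𝓘(ℝ, E) ∞ G] [IsTopologicalGroup G] [CompactSpace G] [ConnectedSpace G]
    -- the commuting automorphisms
    (σ₁ σ₂ : MulAut G)
    (hσ₁ : ContMDiff 𝓘(ℝ, E) 𝓘(ℝ, E) ∞ σ₁) (hσ₂ : ContMDiff 𝓘(ℝ, E) 𝓘(ℝ, E) ∞ σ₂)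
    (hinv : σ₁ ^ 2 = 1) (hfin : IsOfFinOrder σ₂) (hcomm : Commute σ₁ σ₂)
    -- `K`, its maximal torus `S`, and `K₁`, `T₁`, `T`
    (K S K₁ T₁ T : Subgroup G)
    (hK : K = identityComponent (fixedSubgroup σ₁ ⊓ fixedSubgroup σ₂))
    (hS : IsMaximalTorusOf S K)
    (hK₁ : K₁ = identityComponent (fixedSubgroup σ₁))
    (hT₁ : T₁ = centralizerIn K₁ S)
    (hT : T = Subgroup.centralizer (T₁ : Set G))
    -- the invariant negative definite inner product on `𝔤_ℝ`
    (B : LinearMap.BilinForm ℝ (RealLieAlg E G))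
    (hBsymm : ∀ X Y, B X Y = B Y X) (hBneg : ∀ X, X ≠ 0 → B X X < 0)
    (hBAd : ∀ g X Y, B (Ad E g X) (Ad E g Y) = B X Y)
    (hBσ₁ : ∀ X Y, B (differential E σ₁ X) (differential E σ₁ Y) = B X Y)
    (hBσ₂ : ∀ X Y, B (differential E σ₂ X) (differential E σ₂ Y) = B X Y)
    -- the complexified Lie algebras of `S` and `T`, the roots `Ω`, and `Ω = Ω⁺ ⊔ -Ω⁺`
    (s t : Submodule ℂ (ComplexLieAlg E G))
    (hs : s = lieSubspace E S) (ht : t = lieSubspace E T)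
    (Ω Ωpos : Set (Module.Dual ℂ t))
    (hΩ : Ω = rootsVanishingOn t s)
    (hΩunion : Ω = Ωpos ∪ {α | -α ∈ Ωpos}) (hΩdisj : Disjoint Ωpos {α | -α ∈ Ωpos}) :
    (∀ α ∈ Ω, rootSpace t α ≤ Module.End.eigenspace (complexDifferential E σ₁) (-1)) ∧
    (∀ α ∈ Ω, ∀ h : t, ∃ hh : complexDifferential E σ₁⁻¹ (h : ComplexLieAlg E G) ∈ t,
      α ⟨complexDifferential E σ₁⁻¹ (h : ComplexLieAlg E G), hh⟩ = α h) ∧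
    (∀ α ∈ Ω, ∀ β ∈ Ω, α ≠ β → StronglyOrthogonal t α β) ∧
    (∀ α ∈ roots t, ∃! v : t, IsDualVector t (B.baseChange ℂ) α v) ∧
    (∀ H : Ωpos → t, (∀ α : Ωpos, IsDualVector t (B.baseChange ℂ) α (H α)) →
      DirectSum.IsInternal (kernelAndLines t Ωpos H)) := by
  subst hs ht hΩ hT hK hK₁
  have d := involutionTorusData σ₁ σ₂ hσ₁ hσ₂ hinv hfin hcomm hS hT₁ hBsymm hBneg hBAd
  have hσ₁inv : σ₁⁻¹ = σ₁ := inv_eq_of_mul_eq_one_left (by rw [← pow_two, hinv])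
  have hpos : ∀ α ∈ Ωpos, α ∈ rootsVanishingOn (lieSubspace E (Subgroup.centralizer (T₁ : Set G)))
      (lieSubspace E S) := fun α hα => hΩunion ▸ Or.inl hα
  refine ⟨fun α hα x hx => ?_, fun α hα h => ?_, fun α hα β hβ _ => d.stronglyOrthogonal hα hβ,
    fun α _ => d.existsUnique_isDualVector α, fun H hH => ?_⟩
  · rw [Module.End.mem_eigenspace_iff, neg_one_smul]
    exact d.baseChange_apply_eq_neg hα hx
  · rw [hσ₁inv]
    exact ⟨d.baseChange_mem h.2, d.apply_baseChange hα h⟩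
  · refine isInternal_kernelAndLines (fun α => d.apply_dualVector_ne_zero (hpos α α.2).1 (hH α))
      fun α β hαβ => d.apply_dualVector_eq_zero (hpos α α.2) (hpos β β.2)
        (fun h => hαβ (Subtype.ext h)) (fun h => ?_) (hH β)
    exact Set.disjoint_left.1 hΩdisj β.2 (show -(β : Module.Dual ℂ _) ∈ Ωpos from h ▸ α.2)
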